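/- Let $\kappa, v_0, U, H>0$ satisfy $\mathrm{Pe}=UH/\kappa\ge 1$ and $l/H\le 1$, where $l=\kappa/v_0$. Let $\Omega=\mathbb R\times[0,\pi H]$ and let $$u(x,y)=U\Big(\sin\tfrac xH\cos\tfrac yH,\ -\cos\tfrac xH\sin\tfrac yH\Big).$$ Let $f\in C^1[0,1]$ be a reaction term either of general KPP type ($f(0)=f(1)=0$, $f>0$ on $(0,1)$) or of ignition type ($f=0$ on $[0,\theta_0]\cup\{1\}$ and $f>0$ on $(\theta_0,1)$, for some $\theta_0\in(0,1)$), and let $\theta_1<\theta_4$ and $f_0,\zeta>0$ be such that $(\theta_1-\zeta,\theta_4+\zeta)\subset[0,1]$ and $f>f_0$ on $(\theta_1-\zeta,\theta_4+\zeta)$. Let $T(x,y,t)\in[0,1]$ be a classical solution of $$T_t+u\cdot\nabla T=\kappa\Delta T+\frac{v_0^2}{\kappa}f(T)\quad\text{in }\Omega,\ t>0,\qquad T(x,y,0)=T_0(x,y),$$ (continuous for $t\ge 0$ on $\Omega$, and at each time $t\ge0$ of class $C^1$ on $\Omega$ and $C^2$ in its interior), such that for all $t\ge0$, $T\to1$ as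 $x\to-\infty$, $T\to0$ as $x\to+\infty$, and either the Neumann conditions $T_y=0$ at $y=0$ and $y=\pi H$ hold, or the periodic conditions hold, i.e. $T$ and $T_y$ take the same values at $y=0$ and at $y=\pi H$. Suppose that the initial data satisfy $$\kappa\Delta T_0-u\cdot\nabla T_0+\frac{v_0^2}{\kappa}f(T_0)\ge0$$ and, for some $\lambda>0$, $1-T_0=O(e^{\lambda x})$ for $x<0$, $T_0=O(e^{-\lambda x})$ for $x>0$, and $|\nabla T_0|=O(e^{-\lambda|x|})$. Set $\tau_c=\kappa/v_0^2$ and $\tau_u=H/U$. Then, for every time $t>0$, $T_t(\cdot,\cdot,t)$ is integrable over $\Omega$, and the bulk burning rate $V(t)=\int_\Omega T_t(x,y,t)\,\frac{dx\,dy}{H}$ satisfies $$V(t)\ge\begin{cases}\Big(C_1\sqrt{\tau_c/\tau_u}+C_2\Big)v_0,&\text{if }\tau_c\le\tau_u,\\[4pt]\Big(C_1(\tau_c/\tau_u)^{1/5}+C_2\Big)v_0,&\text{if }\tau_c\ge\tau_u,\end{cases}$$ with constants $C_1,C_2>0$ that depend only on $f_0$, $\zeta$ and $\theta_4-\theta_1$.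 -/

import Mathlib

open Set Filter Topology MeasureTheory

noncomputable section

namespace CellularFlow

/-! ### Reaction terms -/

/-- General KPP type: `f ∈ C¹[0,1]`, `f(0) = f(1) = 0` and `f > 0` on `(0,1)`. -/
structure IsKPP (f : ℝ → ℝ) : Prop where
  smooth : ContDiffOn ℝ 1 f (Icc 0 1)
  zero : f 0 = 0
  one : f 1 = 0
  pos : ∀ s ∈ Ioo (0 : ℝ) 1, 0 < f s

/-- Ignition type: `f ∈ C¹[0,1]`, and for some ignition temperature `θ₀ ∈ (0,1)`, `f = 0` on
`[0,θ₀]` and at `1`, and `f > 0` on `(θ₀,1)`. -/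
def IsIgnition (f : ℝ → ℝ) : Prop :=
  ContDiffOn ℝ 1 f (Icc 0 1) ∧ f 1 = 0 ∧
    ∃ θ₀ ∈ Ioo (0 : ℝ) 1, (∀ s ∈ Icc 0 θ₀, f s = 0) ∧ ∀ s ∈ Ioo θ₀ 1, 0 < f s

/-- `f > f₀` on `(θ₁ - ζ, θ₄ + ζ)`, an interval inside the domain `[0,1]` of `f`. -/
structure ReactionBound (f : ℝ → ℝ) (f₀ ζ θ₁ θ₄ : ℝ) : Prop where
  left : 0 ≤ θ₁ - ζ
  right : θ₄ + ζ ≤ 1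
  lower : ∀ s ∈ Ioo (θ₁ - ζ) (θ₄ + ζ), f₀ < f s

/-! ### Geometry and partial derivatives

Points of the strip are pairs `p = (x, y)`; the strip is `ℝ × [0, πH]`. -/

/-- The strip `ℝ × [0, πH]`. -/
def closedStrip (H : ℝ) : Set (ℝ × ℝ) := univ ×ˢ Icc 0 (Real.pi * H)

/-- The open strip `ℝ × (0, πH)`. -/
def openStrip (H : ℝ) : Set (ℝ × ℝ) := univ ×ˢ Ioo 0 (Real.pi * H)

/-- `∂g/∂x`. -/
def dX (g : ℝ × ℝ → ℝ) (p : ℝ × ℝ) : ℝ := deriv (fun x => g (x, p.2)) p.1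

/-- `∂g/∂y`. -/
def dY (g : ℝ × ℝ → ℝ) (p : ℝ × ℝ) : ℝ := deriv (fun y => g (p.1, y)) p.2

/-- The Laplacian `∂²g/∂x² + ∂²g/∂y²`. -/
def lap (g : ℝ × ℝ → ℝ) (p : ℝ × ℝ) : ℝ := dX (dX g) p + dY (dY g) p

/-- `∂g/∂y` on the closed strip, one-sided at the edges `y = 0` and `y = πH`. -/
def dYclosed (H : ℝ) (g : ℝ × ℝ → ℝ) (x y : ℝ) : ℝ :=
  derivWithin (fun y' => g (x, y')) (Icc 0 (Real.pi * H)) y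

/-! ### The cellular flow and the reaction-advection-diffusion equation -/

/-- First component of the cellular flow, `U sin(x/H) cos(y/H)`. -/
def flowX (U H : ℝ) (p : ℝ × ℝ) : ℝ := U * (Real.sin (p.1 / H) * Real.cos (p.2 / H))

/-- Second component of the cellular flow, `-U cos(x/H) sin(y/H)`. -/
def flowY (U H : ℝ) (p : ℝ × ℝ) : ℝ := U * (-(Real.cos (p.1 / H) * Real.sin (p.2 / H)))

/-- `κ Δg - u · ∇g + (v₀²/κ) f(g)` for the cellular flow `u`. -/
def evolutionRHS (κ v₀ U H : ℝ) (f : ℝ → ℝ) (g : ℝ × ℝ → ℝ) (p : ℝ × ℝ) : ℝ :=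
  κ * lap g p - (flowX U H p * dX g p + flowY U H p * dY g p) + v₀ ^ 2 / κ * f (g p)

/-- `T` (evaluated as `T t (x, y)`) is a classical solution, with values in `[0,1]`, of
`T_t + u · ∇T = κ ΔT + (v₀²/κ) f(T)` in the strip for `t > 0`: it is continuous up to `t = 0`
and up to the edges, at each time it is `C¹` up to the edges and `C²` inside, and it is
differentiable in time for `t > 0`. -/
structure IsSolution (κ v₀ U H : ℝ) (f : ℝ → ℝ) (T : ℝ → ℝ × ℝ → ℝ) : Prop where
  mem_Icc : ∀ t, 0 ≤ t → ∀ p ∈ closedStrip H, T t p ∈ Icc (0 : ℝ) 1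
  cont : ContinuousOn (fun q : ℝ × (ℝ × ℝ) => T q.1 q.2) (Ici 0 ×ˢ closedStrip H)
  c1 : ∀ t, 0 ≤ t → ContDiffOn ℝ 1 (T t) (closedStrip H)
  c2 : ∀ t, 0 ≤ t → ContDiffOn ℝ 2 (T t) (openStrip H)
  diff_time : ∀ t, 0 < t → ∀ p ∈ openStrip H, DifferentiableAt ℝ (fun s => T s p) t
  equation : ∀ t, 0 < t → ∀ p ∈ openStrip H,
    deriv (fun s => T s p) t = evolutionRHS κ v₀ U H f (T t) p

/-- `T → 1` as `x → -∞` and `T → 0` as `x → +∞`. -/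
def FrontCondition (H : ℝ) (T : ℝ → ℝ × ℝ → ℝ) : Prop :=
  ∀ t, 0 ≤ t → ∀ y ∈ Icc 0 (Real.pi * H),
    Tendsto (fun x => T t (x, y)) atBot (𝓝 1) ∧ Tendsto (fun x => T t (x, y)) atTop (𝓝 0)

/-- Neumann conditions `T_y = 0` at `y = 0` and `y = πH`. -/
def NeumannCondition (H : ℝ) (T : ℝ → ℝ × ℝ → ℝ) : Prop :=
  ∀ t, 0 ≤ t → ∀ x, dYclosed H (T t) x 0 = 0 ∧ dYclosed H (T t) x (Real.pi * H) = 0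

/-- Periodic conditions: the values and the normal derivatives at `y = 0` and `y = πH` match, so
that `T` continues to a `πH`-periodic `C¹` function of `y`. -/
def PeriodicCondition (H : ℝ) (T : ℝ → ℝ × ℝ → ℝ) : Prop :=
  ∀ t, 0 ≤ t → ∀ x, T t (x, 0) = T t (x, Real.pi * H) ∧
    dYclosed H (T t) x 0 = dYclosed H (T t) x (Real.pi * H)

/-! ### Initial data -/

/-- `κ ΔT₀ - u · ∇T₀ + (v₀²/κ) f(T₀) ≥ 0`. -/
def InitiallyIncreasing (κ v₀ U H : ℝ) (f : ℝ → ℝ) (T₀ : ℝ × ℝ → ℝ) : Prop :=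
  ∀ p ∈ openStrip H, 0 ≤ evolutionRHS κ v₀ U H f T₀ p

/-- For some `lam > 0`: `1 - T₀ = O(e^{lam x})` for `x < 0`, `T₀ = O(e^{-lam x})` for `x > 0`, and
`|∇T₀| = O(e^{-lam |x|})`. -/
def ExponentialDecay (H : ℝ) (T₀ : ℝ × ℝ → ℝ) : Prop :=
  ∃ lam > 0, ∃ K : ℝ,
    (∀ p ∈ closedStrip H, p.1 < 0 → |1 - T₀ p| ≤ K * Real.exp (lam * p.1)) ∧
    (∀ p ∈ closedStrip H, 0 < p.1 → |T₀ p| ≤ K * Real.exp (-lam * p.1)) ∧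
    (∀ p ∈ openStrip H,
      Real.sqrt (dX T₀ p ^ 2 + dY T₀ p ^ 2) ≤ K * Real.exp (-lam * |p.1|))

/-! ### Burning rate and time scales -/

/-- `T_t` at time `t`. -/
def timeDeriv (T : ℝ → ℝ × ℝ → ℝ) (t : ℝ) (p : ℝ × ℝ) : ℝ := deriv (fun s => T s p) t

/-- The bulk burning rate `V(t) = ∫_Ω T_t(x,y,t) dx dy / H` (the edges of the strip are null). -/
def burningRate (H : ℝ) (T : ℝ → ℝ × ℝ → ℝ) (t : ℝ) : ℝ :=
  (∫ p in openStrip H, timeDeriv T t p) / H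

/-- The chemical reaction time `τ_c = κ / v₀²`. -/
def reactionTime (κ v₀ : ℝ) : ℝ := κ / v₀ ^ 2

/-- The turnover time `τ_u = H / U`. -/
def turnoverTime (U H : ℝ) : ℝ := H / U

end CellularFlow

end

/-! After dilation by `H` a time slice becomes `θ` on the strip of width `π`, with source `S = Δθ -
P u·∇θ + q f(θ)`, where `S = (H²/κ) T_t`, `q = (v₀H/κ)²` and `P = UH/κ`. The task is to bound `∫ S`
from below in units of `√q`; the quotient `X = ∫ S / √q` equals `V/v₀`, and `P/q = τ_c/τ_u`.

The initial datum is a subsolution, so the comparison principle makes `T` increase in time and `S ≥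
0` (`IsSolution.timeDeriv_nonneg`). Integrating the equation against `1` and against `θ` gives `∫ S
= q ∫ f(θ)` and `∫ |∇θ|² ≤ ∫ S` (`Profile.energy`), so `∫ S` controls the energy `∫ (|∇θ|² + q
f(θ))`. A segment of length at least one on which `θ` meets `[θ₁, θ₄]` costs energy of order `√q`
(`action_lower_bound`). Every horizontal line contains such a segment, whence `X ≥ c`; this settles
the case `τ_c ≤ τ_u`.

For strong advection, give each cell a mean temperature, weighted on a layer of width about `b`
along a streamline near its boundary. Inside a cell, the flow carries heat from one half to the
other, so the two half-cell means differ by a quantity divided by `P` (`Profile.transport_bound`).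
Across the line between neighbouring cells, diffusion keeps the means close, because the layers are
thin (`Profile.jump_bound`). The means must descend from near `1` to near `0`; a cell with an
intermediate mean costs energy of order `√q` (`Profile.mean_dichotomy`), so there are at most about
`X` of them, and the steps between them must add up to a fixed amount (`descent_le`). The best
choice of `b` and of the Young weights (`exists_quartic_bound`) gives `X⁴ ≥ c' P/q`. This is the
exponent `1/4`, which implies `1/5` when `τ_c ≥ τ_u`. -/

noncomputable section

namespace CellularFlow

/-! ### Linearity of the differential operators and the second-order condition at a minimum. -/

theorem differentiableAt_deriv_of_contDiffAt_two {h : ℝ → ℝ} {x : ℝ} (hh : ContDiffAt ℝ 2 h x) :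
    DifferentiableAt ℝ (deriv h) x := by
  have h1 : ContDiffAt ℝ 1 (fun y => fderiv ℝ h y 1) x :=
    (hh.fderiv_right (m := 1) (by norm_num)).clm_apply contDiffAt_const
  exact h1.differentiableAt (by norm_num)

theorem eventually_differentiableAt_of_contDiffAt_two {h : ℝ → ℝ} {x : ℝ}
    (hh : ContDiffAt ℝ 2 h x) : ∀ᶠ y in 𝓝 x, DifferentiableAt ℝ h y := by
  filter_upwards [hh.eventually (by simp)] with y hy using hy.differentiableAt (by norm_num)

theorem deriv_deriv_linear_comb {g h : ℝ → ℝ} {x : ℝ} (c d : ℝ) (hg : ContDiffAt ℝ 2 g x)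
    (hh : ContDiffAt ℝ 2 h x) :
    deriv (deriv fun y => c * g y + d * h y) x = c * deriv (deriv g) x + d * deriv (deriv h) x := by
  have h1 : deriv (fun y => c * g y + d * h y) =ᶠ[𝓝 x] fun y => c * deriv g y + d * deriv h y := by
    filter_upwards [eventually_differentiableAt_of_contDiffAt_two hg,
      eventually_differentiableAt_of_contDiffAt_two hh] with y h1 h2
    exact ((h1.hasDerivAt.const_mul c).add (h2.hasDerivAt.const_mul d)).deriv
  rw [h1.deriv_eq]
  exact (((differentiableAt_deriv_of_contDiffAt_two hg).hasDerivAt.const_mul c).add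
    ((differentiableAt_deriv_of_contDiffAt_two hh).hasDerivAt.const_mul d)).deriv

/-- A negative second derivative would make `x` a local maximum as well, so `h` would be constant
near `x` and its second derivative would vanish. -/
theorem IsLocalMin.deriv_deriv_nonneg {h : ℝ → ℝ} {x : ℝ} (hm : IsLocalMin h x)
    (hc : ContinuousAt h x) : 0 ≤ deriv (deriv h) x := by
  by_contra! hneg
  have hM := isLocalMax_of_deriv_deriv_neg hneg hm.deriv_eq_zero hc
  have he : h =ᶠ[𝓝 x] fun _ => h x := by
    filter_upwards [hm, hM] with y h1 h2 using le_antisymm h2 h1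
  have h2 : deriv h =ᶠ[𝓝 x] deriv fun _ => h x := he.deriv
  rw [h2.deriv_eq] at hneg
  simp at hneg

theorem contDiffAt_sliceX {n : WithTop ℕ∞} {g : ℝ × ℝ → ℝ} {p : ℝ × ℝ} (hg : ContDiffAt ℝ n g p) :
    ContDiffAt ℝ n (fun x => g (x, p.2)) p.1 :=
  ContDiffAt.comp p.1 (g := g) (f := fun x => (x, p.2)) hg (by fun_prop)

theorem contDiffAt_sliceY {n : WithTop ℕ∞} {g : ℝ × ℝ → ℝ} {p : ℝ × ℝ} (hg : ContDiffAt ℝ n g p) :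
    ContDiffAt ℝ n (fun y => g (p.1, y)) p.2 :=
  ContDiffAt.comp p.2 (g := g) (f := fun y => (p.1, y)) hg (by fun_prop)

theorem dX_linear_comb {g h : ℝ × ℝ → ℝ} {p : ℝ × ℝ} (c d : ℝ) (hg : ContDiffAt ℝ 1 g p)
    (hh : ContDiffAt ℝ 1 h p) : dX (fun r => c * g r + d * h r) p = c * dX g p + d * dX h p :=
  ((((contDiffAt_sliceX hg).differentiableAt (by norm_num)).hasDerivAt.const_mul c).add
    (((contDiffAt_sliceX hh).differentiableAt (by norm_num)).hasDerivAt.const_mul d)).deriv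

theorem dY_linear_comb {g h : ℝ × ℝ → ℝ} {p : ℝ × ℝ} (c d : ℝ) (hg : ContDiffAt ℝ 1 g p)
    (hh : ContDiffAt ℝ 1 h p) : dY (fun r => c * g r + d * h r) p = c * dY g p + d * dY h p :=
  ((((contDiffAt_sliceY hg).differentiableAt (by norm_num)).hasDerivAt.const_mul c).add
    (((contDiffAt_sliceY hh).differentiableAt (by norm_num)).hasDerivAt.const_mul d)).deriv

theorem lap_linear_comb {g h : ℝ × ℝ → ℝ} {p : ℝ × ℝ} (c d : ℝ) (hg : ContDiffAt ℝ 2 g p)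
    (hh : ContDiffAt ℝ 2 h p) : lap (fun r => c * g r + d * h r) p = c * lap g p + d * lap h p := by
  have h1 := deriv_deriv_linear_comb c d (contDiffAt_sliceX hg) (contDiffAt_sliceX hh)
  have h2 := deriv_deriv_linear_comb c d (contDiffAt_sliceY hg) (contDiffAt_sliceY hh)
  have e : lap (fun r => c * g r + d * h r) p =
    deriv (deriv fun y => c * g (y, p.2) + d * h (y, p.2)) p.1 +
    deriv (deriv fun y => c * g (p.1, y) + d * h (p.1, y)) p.2 := rfl
  rw [e, h1, h2]
  have e1 : ∀ g : ℝ × ℝ → ℝ, lap g p = deriv (deriv fun y => g (y, p.2)) p.1 +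
    deriv (deriv fun y => g (p.1, y)) p.2 := fun _ => rfl
  rw [e1, e1]; ring

/-! ### The maximum principle on the unbounded strip. -/

theorem isOpen_openStrip (H : ℝ) : IsOpen (openStrip H) := isOpen_univ.prod isOpen_Ioo

theorem openStrip_subset_closedStrip (H : ℝ) : openStrip H ⊆ closedStrip H :=
  prod_mono subset_rfl Ioo_subset_Icc_self

/-- Existence of one-sided normal derivatives at the edges which satisfy the Neumann or the
periodic condition. -/
def EdgeCondition (H : ℝ) (g : ℝ × ℝ → ℝ) : Prop :=
  ∀ x, ∃ a b, HasDerivWithinAt (fun y => g (x, y)) a (Icc 0 (Real.pi * H)) 0 ∧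
    HasDerivWithinAt (fun y => g (x, y)) b (Icc 0 (Real.pi * H)) (Real.pi * H) ∧ a = b ∧
    (a = 0 ∨ g (x, 0) = g (x, Real.pi * H))

/-- A weight that grows at infinity and whose normal derivatives at the two edges point outwards. -/
def barrier (H : ℝ) (p : ℝ × ℝ) : ℝ := 1 + p.1 ^ 2 + (p.2 - Real.pi * H / 2) ^ 2

theorem one_le_barrier (H : ℝ) (p : ℝ × ℝ) : 1 ≤ barrier H p := by
  unfold barrier; nlinarith [sq_nonneg p.1, sq_nonneg (p.2 - Real.pi * H / 2)]

theorem contDiff_barrier (H : ℝ) : ContDiff ℝ 2 (barrier H) := by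
  unfold barrier; fun_prop

theorem hasDerivAt_barrier_fst (H : ℝ) (x y : ℝ) :
    HasDerivAt (fun x => barrier H (x, y)) (2 * x) x := by
  have := ((hasDerivAt_pow 2 x).const_add 1).add_const ((y - Real.pi * H / 2) ^ 2)
  simpa [barrier] using this

theorem hasDerivAt_barrier_snd (H : ℝ) (x y : ℝ) :
    HasDerivAt (fun y => barrier H (x, y)) (2 * (y - Real.pi * H / 2)) y := by
  have := ((((hasDerivAt_id y).sub_const (Real.pi * H / 2)).pow 2).const_add (1 + x ^ 2))
  simpa [barrier] using this

theorem dX_barrier (H : ℝ) (p : ℝ × ℝ) : dX (barrier H) p = 2 * p.1 :=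
  (hasDerivAt_barrier_fst H p.1 p.2).deriv

theorem dY_barrier (H : ℝ) (p : ℝ × ℝ) : dY (barrier H) p = 2 * (p.2 - Real.pi * H / 2) :=
  (hasDerivAt_barrier_snd H p.1 p.2).deriv

theorem lap_barrier (H : ℝ) (p : ℝ × ℝ) : lap (barrier H) p = 4 := by
  have e : lap (barrier H) p = deriv (deriv fun y => barrier H (y, p.2)) p.1 +
    deriv (deriv fun y => barrier H (p.1, y)) p.2 := rfl
  have h1 : (deriv fun y => barrier H (y, p.2)) = fun y => 2 * y :=
    funext fun y => (hasDerivAt_barrier_fst H y p.2).deriv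
  have h2 : (deriv fun y => barrier H (p.1, y)) = fun y => 2 * (y - Real.pi * H / 2) :=
    funext fun y => (hasDerivAt_barrier_snd H p.1 y).deriv
  have h3 : HasDerivAt (fun y : ℝ => 2 * y) 2 p.1 := by
    simpa using (hasDerivAt_id p.1).const_mul (2 : ℝ)
  have h4 : HasDerivAt (fun y : ℝ => 2 * (y - Real.pi * H / 2)) 2 p.2 := by
    simpa using ((hasDerivAt_id p.2).sub_const (Real.pi * H / 2)).const_mul (2 : ℝ)
  rw [e, h1, h2, h3.deriv, h4.deriv]; norm_num

theorem abs_flowX_le {U : ℝ} (hU : 0 ≤ U) (H : ℝ) (p : ℝ × ℝ) : |flowX U H p| ≤ U := by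
  unfold flowX
  rw [abs_mul, abs_mul, abs_of_nonneg hU]
  have := mul_le_one₀ (Real.abs_sin_le_one (p.1 / H)) (abs_nonneg _) (Real.abs_cos_le_one (p.2 / H))
  nlinarith

theorem abs_flowY_le {U : ℝ} (hU : 0 ≤ U) (H : ℝ) (p : ℝ × ℝ) : |flowY U H p| ≤ U := by
  unfold flowY
  rw [abs_mul, abs_neg, abs_mul, abs_of_nonneg hU]
  have := mul_le_one₀ (Real.abs_cos_le_one (p.1 / H)) (abs_nonneg _) (Real.abs_sin_le_one (p.2 / H))
  nlinarith

/-- The flow is bounded by `U` and `2|s| ≤ 1 + s²`, so the linear growth of the barrier's gradient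
is absorbed by its quadratic growth. -/
theorem drift_barrier_le {U : ℝ} (hU : 0 ≤ U) (H : ℝ) (p : ℝ × ℝ) :
    |flowX U H p * dX (barrier H) p + flowY U H p * dY (barrier H) p| ≤ 2 * U * barrier H p := by
  rw [dX_barrier, dY_barrier]
  have h1 := abs_flowX_le hU H p
  have h2 := abs_flowY_le hU H p
  have h3 : |flowX U H p * (2 * p.1)| ≤ U * (1 + p.1 ^ 2) := by
    rw [abs_mul]
    refine mul_le_mul h1 ?_ (abs_nonneg _) hU
    rw [abs_le]; constructor <;> nlinarith [sq_nonneg (p.1 - 1), sq_nonneg (p.1 + 1)]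
  have h4 : |flowY U H p * (2 * (p.2 - Real.pi * H / 2))| ≤
      U * (1 + (p.2 - Real.pi * H / 2) ^ 2) := by
    rw [abs_mul]
    refine mul_le_mul h2 ?_ (abs_nonneg _) hU
    rw [abs_le]; constructor <;> nlinarith [sq_nonneg (p.2 - Real.pi * H / 2 - 1),
      sq_nonneg (p.2 - Real.pi * H / 2 + 1)]
  refine (abs_add_le _ _).trans ?_
  unfold barrier
  nlinarith [mul_nonneg hU (sq_nonneg p.1), mul_nonneg hU (sq_nonneg (p.2 - Real.pi * H / 2))]

theorem deriv_nonneg_of_min_left {h : ℝ → ℝ} {a l r : ℝ} (hlr : l < r)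
    (hd : HasDerivWithinAt h a (Icc l r) l) (hm : ∀ y ∈ Icc l r, h l ≤ h y) : 0 ≤ a := by
  have h1 : IsLocalMinOn h (Icc l r) l := IsMinOn.localize (fun y hy => hm y hy)
  have h2 := h1.hasFDerivWithinAt_nonneg hd.hasFDerivWithinAt (y := r - l)
    (mem_posTangentConeAt_of_segment_subset (by
      rw [segment_eq_Icc (by linarith)]; ring_nf; exact subset_rfl))
  simp at h2
  nlinarith

theorem deriv_nonpos_of_min_right {h : ℝ → ℝ} {a l r : ℝ} (hlr : l < r)
    (hd : HasDerivWithinAt h a (Icc l r) r) (hm : ∀ y ∈ Icc l r, h r ≤ h y) : a ≤ 0 := by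
  have h1 : IsLocalMinOn h (Icc l r) r := IsMinOn.localize (fun y hy => hm y hy)
  have h2 := h1.hasFDerivWithinAt_nonneg hd.hasFDerivWithinAt (y := l - r)
    (mem_posTangentConeAt_of_segment_subset (by
      rw [segment_symm, segment_eq_Icc (by linarith)]; ring_nf; exact subset_rfl))
  simp at h2
  nlinarith

set_option maxHeartbeats 1000000 in
-- Barrier argument. The function `z = e^{-Kt} w + ε barrier` is positive for large `|x|`, so if it
-- is negative somewhere it attains a negative minimum, at a positive time. The barrier's outward
-- normal derivatives exclude a minimum on an edge. At an interior minimum the gradient of `z`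
-- vanishes, its Laplacian is nonnegative and its time derivative is nonpositive, which contradicts
-- the differential inequality once `K` is large. That inequality is needed only where `w` is
-- negative.
theorem max_principle {κ U H L M t₀ : ℝ} (hκ : 0 < κ) (hU : 0 ≤ U) (hH : 0 < H)
    {w : ℝ → ℝ × ℝ → ℝ}
    (hcont : ContinuousOn (fun q : ℝ × (ℝ × ℝ) => w q.1 q.2) (Icc 0 t₀ ×ˢ closedStrip H))
    (hM : ∀ t ∈ Icc 0 t₀, ∀ p ∈ closedStrip H, -M ≤ w t p)
    (h0 : ∀ p ∈ closedStrip H, 0 ≤ w 0 p)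
    (hc2 : ∀ t ∈ Ioc 0 t₀, ContDiffOn ℝ 2 (w t) (openStrip H))
    (hdt : ∀ t ∈ Ioc 0 t₀, ∀ p ∈ openStrip H, DifferentiableAt ℝ (fun s => w s p) t)
    (hedge : ∀ t ∈ Ioc 0 t₀, EdgeCondition H (w t))
    (hpde : ∀ t ∈ Ioc 0 t₀, ∀ p ∈ openStrip H, w t p < 0 →
      κ * lap (w t) p - (flowX U H p * dX (w t) p + flowY U H p * dY (w t) p) + L * w t p
        ≤ deriv (fun s => w s p) t) :
    ∀ t ∈ Icc 0 t₀, ∀ p ∈ closedStrip H, 0 ≤ w t p := by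
  intro t₁ ht₁ p₁ hp₁
  by_contra! hneg
  have hW : 0 < Real.pi * H := by positivity
  -- Besides `L`, the rate `K` must beat `κ Δ barrier = 4κ` and the drift of the barrier, at most
  -- `2U barrier`; recall `1 ≤ barrier`.
  set K : ℝ := |L| + 4 * κ + 2 * U + 1 with hK
  have hK0 : 0 < K := by positivity
  have hB := one_le_barrier H
  -- Half of the value that would raise `z` to zero at `(t₁, p₁)`.
  set ε : ℝ := -(Real.exp (-K * t₁) * w t₁ p₁) / (2 * barrier H p₁) with hε
  have hBp : 0 < barrier H p₁ := by linarith [hB p₁]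
  have hE₁ := Real.exp_pos (-K * t₁)
  have hε0 : 0 < ε := by
    apply div_pos
    · nlinarith
    · positivity
  set z : ℝ → ℝ × ℝ → ℝ := fun t p => Real.exp (-K * t) * w t p + ε * barrier H p with hz
  have hz₁ : z t₁ p₁ < 0 := by
    have : ε * barrier H p₁ = -(Real.exp (-K * t₁) * w t₁ p₁) / 2 := by
      rw [hε]; field_simp
    simp only [hz, this]
    nlinarith
  have hexp1 : ∀ t ∈ Icc 0 t₀, Real.exp (-K * t) ≤ 1 := fun t ht =>
    Real.exp_le_one_iff.2 (by nlinarith [ht.1])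
  have hzlow : ∀ t ∈ Icc 0 t₀, ∀ p ∈ closedStrip H, -|M| + ε * (1 + p.1 ^ 2) ≤ z t p := by
    intro t ht p hp
    have h1 : -|M| ≤ Real.exp (-K * t) * w t p := by
      have h2 := hM t ht p hp
      have h3 := hexp1 t ht
      have h4 := Real.exp_pos (-K * t)
      have h5 : -|M| ≤ w t p := by linarith [le_abs_self M]
      nlinarith [abs_nonneg M]
    have h2 : ε * (1 + p.1 ^ 2) ≤ ε * barrier H p :=
      mul_le_mul_of_nonneg_left (by unfold barrier; nlinarith [sq_nonneg (p.2 - Real.pi * H / 2)])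
        hε0.le
    simp only [hz]; linarith
  -- With `R ≥ 1` and `|M| ≤ εR`, the term `ε(1 + x²)` outweighs `|M|` as soon as `|x| ≥ R`.
  set R : ℝ := 1 + |M| / ε with hR
  have hR1 : 1 ≤ R := by rw [hR]; have : 0 ≤ |M| / ε := by positivity
                         linarith
  have hRM : |M| ≤ ε * R := by rw [hR]; field_simp; linarith
  have hfar : ∀ t ∈ Icc 0 t₀, ∀ p ∈ closedStrip H, R ≤ |p.1| → 0 < z t p := by
    intro t ht p hp hx
    have h1 := hzlow t ht p hp
    have h2 : R ≤ p.1 ^ 2 := by rw [← sq_abs]; nlinarith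
    nlinarith
  have hcomp : IsCompact (Icc 0 t₀ ×ˢ (Icc (-R) R ×ˢ Icc 0 (Real.pi * H))) :=
    isCompact_Icc.prod (isCompact_Icc.prod isCompact_Icc)
  have hzc : ContinuousOn (fun q : ℝ × (ℝ × ℝ) => z q.1 q.2) (Icc 0 t₀ ×ˢ closedStrip H) := by
    have := (contDiff_barrier H).continuous
    apply ContinuousOn.add
    · exact ContinuousOn.mul (by fun_prop) hcont
    · fun_prop
  have hmem₁ : (t₁, p₁) ∈ Icc 0 t₀ ×ˢ (Icc (-R) R ×ˢ Icc 0 (Real.pi * H)) := by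
    refine ⟨ht₁, ?_, hp₁.2⟩
    by_contra hx
    have : R ≤ |p₁.1| := by
      by_contra! h
      exact hx ⟨(abs_lt.1 h).1.le, (abs_lt.1 h).2.le⟩
    linarith [hfar t₁ ht₁ p₁ hp₁ this]
  obtain ⟨⟨ts, ps⟩, hs, hmin⟩ := hcomp.exists_isMinOn ⟨_, hmem₁⟩
    (hzc.mono (prod_mono subset_rfl (prod_mono (subset_univ _) subset_rfl)))
  have hts : ts ∈ Icc 0 t₀ := hs.1
  have hps : ps ∈ closedStrip H := ⟨mem_univ _, hs.2.2⟩
  have hzs : z ts ps < 0 := lt_of_le_of_lt (hmin hmem₁) hz₁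
  have hglob : ∀ t ∈ Icc 0 t₀, ∀ p ∈ closedStrip H, z ts ps ≤ z t p := by
    intro t ht p hp
    by_cases hx : |p.1| ≤ R
    · exact hmin (show (t, p) ∈ _ from ⟨ht, abs_le.1 hx, hp.2⟩)
    · linarith [hfar t ht p hp (by linarith)]
  have hts0 : 0 < ts := by
    rcases hts.1.lt_or_eq with h | h
    · exact h
    · exfalso
      have h1 := h0 ps hps
      have : 0 < z ts ps := by
        simp only [hz, ← h]
        have := Real.exp_pos (-K * 0)
        have := hB ps
        nlinarith [mul_nonneg (Real.exp_pos (-K * 0)).le h1]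
      linarith
  have htsI : ts ∈ Ioc 0 t₀ := ⟨hts0, hts.2⟩
  set E : ℝ := Real.exp (-K * ts) with hEdef
  have hE : 0 < E := Real.exp_pos _
  obtain ⟨a, b, ha, hb, hab, hor⟩ := hedge ts htsI ps.1
  have hza : HasDerivWithinAt (fun y => z ts (ps.1, y)) (E * a + ε * (2 * (0 - Real.pi * H / 2)))
      (Icc 0 (Real.pi * H)) 0 :=
    (ha.const_mul E).add ((hasDerivAt_barrier_snd H ps.1 0).const_mul ε).hasDerivWithinAt
  have hzb : HasDerivWithinAt (fun y => z ts (ps.1, y))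
      (E * b + ε * (2 * (Real.pi * H - Real.pi * H / 2)))
      (Icc 0 (Real.pi * H)) (Real.pi * H) :=
    (hb.const_mul E).add
      ((hasDerivAt_barrier_snd H ps.1 (Real.pi * H)).const_mul ε).hasDerivWithinAt
  have hεW : 0 < ε * (Real.pi * H) := by positivity
  -- The barrier is symmetric about the midline, so under periodic conditions a minimum at one edge
  -- is also a minimum at the other. The two one-sided conditions then read `a > 0` and `b < 0`,
  -- against `a = b`; under Neumann conditions either one alone contradicts `a = b = 0`.
  have hedges : w ts (ps.1, 0) = w ts (ps.1, Real.pi * H) →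
      z ts (ps.1, 0) = z ts (ps.1, Real.pi * H) := by
    intro h
    simp only [hz, h, barrier]; ring
  have hcol : ∀ y ∈ Icc 0 (Real.pi * H), z ts ps ≤ z ts (ps.1, y) := fun y hy =>
    hglob ts hts (ps.1, y) ⟨mem_univ _, hy⟩
  have hl : z ts ps = z ts (ps.1, 0) → 0 < a := fun h => by
    have := deriv_nonneg_of_min_left hW hza (fun y hy => by simpa [h] using hcol y hy)
    by_contra! h'
    nlinarith
  have hr : z ts ps = z ts (ps.1, Real.pi * H) → b < 0 := fun h => by
    have := deriv_nonpos_of_min_right hW hzb (fun y hy => by simpa [h] using hcol y hy)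
    by_contra! h'
    nlinarith
  have hy0 : ps.2 ≠ 0 := by
    intro h
    have e : z ts ps = z ts (ps.1, 0) := by rw [← h]
    have h1 := hl e
    rcases hor with h2 | h2
    · linarith
    · have := hr (e.trans (hedges h2)); linarith
  have hyW : ps.2 ≠ Real.pi * H := by
    intro h
    have e : z ts ps = z ts (ps.1, Real.pi * H) := by rw [← h]
    have h1 := hr e
    rcases hor with h2 | h2
    · linarith
    · have := hl (e.trans (hedges h2).symm); linarith
  have hpo : ps ∈ openStrip H :=
    ⟨mem_univ _, lt_of_le_of_ne hps.2.1 (Ne.symm hy0), lt_of_le_of_ne hps.2.2 hyW⟩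
  have hmem : openStrip H ∈ 𝓝 ps := (isOpen_openStrip H).mem_nhds hpo
  have hwc : ContDiffAt ℝ 2 (w ts) ps := (hc2 ts htsI).contDiffAt hmem
  have hbc : ContDiffAt ℝ 2 (barrier H) ps := (contDiff_barrier H).contDiffAt
  have hloc : IsLocalMin (z ts) ps := by
    filter_upwards [hmem] with p hp using hglob ts hts p (openStrip_subset_closedStrip H hp)
  have hzc2 : ContDiffAt ℝ 2 (z ts) ps := (contDiffAt_const.mul hwc).add (contDiffAt_const.mul hbc)
  have hlx : IsLocalMin (fun x => z ts (x, ps.2)) ps.1 :=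
    IsLocalMin.comp_continuous (g := fun x : ℝ => (x, ps.2)) hloc (by fun_prop)
  have hly : IsLocalMin (fun y => z ts (ps.1, y)) ps.2 :=
    IsLocalMin.comp_continuous (g := fun y : ℝ => (ps.1, y)) hloc (by fun_prop)
  have hgx : dX (z ts) ps = 0 := hlx.deriv_eq_zero
  have hgy : dY (z ts) ps = 0 := hly.deriv_eq_zero
  have hlap : 0 ≤ lap (z ts) ps :=
    add_nonneg (IsLocalMin.deriv_deriv_nonneg hlx (contDiffAt_sliceX hzc2).continuousAt)
      (IsLocalMin.deriv_deriv_nonneg hly (contDiffAt_sliceY hzc2).continuousAt)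
  have e1 : dX (z ts) ps = E * dX (w ts) ps + ε * dX (barrier H) ps :=
    dX_linear_comb E ε (hwc.of_le (by norm_num)) (hbc.of_le (by norm_num))
  have e2 : dY (z ts) ps = E * dY (w ts) ps + ε * dY (barrier H) ps :=
    dY_linear_comb E ε (hwc.of_le (by norm_num)) (hbc.of_le (by norm_num))
  have e3 : lap (z ts) ps = E * lap (w ts) ps + ε * lap (barrier H) ps :=
    lap_linear_comb E ε hwc hbc
  rw [lap_barrier] at e3
  have hdr := drift_barrier_le hU H ps
  -- The minimum may occur at the final time, so only minimality over `[0, ts]` is used.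
  have htime : E * deriv (fun s => w s ps) ts - K * E * w ts ps ≤ 0 := by
    have hexp : HasDerivAt (fun s => Real.exp (-K * s)) (E * (-K)) ts := by
      simpa [hEdef] using ((hasDerivAt_id ts).const_mul (-K)).exp
    have hd : HasDerivAt (fun s => z s ps)
        (E * (-K) * w ts ps + E * deriv (fun s => w s ps) ts) ts :=
      (hexp.mul (hdt ts htsI ps hpo).hasDerivAt).add_const _
    have := deriv_nonpos_of_min_right hts0 (hd.hasDerivWithinAt (s := Icc 0 ts))
      (fun s hs' => hglob s ⟨hs'.1, hs'.2.trans hts.2⟩ ps hps)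
    linarith
  have hwneg : E * w ts ps < -(ε * barrier H ps) := by
    have : z ts ps = E * w ts ps + ε * barrier H ps := rfl
    linarith
  have hBs := hB ps
  have hwn : w ts ps < 0 := by
    by_contra! h
    nlinarith [mul_nonneg hE.le h]
  have hp := mul_le_mul_of_nonneg_left (hpde ts htsI ps hpo hwn) hE.le
  have hfin : E * (κ * lap (w ts) ps - (flowX U H ps * dX (w ts) ps + flowY U H ps * dY (w ts) ps)
      + L * w ts ps) = κ * (lap (z ts) ps - ε * 4) + ε * (flowX U H ps * dX (barrier H) ps +
        flowY U H ps * dY (barrier H) ps) + L * (E * w ts ps) := by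
    have e4 : E * lap (w ts) ps = lap (z ts) ps - ε * 4 := by rw [e3]; ring
    have e5 : E * dX (w ts) ps = -(ε * dX (barrier H) ps) := by linarith
    have e6 : E * dY (w ts) ps = -(ε * dY (barrier H) ps) := by linarith
    rw [← e4]
    linear_combination (-flowX U H ps) * e5 - flowY U H ps * e6
  rw [hfin] at hp
  have h7 : -(ε * (2 * U * barrier H ps)) ≤ ε * (flowX U H ps * dX (barrier H) ps +
        flowY U H ps * dY (barrier H) ps) := by
    rw [← mul_neg]
    exact mul_le_mul_of_nonneg_left (abs_le.1 hdr).1 hε0.le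
  have h8 : 0 ≤ κ * lap (z ts) ps := by positivity
  have h9 : (K - L) * (E * w ts ps) < -((4 * κ + 2 * U + 1) * (ε * barrier H ps)) := by
    have hKL : 4 * κ + 2 * U + 1 ≤ K - L := by rw [hK]; linarith [le_abs_self L]
    have h1 : 0 < ε * barrier H ps := by positivity
    have h2 : (K - L) * (E * w ts ps) < (K - L) * -(ε * barrier H ps) :=
      mul_lt_mul_of_pos_left hwneg (by linarith)
    have h3 := mul_le_mul_of_nonneg_right hKL h1.le
    linarith
  have h10 : κ * (ε * 4) ≤ 4 * κ * (ε * barrier H ps) := by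
    have : ε ≤ ε * barrier H ps := by nlinarith
    nlinarith
  have h11 : 0 < ε * barrier H ps := by positivity
  linarith

/-! ### The reaction term and the comparison principle. -/

theorem exists_lipschitz_of_contDiffOn {f : ℝ → ℝ} (hf : ContDiffOn ℝ 1 f (Icc 0 1)) :
    ∃ Λ : ℝ, 0 ≤ Λ ∧ ∀ a ∈ Icc (0 : ℝ) 1, ∀ b ∈ Icc (0 : ℝ) 1, |f a - f b| ≤ Λ * |a - b| := by
  have hu := uniqueDiffOn_Icc (zero_lt_one (α := ℝ))
  have hc : ContinuousOn (derivWithin f (Icc 0 1)) (Icc 0 1) :=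
    hf.continuousOn_derivWithin hu (by norm_num)
  obtain ⟨C, hC⟩ := isCompact_Icc.exists_bound_of_continuousOn hc
  refine ⟨|C|, abs_nonneg _, fun a ha b hb => ?_⟩
  have := Convex.norm_image_sub_le_of_norm_derivWithin_le (hf.differentiableOn (by norm_num))
    (fun x hx => (hC x hx).trans (le_abs_self C)) (convex_Icc 0 1) hb ha
  simpa [Real.norm_eq_abs] using this

theorem reaction_contDiffOn {f : ℝ → ℝ} (hf : IsKPP f ∨ IsIgnition f) :
    ContDiffOn ℝ 1 f (Icc 0 1) := hf.elim (fun h => h.smooth) (fun h => h.1)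

theorem reaction_zero {f : ℝ → ℝ} (hf : IsKPP f ∨ IsIgnition f) : f 0 = 0 := by
  rcases hf with h | ⟨-, -, θ₀, h0, h1, -⟩
  · exact h.zero
  · exact h1 0 ⟨le_rfl, h0.1.le⟩

theorem reaction_one {f : ℝ → ℝ} (hf : IsKPP f ∨ IsIgnition f) : f 1 = 0 :=
  hf.elim (fun h => h.one) (fun h => h.2.1)

theorem reaction_nonneg {f : ℝ → ℝ} (hf : IsKPP f ∨ IsIgnition f) {s : ℝ} (hs : s ∈ Icc (0 : ℝ) 1) :
    0 ≤ f s := by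
  rcases hs.1.lt_or_eq with h0 | h0
  · rcases hs.2.lt_or_eq with h1 | h1
    · rcases hf with h | ⟨-, -, θ₀, ht, h2, h3⟩
      · exact (h.pos s ⟨h0, h1⟩).le
      · by_cases h : s ≤ θ₀
        · exact (h2 s ⟨hs.1, h⟩).ge
        · exact (h3 s ⟨by linarith, h1⟩).le
    · rw [h1, reaction_one hf]
  · rw [← h0, reaction_zero hf]

theorem hasDerivWithinAt_dYclosed {H : ℝ} {g : ℝ × ℝ → ℝ} (hg : ContDiffOn ℝ 1 g (closedStrip H))
    (x : ℝ) {y : ℝ} (hy : y ∈ Icc 0 (Real.pi * H)) :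
    HasDerivWithinAt (fun y' => g (x, y')) (dYclosed H g x y) (Icc 0 (Real.pi * H)) y := by
  have h1 : DifferentiableWithinAt ℝ g (closedStrip H) (x, y) :=
    (hg.differentiableOn (by norm_num)) _ ⟨mem_univ _, hy⟩
  have h2 : DifferentiableWithinAt ℝ (fun y' => g (x, y')) (Icc 0 (Real.pi * H)) y :=
    DifferentiableWithinAt.comp y (g := g) (f := fun y' => (x, y')) h1 (by fun_prop)
      (fun y' hy' => ⟨mem_univ _, hy'⟩)
  exact h2.hasDerivWithinAt

theorem edgeCondition_linear_comb {H : ℝ} (hH : 0 < H) {T : ℝ → ℝ × ℝ → ℝ}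
    (hc1 : ∀ t, 0 ≤ t → ContDiffOn ℝ 1 (T t) (closedStrip H))
    (hb : NeumannCondition H T ∨ PeriodicCondition H T) {s t : ℝ} (hs : 0 ≤ s) (ht : 0 ≤ t)
    (c d : ℝ) (k : ℝ → ℝ) : EdgeCondition H (fun p => c * T s p + d * T t p + k p.1) := by
  intro x
  have hW : 0 < Real.pi * H := by positivity
  have h0 : (0 : ℝ) ∈ Icc 0 (Real.pi * H) := ⟨le_rfl, hW.le⟩
  have h1 : Real.pi * H ∈ Icc 0 (Real.pi * H) := ⟨hW.le, le_rfl⟩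
  have key : ∀ {y : ℝ}, y ∈ Icc 0 (Real.pi * H) →
      HasDerivWithinAt (fun y' => c * T s (x, y') + d * T t (x, y') + k x)
        (c * dYclosed H (T s) x y + d * dYclosed H (T t) x y) (Icc 0 (Real.pi * H)) y := fun hy =>
    (((hasDerivWithinAt_dYclosed (hc1 s hs) x hy).const_mul c).add
      ((hasDerivWithinAt_dYclosed (hc1 t ht) x hy).const_mul d)).add_const _
  refine ⟨_, _, key h0, key h1, ?_⟩
  rcases hb with hb | hb
  · rw [(hb s hs x).1, (hb s hs x).2, (hb t ht x).1, (hb t ht x).2]; simp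
  · refine ⟨?_, Or.inr ?_⟩
    · rw [(hb s hs x).2, (hb t ht x).2]
    · simp only [(hb s hs x).1, (hb t ht x).1]

/-- Where `v < g`, the Lipschitz bound gives `f(v) - f(g) ≥ Λ (v - g)`. So `v - g` satisfies a
linear inequality with zero-order coefficient `v₀² Λ / κ` exactly where `max_principle` asks for
one. -/
theorem comparison {κ v₀ U H t₀ : ℝ} (hκ : 0 < κ) (hU : 0 ≤ U) (hH : 0 < H) {f : ℝ → ℝ}
    (hf : ContDiffOn ℝ 1 f (Icc 0 1)) {g v : ℝ → ℝ × ℝ → ℝ}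
    (hgc : ContinuousOn (fun q : ℝ × (ℝ × ℝ) => g q.1 q.2) (Icc 0 t₀ ×ˢ closedStrip H))
    (hvc : ContinuousOn (fun q : ℝ × (ℝ × ℝ) => v q.1 q.2) (Icc 0 t₀ ×ˢ closedStrip H))
    (hgI : ∀ t ∈ Icc 0 t₀, ∀ p ∈ closedStrip H, g t p ∈ Icc (0 : ℝ) 1)
    (hvI : ∀ t ∈ Icc 0 t₀, ∀ p ∈ closedStrip H, v t p ∈ Icc (0 : ℝ) 1)
    (h0 : ∀ p ∈ closedStrip H, g 0 p ≤ v 0 p)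
    (hg2 : ∀ t ∈ Ioc 0 t₀, ContDiffOn ℝ 2 (g t) (openStrip H))
    (hv2 : ∀ t ∈ Ioc 0 t₀, ContDiffOn ℝ 2 (v t) (openStrip H))
    (hgt : ∀ t ∈ Ioc 0 t₀, ∀ p ∈ openStrip H, DifferentiableAt ℝ (fun s => g s p) t)
    (hvt : ∀ t ∈ Ioc 0 t₀, ∀ p ∈ openStrip H, DifferentiableAt ℝ (fun s => v s p) t)
    (hedge : ∀ t ∈ Ioc 0 t₀, EdgeCondition H (fun p => 1 * v t p + (-1) * g t p))
    (hge : ∀ t ∈ Ioc 0 t₀, ∀ p ∈ openStrip H,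
      deriv (fun s => g s p) t ≤ evolutionRHS κ v₀ U H f (g t) p)
    (hve : ∀ t ∈ Ioc 0 t₀, ∀ p ∈ openStrip H,
      evolutionRHS κ v₀ U H f (v t) p ≤ deriv (fun s => v s p) t) :
    ∀ t ∈ Icc 0 t₀, ∀ p ∈ closedStrip H, g t p ≤ v t p := by
  obtain ⟨Λ, hΛ, hlip⟩ := exists_lipschitz_of_contDiffOn hf
  have main := max_principle (w := fun t p => 1 * v t p + (-1) * g t p) (M := 1) (t₀ := t₀)
    (L := v₀ ^ 2 / κ * Λ) hκ hU hH (by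
      exact (continuousOn_const.mul hvc).add (continuousOn_const.mul hgc)) (by
      intro t ht p hp
      have := (hgI t ht p hp).2
      have := (hvI t ht p hp).1
      linarith) (by
      intro p hp
      have := h0 p hp
      linarith) (by
      intro t ht
      exact (contDiffOn_const.mul (hv2 t ht)).add (contDiffOn_const.mul (hg2 t ht))) (by
      intro t ht p hp
      exact ((hvt t ht p hp).const_mul 1).add ((hgt t ht p hp).const_mul (-1))) hedge (by
      intro t ht p hp hneg
      have hmem : openStrip H ∈ 𝓝 p := (isOpen_openStrip H).mem_nhds hp
      have hv' := (hv2 t ht).contDiffAt hmem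
      have hg' := (hg2 t ht).contDiffAt hmem
      rw [lap_linear_comb 1 (-1) hv' hg', dX_linear_comb 1 (-1) (hv'.of_le (by norm_num))
        (hg'.of_le (by norm_num)), dY_linear_comb 1 (-1) (hv'.of_le (by norm_num))
        (hg'.of_le (by norm_num))]
      have hd : deriv (fun s => 1 * v s p + (-1) * g s p) t =
          1 * deriv (fun s => v s p) t + (-1) * deriv (fun s => g s p) t :=
        (((hvt t ht p hp).hasDerivAt.const_mul 1).add
          ((hgt t ht p hp).hasDerivAt.const_mul (-1))).deriv
      rw [hd]
      have h1 := hge t ht p hp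
      have h2 := hve t ht p hp
      have hpc := openStrip_subset_closedStrip H hp
      have h3 := hlip _ (hvI t ⟨ht.1.le, ht.2⟩ p hpc) _ (hgI t ⟨ht.1.le, ht.2⟩ p hpc)
      rw [abs_of_neg (a := v t p - g t p) (by linarith)] at h3
      have h4 := neg_le_of_abs_le h3
      have h5 : 0 ≤ v₀ ^ 2 / κ := by positivity
      have h6 := mul_le_mul_of_nonneg_left h4 h5
      unfold evolutionRHS at h1 h2
      nlinarith)
  intro t ht p hp
  have := main t ht p hp
  linarith

/-! ### Monotonicity in time and exponential decay ahead of the front. -/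

section Solution

variable {κ v₀ U H : ℝ} {f : ℝ → ℝ} {T : ℝ → ℝ × ℝ → ℝ}

/-- The initial datum, frozen in time, is a subsolution. -/
theorem IsSolution.initial_le (hT : IsSolution κ v₀ U H f T) (hκ : 0 < κ) (hU : 0 ≤ U)
    (hH : 0 < H) (hf : IsKPP f ∨ IsIgnition f)
    (hb : NeumannCondition H T ∨ PeriodicCondition H T)
    (hi : InitiallyIncreasing κ v₀ U H f (T 0)) {t : ℝ} (ht : 0 ≤ t) {p : ℝ × ℝ}
    (hp : p ∈ closedStrip H) : T 0 p ≤ T t p := by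
  refine comparison (v₀ := v₀) (t₀ := t) (g := fun _ => T 0) (v := T) hκ hU hH
    (reaction_contDiffOn hf) ?_ (hT.cont.mono (prod_mono Icc_subset_Ici_self subset_rfl))
    (fun t _ => hT.mem_Icc 0 le_rfl)
    (fun t ht => hT.mem_Icc t ht.1) (fun p _ => le_rfl) (fun t _ => hT.c2 0 le_rfl)
    (fun t ht => hT.c2 t ht.1.le) (fun t _ p _ => differentiableAt_const _)
    (fun t ht => hT.diff_time t ht.1) (fun t ht => ?_) (fun t ht p hp => ?_)
    (fun t ht p hp => (hT.equation t ht.1 p hp).ge) t ⟨ht, le_rfl⟩ p hp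
  · exact (hT.c1 0 le_rfl).continuousOn.comp continuousOn_snd (fun q hq => hq.2)
  · have := edgeCondition_linear_comb hH hT.c1 hb ht.1.le (le_refl (0 : ℝ)) 1 (-1) (fun _ => 0)
    simpa using this
  · simpa using hi p hp

/-- The translate by `h` in time is again a solution, and by `IsSolution.initial_le` it starts above
`T`. -/
theorem IsSolution.monotone_time (hT : IsSolution κ v₀ U H f T) (hκ : 0 < κ) (hU : 0 ≤ U)
    (hH : 0 < H) (hf : IsKPP f ∨ IsIgnition f)
    (hb : NeumannCondition H T ∨ PeriodicCondition H T)
    (hi : InitiallyIncreasing κ v₀ U H f (T 0)) {t h : ℝ} (ht : 0 ≤ t) (hh : 0 ≤ h) {p : ℝ × ℝ}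
    (hp : p ∈ closedStrip H) : T t p ≤ T (t + h) p := by
  have hd : ∀ s p, deriv (fun s => T (s + h) p) s = deriv (fun s => T s p) (s + h) := fun s p =>
    deriv_comp_add_const (fun s => T s p) h s
  refine comparison (v₀ := v₀) (t₀ := t) (g := T) (v := fun s => T (s + h)) hκ hU hH
    (reaction_contDiffOn hf) (hT.cont.mono (prod_mono Icc_subset_Ici_self subset_rfl)) ?_
    (fun t ht => hT.mem_Icc t ht.1) (fun t ht => hT.mem_Icc _ (add_nonneg ht.1 hh))
    (fun p hp => ?_) (fun t ht => hT.c2 t ht.1.le)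
    (fun t ht => hT.c2 _ (add_nonneg ht.1.le hh)) (fun t ht => hT.diff_time t ht.1)
    (fun t ht p hp => ?_) (fun t ht => ?_)
    (fun t ht p hp => (hT.equation t ht.1 p hp).le) (fun t ht p hp => ?_) t ⟨ht, le_rfl⟩ p hp
  · exact hT.cont.comp (f := fun q : ℝ × (ℝ × ℝ) => (q.1 + h, q.2)) (by fun_prop)
      (fun q hq => ⟨add_nonneg hq.1.1 hh, hq.2⟩)
  · simpa using hT.initial_le hκ hU hH hf hb hi hh hp
  · exact (differentiableAt_comp_add_const (f := fun s => T s p)).2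
      (hT.diff_time _ (by linarith [ht.1]) p hp)
  · have := edgeCondition_linear_comb hH hT.c1 hb (add_nonneg ht.1.le hh) ht.1.le 1 (-1) (fun _ => 0)
    simpa using this
  · rw [hd]
    exact (hT.equation _ (by linarith [ht.1]) p hp).ge

theorem IsSolution.timeDeriv_nonneg (hT : IsSolution κ v₀ U H f T) (hκ : 0 < κ) (hU : 0 ≤ U)
    (hH : 0 < H) (hf : IsKPP f ∨ IsIgnition f)
    (hb : NeumannCondition H T ∨ PeriodicCondition H T)
    (hi : InitiallyIncreasing κ v₀ U H f (T 0)) {t : ℝ} (ht : 0 < t) {p : ℝ × ℝ}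
    (hp : p ∈ openStrip H) : 0 ≤ timeDeriv T t p := by
  have hd := (hT.diff_time t ht p hp).hasDerivAt
  refine deriv_nonneg_of_min_left (lt_add_one t) hd.hasDerivWithinAt (fun s hs => ?_)
  have := hT.monotone_time hκ hU hH hf hb hi ht.le (sub_nonneg.2 hs.1)
    (openStrip_subset_closedStrip H hp)
  simpa using this

theorem lap_comp_fst {e : ℝ → ℝ} (p : ℝ × ℝ) :
    lap (fun p => e p.1) p = deriv (deriv e) p.1 := by
  have h2 : lap (fun p => e p.1) p = deriv (deriv e) p.1 +
    deriv (deriv fun _ => e p.1) p.2 := rfl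
  rw [h2]; simp

/-- The function `K e^{ct - lam x}` is a supersolution: `c` pays for diffusion (`κ lam²`), drift
(`|lam| U`) and the linear bound `f(T) ≤ Λ T`. It does not depend on `y`, so it respects both kinds
of edge conditions. -/
theorem IsSolution.le_exp (hT : IsSolution κ v₀ U H f T) (hκ : 0 < κ) (hU : 0 ≤ U)
    (hH : 0 < H) (hf : IsKPP f ∨ IsIgnition f)
    (hb : NeumannCondition H T ∨ PeriodicCondition H T) {lam K : ℝ} (hK : 0 ≤ K)
    (h0 : ∀ p ∈ closedStrip H, T 0 p ≤ K * Real.exp (-lam * p.1)) {t₀ : ℝ} (ht₀ : 0 ≤ t₀) :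
    ∃ K', 0 ≤ K' ∧ ∀ p ∈ closedStrip H, T t₀ p ≤ K' * Real.exp (-lam * p.1) := by
  obtain ⟨Λ, hΛ, hlip⟩ := exists_lipschitz_of_contDiffOn (reaction_contDiffOn hf)
  set L := v₀ ^ 2 / κ * Λ with hL
  have hL0 : 0 ≤ L := by positivity
  set c := κ * lam ^ 2 + |lam| * U + L with hc
  set E : ℝ → ℝ × ℝ → ℝ := fun t p => K * Real.exp (c * t) * Real.exp (-lam * p.1) with hE
  have hEx : ∀ a x : ℝ, HasDerivAt (fun x => a * Real.exp (-lam * x))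
      (a * (-lam) * Real.exp (-lam * x)) x := by
    intro a x
    have := (((hasDerivAt_id x).const_mul (-lam)).exp).const_mul a
    refine this.congr_deriv ?_
    simp; ring
  have hEsm : ∀ t, ContDiff ℝ 2 (E t) := fun t => by simp only [hE]; fun_prop
  have main := max_principle (w := fun t p => 1 * E t p + (-1) * T t p) (M := 1) (t₀ := t₀)
    (L := L) hκ hU hH (by
      apply ContinuousOn.add
      · exact Continuous.continuousOn (by simp only [hE]; fun_prop)
      · exact continuousOn_const.mul (hT.cont.mono (prod_mono Icc_subset_Ici_self subset_rfl))) (by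
      intro t ht p hp
      have := (hT.mem_Icc t ht.1 p hp).2
      have : 0 ≤ E t p := by simp only [hE]; positivity
      linarith) (by
      intro p hp
      have := h0 p hp
      simp [hE] at this ⊢
      linarith) (by
      intro t ht
      exact (contDiffOn_const.mul (hEsm t).contDiffOn).add
        (contDiffOn_const.mul (hT.c2 t ht.1.le))) (by
      intro t ht p hp
      refine DifferentiableAt.add ?_ ((hT.diff_time t ht.1 p hp).const_mul (-1))
      simp only [hE]; fun_prop) (by
      intro t ht
      have := edgeCondition_linear_comb hH hT.c1 hb ht.1.le ht.1.le (-1) 0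
        (fun x => K * Real.exp (c * t) * Real.exp (-lam * x))
      have e : (fun p => 1 * E t p + (-1) * T t p) = fun p : ℝ × ℝ => -1 * T t p + 0 * T t p +
          K * Real.exp (c * t) * Real.exp (-lam * p.1) := by
        funext p; simp only [hE]; ring
      rw [e]; exact this) (by
      intro t ht p hp hneg
      have hmem : openStrip H ∈ 𝓝 p := (isOpen_openStrip H).mem_nhds hp
      have hT' := (hT.c2 t ht.1.le).contDiffAt hmem
      have hE' := (hEsm t).contDiffAt (x := p)
      rw [lap_linear_comb 1 (-1) hE' hT', dX_linear_comb 1 (-1) (hE'.of_le (by norm_num))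
        (hT'.of_le (by norm_num)), dY_linear_comb 1 (-1) (hE'.of_le (by norm_num))
        (hT'.of_le (by norm_num))]
      have hEt : HasDerivAt (fun s => E s p) (c * E t p) t := by
        have := ((((hasDerivAt_id t).const_mul c).exp).const_mul K).mul_const
          (Real.exp (-lam * p.1))
        refine this.congr_deriv ?_
        simp [hE]; ring
      have hd : deriv (fun s => 1 * E s p + (-1) * T s p) t =
          1 * (c * E t p) + (-1) * deriv (fun s => T s p) t :=
        ((hEt.const_mul 1).add ((hT.diff_time t ht.1 p hp).hasDerivAt.const_mul (-1))).deriv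
      rw [hd, hT.equation t ht.1 p hp]
      have e1 : dX (E t) p = -lam * E t p := by
        refine (hEx (K * Real.exp (c * t)) p.1).deriv.trans ?_
        simp only [hE]; ring
      have e2 : dY (E t) p = 0 := by simp [dY, hE]
      have e3 : lap (E t) p = lam ^ 2 * E t p := by
        have h1 : lap (E t) p = deriv (deriv fun x => K * Real.exp (c * t) * Real.exp (-lam * x)) p.1 :=
          lap_comp_fst (e := fun x => K * Real.exp (c * t) * Real.exp (-lam * x)) p
        have h2 : (deriv fun x => K * Real.exp (c * t) * Real.exp (-lam * x)) =
            fun x => K * Real.exp (c * t) * (-lam) * Real.exp (-lam * x) :=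
          funext fun x => (hEx _ x).deriv
        rw [h1, h2, (hEx _ _).deriv]
        simp only [hE]; ring
      rw [e1, e2, e3]
      have hpc := openStrip_subset_closedStrip H hp
      have hI := hT.mem_Icc t ht.1.le p hpc
      have h3 := hlip _ hI 0 ⟨le_rfl, zero_le_one⟩
      rw [reaction_zero hf, sub_zero, sub_zero, abs_of_nonneg hI.1] at h3
      have h4 := (le_abs_self _).trans h3
      have h5 : 0 ≤ v₀ ^ 2 / κ := by positivity
      have h6 := mul_le_mul_of_nonneg_left h4 h5
      have hE0 : 0 ≤ E t p := by simp only [hE]; positivity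
      have h7 : lam * flowX U H p ≤ |lam| * U := by
        refine (le_abs_self _).trans ?_
        rw [abs_mul]
        exact mul_le_mul_of_nonneg_left (abs_flowX_le hU H p) (abs_nonneg _)
      have h8 := mul_le_mul_of_nonneg_right h7 hE0
      unfold evolutionRHS
      rw [hc]
      have h9 : v₀ ^ 2 / κ * (Λ * T t p) = L * T t p := by rw [hL]; ring
      nlinarith)
  refine ⟨K * Real.exp (c * t₀), by positivity, fun p hp => ?_⟩
  have := main t₀ ⟨ht₀, le_rfl⟩ p hp
  simp only [hE] at this
  linarith

end Solution

/-! ### Rescaling to the strip of width `π`. -/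

/-- The strip `ℝ × (0, π)`. -/
def strip : Set (ℝ × ℝ) := univ ×ˢ Ioo 0 Real.pi

theorem isOpen_strip : IsOpen strip := isOpen_univ.prod isOpen_Ioo

/-- A temperature field `θ` on the strip of width `π`, with gradient `(gx, gy)` continuous up to the
edges, such that `S = Δθ - P u · ∇θ + q f(θ)` is nonnegative inside, for the cellular flow `u` of
unit amplitude. -/
structure Profile (q P : ℝ) (f : ℝ → ℝ) (θ gx gy S : ℝ × ℝ → ℝ) : Prop where
  cont : Continuous θ
  cont_gx : Continuous gx
  cont_gy : Continuous gy
  mem_Icc : ∀ p, θ p ∈ Icc (0 : ℝ) 1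
  hasFDerivAt : ∀ p ∈ strip, HasFDerivAt θ
    (gx p • ContinuousLinearMap.fst ℝ ℝ ℝ + gy p • ContinuousLinearMap.snd ℝ ℝ ℝ) p
  c1_gx : ContDiffOn ℝ 1 gx strip
  c1_gy : ContDiffOn ℝ 1 gy strip
  edge : ∀ x, gy (x, 0) = gy (x, Real.pi) ∧
    θ (x, 0) * gy (x, 0) = θ (x, Real.pi) * gy (x, Real.pi)
  equation : ∀ p ∈ strip, S p = fderiv ℝ gx p (1, 0) + fderiv ℝ gy p (0, 1)
    - P * (Real.sin p.1 * Real.cos p.2 * gx p - Real.cos p.1 * Real.sin p.2 * gy p) + q * f (θ p)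
  nonneg : ∀ p ∈ strip, 0 ≤ S p

/-- Convergence to `1` on the left and to `0` on the right at an exponential rate. -/
def ExpFront (θ : ℝ × ℝ → ℝ) : Prop :=
  ∃ lam > 0, ∃ K, ∀ p : ℝ × ℝ,
    |θ p - if p.1 < 0 then 1 else 0| ≤ K * Real.exp (-lam * |p.1|)

theorem dX_eq_fderiv {g : ℝ × ℝ → ℝ} {p : ℝ × ℝ} (hg : DifferentiableAt ℝ g p) :
    dX g p = fderiv ℝ g p (1, 0) := by
  have h : HasDerivAt (fun x => ((x, p.2) : ℝ × ℝ)) (1, 0) p.1 :=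
    (hasDerivAt_id p.1).prodMk (hasDerivAt_const p.1 p.2)
  exact (hg.hasFDerivAt.comp_hasDerivAt (f := fun x => ((x, p.2) : ℝ × ℝ)) p.1 h).deriv

theorem dY_eq_fderiv {g : ℝ × ℝ → ℝ} {p : ℝ × ℝ} (hg : DifferentiableAt ℝ g p) :
    dY g p = fderiv ℝ g p (0, 1) := by
  have h : HasDerivAt (fun y => ((p.1, y) : ℝ × ℝ)) (0, 1) p.2 :=
    (hasDerivAt_const p.2 p.1).prodMk (hasDerivAt_id p.2)
  exact (hg.hasFDerivAt.comp_hasDerivAt (f := fun y => ((p.1, y) : ℝ × ℝ)) p.2 h).deriv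

theorem dX_dX_eq_fderiv {g : ℝ × ℝ → ℝ} {s : Set (ℝ × ℝ)} (hs : IsOpen s)
    (hg : ContDiffOn ℝ 2 g s) {p : ℝ × ℝ} (hp : p ∈ s) :
    dX (dX g) p = fderiv ℝ (fun r => fderiv ℝ g r (1, 0)) p (1, 0) := by
  have h1 : ContDiffOn ℝ 1 (fun r => fderiv ℝ g r (1, 0)) s :=
    (hg.fderiv_of_isOpen hs (by norm_num)).clm_apply contDiffOn_const
  rw [← dX_eq_fderiv ((h1.differentiableOn (by norm_num)).differentiableAt (hs.mem_nhds hp))]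
  refine Filter.EventuallyEq.deriv_eq ?_
  have h2 : ∀ᶠ x in 𝓝 p.1, ((x, p.2) : ℝ × ℝ) ∈ s :=
    (Continuous.tendsto (f := fun x => ((x, p.2) : ℝ × ℝ)) (by fun_prop) p.1).eventually
      (hs.mem_nhds hp)
  filter_upwards [h2] with x hx
  exact dX_eq_fderiv ((hg.differentiableOn (by norm_num)).differentiableAt (hs.mem_nhds hx))

theorem dY_dY_eq_fderiv {g : ℝ × ℝ → ℝ} {s : Set (ℝ × ℝ)} (hs : IsOpen s)
    (hg : ContDiffOn ℝ 2 g s) {p : ℝ × ℝ} (hp : p ∈ s) :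
    dY (dY g) p = fderiv ℝ (fun r => fderiv ℝ g r (0, 1)) p (0, 1) := by
  have h1 : ContDiffOn ℝ 1 (fun r => fderiv ℝ g r (0, 1)) s :=
    (hg.fderiv_of_isOpen hs (by norm_num)).clm_apply contDiffOn_const
  rw [← dY_eq_fderiv ((h1.differentiableOn (by norm_num)).differentiableAt (hs.mem_nhds hp))]
  refine Filter.EventuallyEq.deriv_eq ?_
  have h2 : ∀ᶠ y in 𝓝 p.2, ((p.1, y) : ℝ × ℝ) ∈ s :=
    (Continuous.tendsto (f := fun y => ((p.1, y) : ℝ × ℝ)) (by fun_prop) p.2).eventually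
      (hs.mem_nhds hp)
  filter_upwards [h2] with x hx
  exact dY_eq_fderiv ((hg.differentiableOn (by norm_num)).differentiableAt (hs.mem_nhds hx))

/-- Dilation by `H` after projection of the plane to the closed strip of width `π`. -/
def stripScale (H : ℝ) (p : ℝ × ℝ) : ℝ × ℝ := (H * p.1, H * max 0 (min p.2 Real.pi))

theorem continuous_stripScale (H : ℝ) : Continuous (stripScale H) := by
  unfold stripScale; fun_prop

theorem stripScale_mem {H : ℝ} (hH : 0 < H) (p : ℝ × ℝ) : stripScale H p ∈ closedStrip H := by
  refine ⟨mem_univ _, by unfold stripScale; positivity, ?_⟩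
  have : max 0 (min p.2 Real.pi) ≤ Real.pi := max_le Real.pi_pos.le (min_le_right _ _)
  simp only [stripScale]
  nlinarith

theorem stripScale_eq_smul {H : ℝ} {p : ℝ × ℝ} (hp : p ∈ strip) : stripScale H p = H • p := by
  have h1 : max 0 (min p.2 Real.pi) = p.2 := by
    rw [min_eq_left hp.2.2.le, max_eq_right hp.2.1.le]
  simp [stripScale, h1, Prod.smul_def]

theorem smul_mem_openStrip_iff {H : ℝ} (hH : 0 < H) {p : ℝ × ℝ} :
    H • p ∈ openStrip H ↔ p ∈ strip := by
  have h1 : 0 < H * p.2 ↔ 0 < p.2 := by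
    constructor
    · intro h; exact (pos_iff_pos_of_mul_pos h).1 hH
    · intro h; positivity
  have h2 : H * p.2 < Real.pi * H ↔ p.2 < Real.pi := by
    rw [mul_comm Real.pi H]; exact mul_lt_mul_iff_right₀ hH
  simp [openStrip, strip, h1, h2]

theorem fderiv_comp_smul_apply {a : ℝ × ℝ → ℝ} {H : ℝ} {p : ℝ × ℝ}
    (ha : DifferentiableAt ℝ a (H • p)) (v : ℝ × ℝ) :
    fderiv ℝ (fun r => H * a (H • r)) p v = H ^ 2 * fderiv ℝ a (H • p) v := by
  have h1 : HasFDerivAt (fun r : ℝ × ℝ => H • r) (H • ContinuousLinearMap.id ℝ (ℝ × ℝ)) p :=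
    (hasFDerivAt_id p).const_smul H
  have h2 := (HasFDerivAt.comp (g := a) (f := fun r : ℝ × ℝ => H • r) p ha.hasFDerivAt h1).const_mul H
  have h3 : HasFDerivAt (fun r => H * a (H • r)) _ p := h2
  rw [h3.fderiv]
  simp; ring

/-- The gradient is `H` times the derivative of `T t` within the closed strip, which is continuous
up to the edges; composition with `stripScale` extends it to the plane. Inside the strip, the chain
rule puts a factor `H` on first and `H²` on second derivatives, which produces the two dimensionless
numbers. -/
theorem IsSolution.profile {κ v₀ U H : ℝ} {f : ℝ → ℝ} {T : ℝ → ℝ × ℝ → ℝ}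
    (hT : IsSolution κ v₀ U H f T) (hκ : 0 < κ) (hU : 0 ≤ U)
    (hH : 0 < H) (hf : IsKPP f ∨ IsIgnition f)
    (hb : NeumannCondition H T ∨ PeriodicCondition H T)
    (hi : InitiallyIncreasing κ v₀ U H f (T 0)) {t : ℝ} (ht : 0 < t) :
    ∃ gx gy, Profile ((v₀ * H / κ) ^ 2) (U * H / κ) f (fun p => T t (stripScale H p)) gx gy
      (fun p => H ^ 2 / κ * timeDeriv T t (H • p)) := by
  have hc1 := hT.c1 t ht.le
  have hc2 := hT.c2 t ht.le
  have ho := isOpen_openStrip H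
  have hW : 0 < Real.pi * H := by positivity
  have huniq : UniqueDiffOn ℝ (closedStrip H) := uniqueDiffOn_univ.prod (uniqueDiffOn_Icc hW)
  set G := fderivWithin ℝ (T t) (closedStrip H) with hG
  have hGc : ContinuousOn G (closedStrip H) := hc1.continuousOn_fderivWithin huniq (by norm_num)
  have hGs : Continuous fun p => G (stripScale H p) :=
    hGc.comp_continuous (continuous_stripScale H) (stripScale_mem hH)
  have hGo : ∀ r ∈ openStrip H, G r = fderiv ℝ (T t) r := fun r hr =>
    fderivWithin_of_mem_nhds (mem_of_superset (ho.mem_nhds hr) (openStrip_subset_closedStrip H))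
  have hd : ∀ r ∈ openStrip H, DifferentiableAt ℝ (T t) r := fun r hr =>
    (hc2.differentiableOn (by norm_num)).differentiableAt (ho.mem_nhds hr)
  have hev : ∀ p ∈ strip, ∀ v : ℝ × ℝ, H * G (stripScale H p) v =
      H * fderiv ℝ (T t) (H • p) v := fun p hp v => by
    rw [stripScale_eq_smul hp, hGo _ ((smul_mem_openStrip_iff hH).2 hp)]
  have hcd : ∀ v : ℝ × ℝ, ContDiffOn ℝ 1 (fun r => fderiv ℝ (T t) r v) (openStrip H) := fun v =>
    (hc2.fderiv_of_isOpen ho (by norm_num)).clm_apply contDiffOn_const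
  have hcdH : ∀ v : ℝ × ℝ, ContDiffOn ℝ 1 (fun p => H * G (stripScale H p) v) strip := fun v => by
    have : ContDiffOn ℝ 1 (fun p : ℝ × ℝ => H * fderiv ℝ (T t) (H • p) v) strip :=
      contDiffOn_const.mul ((hcd v).comp (f := fun p : ℝ × ℝ => H • p)
        (contDiff_const_smul H).contDiffOn (fun p hp => (smul_mem_openStrip_iff hH).2 hp))
    exact this.congr fun p hp => hev p hp v
  have hfd : ∀ p ∈ strip, ∀ v w : ℝ × ℝ, fderiv ℝ (fun p => H * G (stripScale H p) v) p w =
      H ^ 2 * fderiv ℝ (fun r => fderiv ℝ (T t) r v) (H • p) w := fun p hp v w => by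
    have h1 : (fun p => H * G (stripScale H p) v) =ᶠ[𝓝 p]
        fun p => H * (fun r => fderiv ℝ (T t) r v) (H • p) := by
      filter_upwards [isOpen_strip.mem_nhds hp] with r hr using hev r hr v
    rw [h1.fderiv_eq]
    refine fderiv_comp_smul_apply (a := fun r => fderiv ℝ (T t) r v) ?_ w
    exact ((hcd v).differentiableOn (by norm_num)).differentiableAt
      (ho.mem_nhds ((smul_mem_openStrip_iff hH).2 hp))
  have hGy : ∀ x, ∀ y ∈ Icc 0 (Real.pi * H), G (x, y) (0, 1) = dYclosed H (T t) x y := by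
    intro x y hy
    have h1 : HasFDerivWithinAt (T t) (G (x, y)) (closedStrip H) (x, y) :=
      ((hc1.differentiableOn (by norm_num)) _ ⟨mem_univ _, hy⟩).hasFDerivWithinAt
    have h2 : HasDerivWithinAt (fun y' => ((x, y') : ℝ × ℝ)) (0, 1) (Icc 0 (Real.pi * H)) y :=
      ((hasDerivAt_const y x).prodMk (hasDerivAt_id y)).hasDerivWithinAt
    have h3 := HasFDerivWithinAt.comp_hasDerivWithinAt (l := T t)
      (f := fun y' => ((x, y') : ℝ × ℝ)) y h1 h2 (fun y' hy' => ⟨mem_univ _, hy'⟩)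
    exact (h3.derivWithin ((uniqueDiffOn_Icc hW) y hy)).symm
  have hs0 : ∀ x, stripScale H (x, 0) = (H * x, 0) := fun x => by
    simp [stripScale, Real.pi_pos.le]
  have hsπ : ∀ x, stripScale H (x, Real.pi) = (H * x, Real.pi * H) := fun x => by
    simp [stripScale, Real.pi_pos.le, mul_comm]
  refine ⟨fun p => H * G (stripScale H p) (1, 0), fun p => H * G (stripScale H p) (0, 1), ?_⟩
  refine ⟨?_, ?_, ?_, ?_, ?_, hcdH _, hcdH _, ?_, ?_, ?_⟩
  · exact hc1.continuousOn.comp_continuous (continuous_stripScale H) (stripScale_mem hH)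
  · exact continuous_const.mul (hGs.clm_apply continuous_const)
  · exact continuous_const.mul (hGs.clm_apply continuous_const)
  · exact fun p => hT.mem_Icc t ht.le _ (stripScale_mem hH p)
  · intro p hp
    have h0 := hd _ ((smul_mem_openStrip_iff hH).2 hp)
    have h1 : HasFDerivAt (fun r : ℝ × ℝ => H • r) (H • ContinuousLinearMap.id ℝ (ℝ × ℝ)) p :=
      (hasFDerivAt_id p).const_smul H
    have h2 := HasFDerivAt.comp (g := T t) (f := fun r : ℝ × ℝ => H • r) p h0.hasFDerivAt h1
    have h3 : (fun p => T t (stripScale H p)) =ᶠ[𝓝 p] (T t ∘ fun r : ℝ × ℝ => H • r) := by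
      filter_upwards [isOpen_strip.mem_nhds hp] with r hr
      simp [stripScale_eq_smul hr]
    refine (h2.congr_of_eventuallyEq h3).congr_fderiv ?_
    rw [hev p hp, hev p hp]
    ext <;> simp
  · intro x
    have e0 : G (stripScale H (x, 0)) (0, 1) = dYclosed H (T t) (H * x) 0 := by
      rw [hs0, hGy _ _ ⟨le_rfl, hW.le⟩]
    have e1 : G (stripScale H (x, Real.pi)) (0, 1) = dYclosed H (T t) (H * x) (Real.pi * H) := by
      rw [hsπ, hGy _ _ ⟨hW.le, le_rfl⟩]
    simp only [e0, e1]
    rcases hb with hb | hb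
    · simp [(hb t ht.le (H * x)).1, (hb t ht.le (H * x)).2]
    · obtain ⟨h1, h2⟩ := hb t ht.le (H * x)
      rw [hs0, hsπ, h1, h2]; simp
  · intro p hp
    have hpo := (smul_mem_openStrip_iff hH).2 hp
    rw [hfd p hp, hfd p hp, hev p hp, hev p hp, stripScale_eq_smul hp]
    have h1 := hT.equation t ht _ hpo
    unfold timeDeriv
    rw [h1, evolutionRHS, lap, dX_dX_eq_fderiv ho hc2 hpo, dY_dY_eq_fderiv ho hc2 hpo,
      dX_eq_fderiv (hd _ hpo), dY_eq_fderiv (hd _ hpo), flowX, flowY]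
    have hH' := hH.ne'
    have ex : (H • p).1 / H = p.1 := by simp [hH']
    have ey : (H • p).2 / H = p.2 := by simp [hH']
    rw [ex, ey]
    field_simp
    ring
  · intro p hp
    have := hT.timeDeriv_nonneg hκ hU hH hf hb hi ht ((smul_mem_openStrip_iff hH).2 hp)
    positivity

/-- On the left `1 - T` only decreases in time, so its initial decay persists; on the right the
supersolution of `IsSolution.le_exp` carries the decay along. -/
theorem IsSolution.expFront {κ v₀ U H : ℝ} {f : ℝ → ℝ} {T : ℝ → ℝ × ℝ → ℝ}
    (hT : IsSolution κ v₀ U H f T) (hκ : 0 < κ) (hU : 0 ≤ U)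
    (hH : 0 < H) (hf : IsKPP f ∨ IsIgnition f)
    (hb : NeumannCondition H T ∨ PeriodicCondition H T)
    (hi : InitiallyIncreasing κ v₀ U H f (T 0)) (hdec : ExponentialDecay H (T 0))
    {t : ℝ} (ht : 0 ≤ t) : ExpFront fun p => T t (stripScale H p) := by
  obtain ⟨lam, hlam, K, hl, hr, -⟩ := hdec
  -- The maximum with `1` extends the initial bound to `x ≤ 0`, where `T ≤ 1 ≤ e^{-lam x}`.
  obtain ⟨K', hK', h1⟩ := hT.le_exp hκ hU hH hf hb (lam := lam) (K := max K 1) (by positivity)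
    (fun p hp => by
      by_cases hx : 0 < p.1
      · refine (le_abs_self _).trans ((hr p hp hx).trans ?_)
        gcongr
        exact le_max_left _ _
      · refine (hT.mem_Icc 0 le_rfl p hp).2.trans ?_
        have : 1 ≤ Real.exp (-lam * p.1) := Real.one_le_exp (by nlinarith)
        calc (1 : ℝ) ≤ 1 * Real.exp (-lam * p.1) := by linarith
          _ ≤ _ := by gcongr; exact le_max_right _ _) ht
  refine ⟨lam * H, by positivity, max K K', fun p => ?_⟩
  have hp := stripScale_mem hH p
  have hI := hT.mem_Icc t ht _ hp
  have hfst : (stripScale H p).1 = H * p.1 := rfl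
  split_ifs with hx
  · have h2 := hT.initial_le hκ hU hH hf hb hi ht hp
    have h3 := hl _ hp (by rw [hfst]; nlinarith)
    rw [hfst] at h3
    rw [abs_sub_comm, abs_of_nonneg (by linarith [hI.2]), abs_of_neg hx]
    calc 1 - T t (stripScale H p) ≤ 1 - T 0 (stripScale H p) := by linarith
      _ ≤ K * Real.exp (lam * (H * p.1)) := (le_abs_self _).trans h3
      _ = K * Real.exp (-(lam * H) * -p.1) := by ring_nf
      _ ≤ _ := by gcongr; exact le_max_left _ _
  · have h3 := h1 _ hp
    rw [hfst] at h3
    rw [sub_zero, abs_of_nonneg hI.1, abs_of_nonneg (not_lt.1 hx)]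
    calc T t (stripScale H p) ≤ K' * Real.exp (-lam * (H * p.1)) := h3
      _ = K' * Real.exp (-(lam * H) * p.1) := by ring_nf
      _ ≤ _ := by gcongr; exact le_max_right _ _

/-! ### Gradient calculus and cut-offs in `x`. -/

/-- `φ` has partial derivatives `a` and `b` at `p`, in the sense of Fréchet. -/
def HasGrad (φ : ℝ × ℝ → ℝ) (a b : ℝ) (p : ℝ × ℝ) : Prop :=
  HasFDerivAt φ (a • ContinuousLinearMap.fst ℝ ℝ ℝ + b • ContinuousLinearMap.snd ℝ ℝ ℝ) p

section HasGrad

variable {φ ψ : ℝ × ℝ → ℝ} {a b c d : ℝ} {p : ℝ × ℝ}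

theorem HasGrad.congr (h : HasGrad φ a b p) (hac : a = c) (hbd : b = d) : HasGrad φ c d p := by
  subst hac hbd; exact h

theorem HasGrad.add (h : HasGrad φ a b p) (h' : HasGrad ψ c d p) :
    HasGrad (fun r => φ r + ψ r) (a + c) (b + d) p := by
  refine (HasFDerivAt.add h h').congr_fderiv ?_
  ext <;> simp

theorem HasGrad.mul (h : HasGrad φ a b p) (h' : HasGrad ψ c d p) :
    HasGrad (fun r => φ r * ψ r) (a * ψ p + φ p * c) (b * ψ p + φ p * d) p := by
  refine (HasFDerivAt.mul h h').congr_fderiv ?_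
  ext <;> simp <;> ring

theorem HasGrad.const_mul (h : HasGrad φ a b p) (k : ℝ) :
    HasGrad (fun r => k * φ r) (k * a) (k * b) p := by
  refine (HasFDerivAt.const_mul h k).congr_fderiv ?_
  ext <;> simp

theorem HasGrad.comp {k : ℝ → ℝ} {k' : ℝ} (hk : HasDerivAt k k' (φ p)) (h : HasGrad φ a b p) :
    HasGrad (fun r => k (φ r)) (k' * a) (k' * b) p := by
  refine (hk.comp_hasFDerivAt p h).congr_fderiv ?_
  ext <;> simp

theorem hasGrad_of_fst {k : ℝ → ℝ} {k' : ℝ} (hk : HasDerivAt k k' p.1) :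
    HasGrad (fun r => k r.1) k' 0 p := by
  refine (hk.comp_hasFDerivAt p hasFDerivAt_fst).congr_fderiv ?_
  ext <;> simp

theorem hasGrad_of_snd {k : ℝ → ℝ} {k' : ℝ} (hk : HasDerivAt k k' p.2) :
    HasGrad (fun r => k r.2) 0 k' p := by
  refine (hk.comp_hasFDerivAt p hasFDerivAt_snd).congr_fderiv ?_
  ext <;> simp

end HasGrad

theorem hasDerivAt_max_zero_pow (n : ℕ) (z : ℝ) :
    HasDerivAt (fun z : ℝ => (max 0 z) ^ (n + 2)) ((n + 2 : ℝ) * (max 0 z) ^ (n + 1)) z := by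
  rcases lt_trichotomy z 0 with h | h | h
  · have e : (fun z : ℝ => (max 0 z) ^ (n + 2)) =ᶠ[𝓝 z] fun _ => 0 := by
      filter_upwards [eventually_lt_nhds h] with w hw
      simp [max_eq_left hw.le]
    rw [max_eq_left h.le]
    simpa using (hasDerivAt_const z (0 : ℝ)).congr_of_eventuallyEq e
  · subst h
    rw [max_self, zero_pow (by omega), mul_zero]
    rw [hasDerivAt_iff_isLittleO_nhds_zero]
    have h1 : (fun h : ℝ => max 0 (0 + h) ^ (n + 2) - max 0 0 ^ (n + 2) - h • (0 : ℝ)) =O[𝓝 0]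
        fun h : ℝ => h ^ (n + 2) := by
      refine Asymptotics.isBigO_of_le _ fun h => ?_
      simp only [zero_add, max_self, smul_zero, sub_zero, Real.norm_eq_abs]
      rw [zero_pow (by omega), sub_zero, abs_pow, abs_pow]
      refine pow_le_pow_left₀ (abs_nonneg _) ?_ _
      rw [abs_of_nonneg (a := max 0 h) (le_max_left _ _)]
      exact max_le (abs_nonneg _) (le_abs_self _)
    refine h1.trans_isLittleO ?_
    simpa using Asymptotics.isLittleO_pow_id (𝕜 := ℝ) (show 1 < n + 2 by omega)
  · have e : (fun z : ℝ => (max 0 z) ^ (n + 2)) =ᶠ[𝓝 z] fun z => z ^ (n + 2) := by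
      filter_upwards [eventually_gt_nhds h] with w hw
      simp [max_eq_right hw.le]
    rw [max_eq_right h.le]
    refine ((hasDerivAt_pow (n + 2) z).congr_of_eventuallyEq e).congr_deriv ?_
    push_cast; simp

section Cutoff

/-- A cut-off of class `C²` supported in `[-R, R]`. -/
def cutoff (R x : ℝ) : ℝ := (max 0 (1 - (x / R) ^ 2)) ^ 3

/-- The derivative of `cutoff`. -/
def cutoffDeriv (R x : ℝ) : ℝ := 3 * (max 0 (1 - (x / R) ^ 2)) ^ 2 * (-(2 * x / R ^ 2))

/-- The second derivative of `cutoff`. -/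
def cutoffDeriv₂ (R x : ℝ) : ℝ :=
  3 * (2 * max 0 (1 - (x / R) ^ 2) * (-(2 * x / R ^ 2))) * (-(2 * x / R ^ 2)) +
    3 * (max 0 (1 - (x / R) ^ 2)) ^ 2 * (-(2 / R ^ 2))

variable {R x : ℝ}

theorem hasDerivAt_cutoff_inner (R x : ℝ) :
    HasDerivAt (fun x => 1 - (x / R) ^ 2) (-(2 * x / R ^ 2)) x := by
  refine ((((hasDerivAt_id x).div_const R).pow 2).const_sub 1).congr_deriv ?_
  simp; ring

theorem hasDerivAt_cutoff (R x : ℝ) : HasDerivAt (cutoff R) (cutoffDeriv R x) x := by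
  have h := hasDerivAt_max_zero_pow 1 (1 - (x / R) ^ 2)
  refine (h.comp x (hasDerivAt_cutoff_inner R x)).congr_deriv ?_
  unfold cutoffDeriv; norm_num

theorem hasDerivAt_cutoffDeriv (R x : ℝ) : HasDerivAt (cutoffDeriv R) (cutoffDeriv₂ R x) x := by
  have h := hasDerivAt_max_zero_pow 0 (1 - (x / R) ^ 2)
  have h1 : HasDerivAt (fun x : ℝ => -(2 * x / R ^ 2)) (-(2 / R ^ 2)) x := by
    refine ((((hasDerivAt_id x).const_mul 2).div_const (R ^ 2)).neg).congr_deriv ?_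
    simp
  refine (((h.comp x (hasDerivAt_cutoff_inner R x)).const_mul 3).mul h1).congr_deriv ?_
  unfold cutoffDeriv₂; simp

@[fun_prop]
theorem continuous_cutoff (R : ℝ) : Continuous (cutoff R) := by unfold cutoff; fun_prop

@[fun_prop]
theorem continuous_cutoffDeriv (R : ℝ) : Continuous (cutoffDeriv R) := by
  unfold cutoffDeriv; fun_prop

@[fun_prop]
theorem continuous_cutoffDeriv₂ (R : ℝ) : Continuous (cutoffDeriv₂ R) := by
  unfold cutoffDeriv₂; fun_prop

theorem cutoff_nonneg (R x : ℝ) : 0 ≤ cutoff R x := by unfold cutoff; positivity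

theorem max_cutoff_le_one (R x : ℝ) : max 0 (1 - (x / R) ^ 2) ≤ 1 :=
  max_le zero_le_one (by linarith [sq_nonneg (x / R)])

theorem cutoff_le_one (R x : ℝ) : cutoff R x ≤ 1 :=
  pow_le_one₀ (le_max_left _ _) (max_cutoff_le_one R x)

theorem max_cutoff_eq_zero (hR : 0 < R) (hx : R ≤ |x|) : max 0 (1 - (x / R) ^ 2) = 0 := by
  apply max_eq_left
  have : 1 ≤ |x / R| := by rw [abs_div, abs_of_pos hR]; exact (one_le_div hR).2 hx
  rw [← sq_abs]; nlinarith

theorem cutoff_eq_zero (hR : 0 < R) (hx : R ≤ |x|) : cutoff R x = 0 := by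
  unfold cutoff; rw [max_cutoff_eq_zero hR hx]; norm_num

theorem cutoffDeriv_eq_zero (hR : 0 < R) (hx : R ≤ |x|) : cutoffDeriv R x = 0 := by
  unfold cutoffDeriv; rw [max_cutoff_eq_zero hR hx]; norm_num

theorem abs_cutoffDeriv_le (hR : 0 < R) (x : ℝ) : |cutoffDeriv R x| ≤ 6 / R := by
  by_cases hx : R ≤ |x|
  · rw [cutoffDeriv_eq_zero hR hx, abs_zero]; positivity
  · push Not at hx
    have h1 := max_cutoff_le_one R x
    have h0 : 0 ≤ max 0 (1 - (x / R) ^ 2) := le_max_left _ _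
    unfold cutoffDeriv
    rw [abs_mul, abs_neg, abs_div, abs_of_nonneg (by positivity), abs_mul, abs_two,
      abs_of_pos (a := R ^ 2) (by positivity)]
    calc 3 * (max 0 (1 - (x / R) ^ 2)) ^ 2 * (2 * |x| / R ^ 2)
        ≤ 3 * 1 ^ 2 * (2 * R / R ^ 2) := by gcongr
      _ = 6 / R := by field_simp; norm_num

theorem abs_cutoffDeriv₂_le (hR : 0 < R) (x : ℝ) : |cutoffDeriv₂ R x| ≤ 30 / R ^ 2 := by
  by_cases hx : R ≤ |x|
  · unfold cutoffDeriv₂; rw [max_cutoff_eq_zero hR hx]; simp; positivity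
  · push Not at hx
    have h1 := max_cutoff_le_one R x
    have h0 : 0 ≤ max 0 (1 - (x / R) ^ 2) := le_max_left _ _
    have h2 : |-(2 * x / R ^ 2)| ≤ 2 / R := by
      rw [abs_neg, abs_div, abs_mul, abs_two, abs_of_pos (a := R ^ 2) (by positivity)]
      calc 2 * |x| / R ^ 2 ≤ 2 * R / R ^ 2 := by gcongr
        _ = 2 / R := by field_simp
    unfold cutoffDeriv₂
    refine (abs_add_le _ _).trans ?_
    have e1 : |3 * (2 * max 0 (1 - (x / R) ^ 2) * (-(2 * x / R ^ 2))) * (-(2 * x / R ^ 2))| ≤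
        3 * (2 * 1 * (2 / R)) * (2 / R) := by
      rw [abs_mul, abs_mul, abs_mul, abs_mul, abs_two, abs_of_nonneg h0,
        abs_of_pos (show (0:ℝ) < 3 by norm_num)]
      gcongr
    have e2 : |3 * (max 0 (1 - (x / R) ^ 2)) ^ 2 * (-(2 / R ^ 2))| ≤ 3 * 1 ^ 2 * (2 / R ^ 2) := by
      rw [abs_mul, abs_of_nonneg (a := 3 * _) (by positivity), abs_neg,
        abs_of_nonneg (a := 2 / R ^ 2) (by positivity)]
      gcongr
    calc _ ≤ 3 * (2 * 1 * (2 / R)) * (2 / R) + 3 * 1 ^ 2 * (2 / R ^ 2) := add_le_add e1 e2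
      _ = 30 / R ^ 2 := by field_simp; norm_num

theorem tendsto_cutoff (x : ℝ) : Tendsto (fun n : ℕ => cutoff n x) atTop (𝓝 1) := by
  have h : Tendsto (fun n : ℕ => x / (n : ℝ)) atTop (𝓝 0) :=
    tendsto_const_div_atTop_nhds_zero_nat x
  have h2 : Tendsto (fun n : ℕ => (max 0 (1 - (x / (n : ℝ)) ^ 2)) ^ 3) atTop
      (𝓝 ((max 0 (1 - 0 ^ 2)) ^ 3)) :=
    ((tendsto_const_nhds.max (tendsto_const_nhds.sub (h.pow 2))).pow 3)
  simpa [cutoff] using h2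

end Cutoff

/-! ### Energy identities on the strip. -/

section Profile

variable {q P : ℝ} {f : ℝ → ℝ} {θ gx gy S : ℝ × ℝ → ℝ}

theorem Profile.hasGrad (h : Profile q P f θ gx gy S) {p : ℝ × ℝ} (hp : p ∈ strip) :
    HasGrad θ (gx p) (gy p) p := h.hasFDerivAt p hp

theorem Profile.continuous_reaction (h : Profile q P f θ gx gy S)
    (hf : ContinuousOn f (Icc 0 1)) : Continuous fun p => f (θ p) :=
  hf.comp_continuous h.cont h.mem_Icc

theorem Profile.continuousOn_fderiv_gx (h : Profile q P f θ gx gy S) (v : ℝ × ℝ) :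
    ContinuousOn (fun p => fderiv ℝ gx p v) strip :=
  (h.c1_gx.continuousOn_fderiv_of_isOpen isOpen_strip (by norm_num)).clm_apply continuousOn_const

theorem Profile.continuousOn_fderiv_gy (h : Profile q P f θ gx gy S) (v : ℝ × ℝ) :
    ContinuousOn (fun p => fderiv ℝ gy p v) strip :=
  (h.c1_gy.continuousOn_fderiv_of_isOpen isOpen_strip (by norm_num)).clm_apply continuousOn_const

theorem Profile.continuousOn_source (h : Profile q P f θ gx gy S)
    (hf : ContinuousOn f (Icc 0 1)) : ContinuousOn S strip := by
  refine ContinuousOn.congr ?_ h.equation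
  have h1 := h.cont_gx
  have h2 := h.cont_gy
  refine ContinuousOn.add (ContinuousOn.sub ((h.continuousOn_fderiv_gx _).add
    (h.continuousOn_fderiv_gy _)) (Continuous.continuousOn (by fun_prop)))
    (continuous_const.mul (h.continuous_reaction hf)).continuousOn

/-- The divergence theorem for the field `φ ∇θ + (A, B)` on a rectangle inside the strip. -/
theorem Profile.integral_divergence (h : Profile q P f θ gx gy S)
    {φ A B φx φy Ax Ay Bx By : ℝ × ℝ → ℝ} {a b : ℝ × ℝ}
    (hab : a ≤ b) (hsub : Icc a b ⊆ strip)
    (hφ : ∀ p ∈ strip, HasGrad φ (φx p) (φy p) p)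
    (hA : ∀ p ∈ strip, HasGrad A (Ax p) (Ay p) p) (hB : ∀ p ∈ strip, HasGrad B (Bx p) (By p) p)
    (hφx : ContinuousOn φx strip) (hφy : ContinuousOn φy strip)
    (hAx : ContinuousOn Ax strip) (hBy : ContinuousOn By strip) :
    ∫ p in Icc a b, (φx p * gx p + φy p * gy p + φ p * (S p - q * f (θ p) +
        P * (Real.sin p.1 * Real.cos p.2 * gx p - Real.cos p.1 * Real.sin p.2 * gy p)) +
        Ax p + By p) =
      (((∫ x in a.1..b.1, (φ (x, b.2) * gy (x, b.2) + B (x, b.2))) -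
        ∫ x in a.1..b.1, (φ (x, a.2) * gy (x, a.2) + B (x, a.2))) +
          ∫ y in a.2..b.2, (φ (b.1, y) * gx (b.1, y) + A (b.1, y))) -
        ∫ y in a.2..b.2, (φ (a.1, y) * gx (a.1, y) + A (a.1, y)) := by
  have hφc : ContinuousOn φ strip := fun p hp => (hφ p hp).continuousAt.continuousWithinAt
  have hAc : ContinuousOn A strip := fun p hp => (hA p hp).continuousAt.continuousWithinAt
  have hBc : ContinuousOn B strip := fun p hp => (hB p hp).continuousAt.continuousWithinAt
  have hgx := h.cont_gx.continuousOn (s := strip)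
  have hgy := h.cont_gy.continuousOn (s := strip)
  have hdx : ∀ p ∈ strip, HasFDerivAt gx (fderiv ℝ gx p) p := fun p hp =>
    ((h.c1_gx.differentiableOn (by norm_num)).differentiableAt
      (isOpen_strip.mem_nhds hp)).hasFDerivAt
  have hdy : ∀ p ∈ strip, HasFDerivAt gy (fderiv ℝ gy p) p := fun p hp =>
    ((h.c1_gy.differentiableOn (by norm_num)).differentiableAt
      (isOpen_strip.mem_nhds hp)).hasFDerivAt
  have hI : Ioo a.1 b.1 ×ˢ Ioo a.2 b.2 ⊆ strip := by
    refine Subset.trans ?_ hsub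
    rw [Icc_prod_eq]
    exact prod_mono Ioo_subset_Icc_self Ioo_subset_Icc_self
  have key := integral_divergence_prod_Icc_of_hasFDerivAt_of_le
    (fun p => φ p * gx p + A p) (fun p => φ p * gy p + B p) _ _ a b hab
    (((hφc.mul hgx).add hAc).mono hsub) (((hφc.mul hgy).add hBc).mono hsub)
    (fun p hp => (HasFDerivAt.mul (hφ p (hI hp)) (hdx p (hI hp))).add (hA p (hI hp)))
    (fun p hp => (HasFDerivAt.mul (hφ p (hI hp)) (hdy p (hI hp))).add (hB p (hI hp))) ?_
  · rw [← key]
    refine setIntegral_congr_fun measurableSet_Icc fun p hp => ?_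
    simp [h.equation p (hsub hp)]
    ring
  · have e : ∀ p, (φ p • fderiv ℝ gx p + gx p • (φx p • ContinuousLinearMap.fst ℝ ℝ ℝ +
        φy p • ContinuousLinearMap.snd ℝ ℝ ℝ) + (Ax p • ContinuousLinearMap.fst ℝ ℝ ℝ +
        Ay p • ContinuousLinearMap.snd ℝ ℝ ℝ)) (1, 0) + (φ p • fderiv ℝ gy p + gy p •
        (φx p • ContinuousLinearMap.fst ℝ ℝ ℝ + φy p • ContinuousLinearMap.snd ℝ ℝ ℝ) +
        (Bx p • ContinuousLinearMap.fst ℝ ℝ ℝ + By p • ContinuousLinearMap.snd ℝ ℝ ℝ)) (0, 1) =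
        φ p * fderiv ℝ gx p (1, 0) + gx p * φx p + Ax p +
        (φ p * fderiv ℝ gy p (0, 1) + gy p * φy p + By p) := fun p => by simp
    simp only [e]
    refine ContinuousOn.integrableOn_compact isCompact_Icc (ContinuousOn.mono ?_ hsub)
    exact (((hφc.mul (h.continuousOn_fderiv_gx _)).add (hgx.mul hφx)).add hAx).add
      (((hφc.mul (h.continuousOn_fderiv_gy _)).add (hgy.mul hφy)).add hBy)

end Profile

/-- The rectangle `[-R, R] × [ε, π - ε]`. -/
def box (R ε : ℝ) : Set (ℝ × ℝ) := Icc (-R, ε) (R, Real.pi - ε)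

/-- The margin `ε` keeps the rectangle inside the open strip, where the gradient is `C¹`. Up to the
edges it is only continuous, so the divergence theorem is applied on these rectangles and the limit
is taken afterwards. -/
theorem box_subset_strip {R ε : ℝ} (hε : 0 < ε) : box R ε ⊆ strip := by
  intro p hp
  rw [box, Icc_prod_eq] at hp
  exact ⟨mem_univ _, lt_of_lt_of_le hε hp.2.1, by have := hp.2.2; simp only at this; linarith⟩

theorem box_eq_prod (R ε : ℝ) : box R ε = Icc (-R) R ×ˢ Icc ε (Real.pi - ε) := Icc_prod_eq _ _

theorem integral_box_mul (R ε : ℝ) (k l : ℝ → ℝ) :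
    ∫ p in box R ε, k p.1 * l p.2 = (∫ x in Icc (-R) R, k x) * ∫ y in Icc ε (Real.pi - ε), l y := by
  rw [box_eq_prod]
  exact setIntegral_prod_mul k l _ _

/-- The flow has no net flux through a vertical section. Hence a function of `x` alone may be
subtracted from the advected quantity at no cost. -/
theorem integral_Icc_cos_eq_zero {ε : ℝ} (hε : ε ≤ Real.pi / 2) :
    ∫ y in Icc ε (Real.pi - ε), Real.cos y = 0 := by
  rw [integral_Icc_eq_integral_Ioc, ← intervalIntegral.integral_of_le (by linarith), integral_cos]
  simp [Real.sin_pi_sub]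

theorem integrable_exp_neg_mul_abs {lam : ℝ} (hlam : 0 < lam) :
    Integrable fun x : ℝ => Real.exp (-lam * |x|) := by
  have h1 : IntegrableOn (fun x : ℝ => Real.exp (-lam * |x|)) (Ioi 0) :=
    (exp_neg_integrableOn_Ioi 0 hlam).congr_fun (fun x hx => by
      simp only [abs_of_pos (show (0 : ℝ) < x from hx)]) measurableSet_Ioi
  have h2 : IntegrableOn (fun x : ℝ => Real.exp (-lam * |x|)) (Iic 0) := by
    refine (integrableOn_exp_mul_Iic hlam 0).congr_fun (fun x hx => ?_) measurableSet_Iic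
    simp only [abs_of_nonpos (show x ≤ 0 from hx)]
    ring_nf
  have := h2.union h1
  rwa [Iic_union_Ioi, integrableOn_univ] at this

theorem integrableOn_abs_sub_step {θ : ℝ × ℝ → ℝ} (hc : Continuous θ) (hθ : ExpFront θ) :
    IntegrableOn (fun p => |θ p - if p.1 < 0 then 1 else 0|) strip := by
  obtain ⟨lam, hlam, K, hK⟩ := hθ
  have h1 : IntegrableOn (fun p : ℝ × ℝ => (K * Real.exp (-lam * |p.1|)) * (1 : ℝ)) strip := by
    rw [IntegrableOn, strip, Measure.volume_eq_prod, ← Measure.prod_restrict, Measure.restrict_univ]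
    exact ((integrable_exp_neg_mul_abs hlam).const_mul K).mul_prod (integrable_const (1 : ℝ))
  refine Integrable.mono' h1 ?_ (ae_of_all _ fun p => ?_)
  · have : Measurable fun p : ℝ × ℝ => if p.1 < 0 then (1 : ℝ) else 0 :=
      Measurable.ite (measurableSet_lt measurable_fst measurable_const) measurable_const
        measurable_const
    exact ((hc.measurable.sub this).abs).aestronglyMeasurable
  · rw [Real.norm_eq_abs, abs_abs, mul_one]; exact hK p

section Profile

variable {q P : ℝ} {f : ℝ → ℝ} {θ gx gy S : ℝ × ℝ → ℝ}

/-- The equation is tested with `cutoff · (α + βθ)`. Since `(α + βθ)∇θ` is the gradient of `αθ +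
βθ²/2` and the flow is divergence free, the fields `A` and `B` move all remaining derivatives of `θ`
onto the cut-off. On the vertical sides the cut-off and its derivative vanish; only the horizontal
edges contribute. -/
theorem Profile.cutoff_identity (h : Profile q P f θ gx gy S) (hf : ContinuousOn f (Icc 0 1))
    (α β : ℝ) {R ε : ℝ} (hR : 0 < R) (hε : 0 < ε) (hε' : ε ≤ Real.pi / 2) :
    ∫ p in box R ε, cutoff R p.1 * (β * (gx p ^ 2 + gy p ^ 2) +
      (α + β * θ p) * (S p - q * f (θ p))) =
    (∫ p in box R ε, (cutoffDeriv₂ R p.1 * (α * θ p + β * θ p ^ 2 / 2) +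
      P * (cutoffDeriv R p.1 * Real.sin p.1 * Real.cos p.2 * (α * θ p + β * θ p ^ 2 / 2)))) +
    ((∫ x in (-R)..R, (cutoff R x * (α + β * θ (x, Real.pi - ε)) * gy (x, Real.pi - ε) +
        P * (cutoff R x * (α * θ (x, Real.pi - ε) + β * θ (x, Real.pi - ε) ^ 2 / 2) *
          (Real.cos x * Real.sin (Real.pi - ε))))) -
      ∫ x in (-R)..R, (cutoff R x * (α + β * θ (x, ε)) * gy (x, ε) +
        P * (cutoff R x * (α * θ (x, ε) + β * θ (x, ε) ^ 2 / 2) * (Real.cos x * Real.sin ε)))) := by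
  have hc := h.cont
  have hcx := h.cont_gx
  have hcy := h.cont_gy
  have hχ := continuous_cutoff R
  have hχ1 := continuous_cutoffDeriv R
  have hχ2 := continuous_cutoffDeriv₂ R
  have hd1 : ∀ s : ℝ, HasDerivAt (fun s => α + β * s) β s := fun s => by
    simpa using ((hasDerivAt_id s).const_mul β).const_add α
  have hd2 : ∀ s : ℝ, HasDerivAt (fun s => α * s + β * s ^ 2 / 2) (α + β * s) s := fun s => by
    refine (((hasDerivAt_id s).const_mul α).add
      ((((hasDerivAt_id s).pow 2).const_mul β).div_const 2)).congr_deriv ?_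
    simp; ring
  have hg1 : ∀ p ∈ strip, HasGrad (fun p => α + β * θ p) (β * gx p) (β * gy p) p := fun p hp =>
    HasGrad.comp (k := fun s => α + β * s) (hd1 _) (h.hasGrad hp)
  have hg2 : ∀ p ∈ strip, HasGrad (fun p => α * θ p + β * θ p ^ 2 / 2) ((α + β * θ p) * gx p)
      ((α + β * θ p) * gy p) p := fun p hp =>
    HasGrad.comp (k := fun s => α * s + β * s ^ 2 / 2) (hd2 _) (h.hasGrad hp)
  have hsub := box_subset_strip (R := R) hε
  have hle : ((-R, ε) : ℝ × ℝ) ≤ (R, Real.pi - ε) := ⟨by simp; linarith, by simp; linarith⟩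
  have key := h.integral_divergence hle hsub
    (φ := fun p => cutoff R p.1 * (α + β * θ p))
    (A := fun p => -1 * (cutoffDeriv R p.1 * (α * θ p + β * θ p ^ 2 / 2)) +
      -P * ((cutoff R p.1 * (α * θ p + β * θ p ^ 2 / 2)) * (Real.sin p.1 * Real.cos p.2)))
    (B := fun p => P * ((cutoff R p.1 * (α * θ p + β * θ p ^ 2 / 2)) *
      (Real.cos p.1 * Real.sin p.2)))
    (fun p hp => (hasGrad_of_fst (hasDerivAt_cutoff R p.1)).mul (hg1 p hp))
    (fun p hp => (((hasGrad_of_fst (hasDerivAt_cutoffDeriv R p.1)).mul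
      (hg2 p hp)).const_mul (-1)).add
      ((((hasGrad_of_fst (hasDerivAt_cutoff R p.1)).mul (hg2 p hp)).mul
        ((hasGrad_of_fst (Real.hasDerivAt_sin p.1)).mul
          (hasGrad_of_snd (Real.hasDerivAt_cos p.2)))).const_mul (-P)))
    (fun p hp => ((((hasGrad_of_fst (hasDerivAt_cutoff R p.1)).mul
      (hg2 p hp)).mul
        ((hasGrad_of_fst (Real.hasDerivAt_cos p.1)).mul
          (hasGrad_of_snd (Real.hasDerivAt_sin p.2)))).const_mul P))
    (Continuous.continuousOn (by fun_prop)) (Continuous.continuousOn (by fun_prop))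
    (Continuous.continuousOn (by fun_prop)) (Continuous.continuousOn (by fun_prop))
  have hRabs : R ≤ |R| := le_abs_self R
  have hRabs' : R ≤ |-R| := by rw [abs_neg]; exact hRabs
  simp only [cutoff_eq_zero hR hRabs, cutoffDeriv_eq_zero hR hRabs, cutoff_eq_zero hR hRabs',
    cutoffDeriv_eq_zero hR hRabs', zero_mul, mul_zero, add_zero, intervalIntegral.integral_zero,
    sub_zero] at key
  rw [← key]
  unfold box
  rw [← integral_add]
  · refine setIntegral_congr_fun measurableSet_Icc fun p hp => ?_
    ring
  · exact (Continuous.continuousOn (by fun_prop)).integrableOn_compact isCompact_Icc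
  · refine ContinuousOn.integrableOn_compact isCompact_Icc ?_
    have hS := (h.continuousOn_source hf).mono hsub
    have hF := (h.continuous_reaction hf).continuousOn (s := box R ε)
    unfold box at hS hF
    obtain ⟨F, hFe⟩ : ∃ F : ℝ × ℝ → ℝ, ∀ p, f (θ p) = F p := ⟨_, fun _ => rfl⟩
    simp only [hFe] at hF ⊢
    fun_prop

/-- The term with the second derivative is of order `R⁻²` on an area of order `R`. The advective
term is only of order `R⁻¹`, so the step function is subtracted first: its contribution vanishes by
`integral_Icc_cos_eq_zero`, and the distance of `θ` to it is integrable. -/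
theorem Profile.abs_cutoff_error_le (h : Profile q P f θ gx gy S) (hθ : ExpFront θ) {α β : ℝ}
    (hα : 0 ≤ α) (hβ : 0 ≤ β) (hαβ : α + β ≤ 1) {R ε : ℝ} (hR : 0 < R) (hε : 0 < ε)
    (hε' : ε ≤ Real.pi / 2) :
    |∫ p in box R ε, (cutoffDeriv₂ R p.1 * (α * θ p + β * θ p ^ 2 / 2) +
      P * (cutoffDeriv R p.1 * Real.sin p.1 * Real.cos p.2 * (α * θ p + β * θ p ^ 2 / 2)))| ≤
    (60 * Real.pi + 6 * |P| * ∫ p in strip, |θ p - if p.1 < 0 then 1 else 0|) / R := by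
  have hc := h.cont
  have hχ1 := continuous_cutoffDeriv R
  have hχ2 := continuous_cutoffDeriv₂ R
  have hm : Measurable fun x : ℝ => if x < 0 then (1 : ℝ) else 0 :=
    Measurable.ite measurableSet_Iio measurable_const measurable_const
  have hbox : IsCompact (box R ε) := isCompact_Icc
  set st : ℝ → ℝ := fun x => if x < 0 then 1 else 0 with hst
  have hst01 : ∀ x, st x = 0 ∨ st x = 1 := fun x => by simp only [hst]; split_ifs <;> simp
  have hvol : volume.real (box R ε) ≤ 2 * R * Real.pi := by
    rw [box_eq_prod, Measure.volume_eq_prod, measureReal_prod_prod, Real.volume_real_Icc_of_le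
      (by linarith), Real.volume_real_Icc_of_le (by linarith)]
    nlinarith
  have hzero : ∫ p in box R ε, (P * (α + β / 2)) *
      ((cutoffDeriv R p.1 * Real.sin p.1 * st p.1) * Real.cos p.2) = 0 := by
    rw [integral_const_mul, integral_box_mul R ε
      (fun x => cutoffDeriv R x * Real.sin x * st x) Real.cos, integral_Icc_cos_eq_zero hε',
      mul_zero, mul_zero]
  have hi1 : IntegrableOn (fun p => (cutoffDeriv₂ R p.1 * (α * θ p + β * θ p ^ 2 / 2) +
      P * (cutoffDeriv R p.1 * Real.sin p.1 * Real.cos p.2 * (α * θ p + β * θ p ^ 2 / 2))))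
      (box R ε) := (Continuous.continuousOn (by fun_prop)).integrableOn_compact hbox
  have hi2 : IntegrableOn (fun p : ℝ × ℝ => (P * (α + β / 2)) *
      ((cutoffDeriv R p.1 * Real.sin p.1 * st p.1) * Real.cos p.2)) (box R ε) := by
    have h1 : IntegrableOn (fun p : ℝ × ℝ => (P * (α + β / 2)) *
      ((cutoffDeriv R p.1 * Real.sin p.1) * Real.cos p.2)) (box R ε) :=
      (Continuous.continuousOn (by fun_prop)).integrableOn_compact hbox
    refine Integrable.mono h1 ?_ (ae_of_all _ fun p => ?_)
    · refine Measurable.aestronglyMeasurable ?_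
      have := hχ1.measurable
      have h3 : Measurable fun p : ℝ × ℝ => st p.1 := hm.comp measurable_fst
      fun_prop
    · rcases hst01 p.1 with h0 | h0 <;> simp [h0]; positivity
  have hstep := (integrableOn_abs_sub_step h.cont hθ)
  have hsub := box_subset_strip (R := R) hε
  have hstep' := hstep.mono_set hsub
  have hle : ∫ p in box R ε, |θ p - st p.1| ≤ ∫ p in strip, |θ p - st p.1| :=
    setIntegral_mono_set hstep (ae_of_all _ fun p => abs_nonneg _) (ae_of_all _ hsub)
  calc _ = |∫ p in box R ε, ((cutoffDeriv₂ R p.1 * (α * θ p + β * θ p ^ 2 / 2) +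
      P * (cutoffDeriv R p.1 * Real.sin p.1 * Real.cos p.2 * (α * θ p + β * θ p ^ 2 / 2))) -
      (P * (α + β / 2)) * ((cutoffDeriv R p.1 * Real.sin p.1 * st p.1) * Real.cos p.2))| := by
        rw [integral_sub hi1 hi2, hzero, sub_zero]
    _ ≤ ∫ p in box R ε, (30 / R ^ 2 + 6 * |P| / R * |θ p - st p.1|) := by
        rw [← Real.norm_eq_abs]
        refine norm_integral_le_of_norm_le ((integrable_const_iff.2 (Or.inr ?_)).add
          (hstep'.const_mul _)) (ae_of_all _ fun p => ?_)
        · exact ⟨by simpa using hbox.measure_lt_top⟩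
        have hI := h.mem_Icc p
        have e : (cutoffDeriv₂ R p.1 * (α * θ p + β * θ p ^ 2 / 2) +
            P * (cutoffDeriv R p.1 * Real.sin p.1 * Real.cos p.2 * (α * θ p + β * θ p ^ 2 / 2))) -
            (P * (α + β / 2)) * ((cutoffDeriv R p.1 * Real.sin p.1 * st p.1) * Real.cos p.2) =
            cutoffDeriv₂ R p.1 * (α * θ p + β * θ p ^ 2 / 2) + P * cutoffDeriv R p.1 *
            (Real.sin p.1 * Real.cos p.2) *
            ((α * θ p + β * θ p ^ 2 / 2) - (α + β / 2) * st p.1) := by ring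
        rw [e, Real.norm_eq_abs]
        refine (abs_add_le _ _).trans (add_le_add ?_ ?_)
        · rw [abs_mul]
          have : |α * θ p + β * θ p ^ 2 / 2| ≤ 1 := by
            have h2 : θ p ^ 2 ≤ 1 := by nlinarith [hI.1, hI.2]
            rw [abs_of_nonneg (by have := hI.1; positivity)]
            nlinarith [mul_nonneg hα (sub_nonneg.2 hI.2), mul_nonneg hβ (sub_nonneg.2 h2)]
          calc _ ≤ 30 / R ^ 2 * 1 := mul_le_mul (abs_cutoffDeriv₂_le hR _) this (abs_nonneg _)
                (by positivity)
            _ = _ := mul_one _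
        · have h1 : |Real.sin p.1 * Real.cos p.2| ≤ 1 := by
            rw [abs_mul]
            exact mul_le_one₀ (Real.abs_sin_le_one _) (abs_nonneg _) (Real.abs_cos_le_one _)
          have h2 : |(α * θ p + β * θ p ^ 2 / 2) - (α + β / 2) * st p.1| ≤ |θ p - st p.1| := by
            have e2 : (α * θ p + β * θ p ^ 2 / 2) - (α + β / 2) * st p.1 =
                (α + β * (θ p + st p.1) / 2) * (θ p - st p.1) := by
              rcases hst01 p.1 with h0 | h0 <;> rw [h0] <;> ring
            rw [e2, abs_mul]
            have h3 : 0 ≤ st p.1 ∧ st p.1 ≤ 1 := by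
              rcases hst01 p.1 with h0 | h0 <;> rw [h0] <;> norm_num
            have h4 : |α + β * (θ p + st p.1) / 2| ≤ 1 := by
              rw [abs_of_nonneg (by have := hI.1; have := h3.1; positivity)]
              nlinarith [mul_nonneg hβ (sub_nonneg.2 hI.2), mul_nonneg hβ (sub_nonneg.2 h3.2)]
            exact mul_le_of_le_one_left (abs_nonneg _) h4
          rw [abs_mul, abs_mul, abs_mul]
          calc |P| * |cutoffDeriv R p.1| * |Real.sin p.1 * Real.cos p.2| * _
              ≤ |P| * (6 / R) * 1 * |θ p - st p.1| := by
                gcongr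
                exact abs_cutoffDeriv_le hR _
            _ = _ := by ring
    _ = 30 / R ^ 2 * volume.real (box R ε) + 6 * |P| / R * ∫ p in box R ε, |θ p - st p.1| := by
        rw [integral_add (integrable_const_iff.2 (Or.inr ⟨by simpa using hbox.measure_lt_top⟩))
          (hstep'.const_mul _), setIntegral_const, integral_const_mul, smul_eq_mul, mul_comm]
    _ ≤ 30 / R ^ 2 * (2 * R * Real.pi) + 6 * |P| / R * ∫ p in strip, |θ p - st p.1| := by
        gcongr
    _ = _ := by field_simp; ring

/-- The difference of the edge terms is continuous in `ε`. At `ε = 0` the advective parts vanish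
with `sin 0 = sin π = 0`, and the diffusive parts cancel by the edge conditions of the profile. -/
theorem Profile.exists_edge_small (h : Profile q P f θ gx gy S) (α β : ℝ) {R δ : ℝ}
    (hδ : 0 < δ) : ∃ ε, 0 < ε ∧ ε ≤ δ ∧
    |(∫ x in (-R)..R, (cutoff R x * (α + β * θ (x, Real.pi - ε)) * gy (x, Real.pi - ε) +
        P * (cutoff R x * (α * θ (x, Real.pi - ε) + β * θ (x, Real.pi - ε) ^ 2 / 2) *
          (Real.cos x * Real.sin (Real.pi - ε))))) -
      ∫ x in (-R)..R, (cutoff R x * (α + β * θ (x, ε)) * gy (x, ε) +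
        P * (cutoff R x * (α * θ (x, ε) + β * θ (x, ε) ^ 2 / 2) * (Real.cos x * Real.sin ε)))|
      ≤ δ := by
  have hc := h.cont
  have hcy := h.cont_gy
  have hχ := continuous_cutoff R
  set E : ℝ → ℝ := fun y => ∫ x in (-R)..R, (cutoff R x * (α + β * θ (x, y)) * gy (x, y) +
        P * (cutoff R x * (α * θ (x, y) + β * θ (x, y) ^ 2 / 2) * (Real.cos x * Real.sin y)))
    with hE
  have hEc : Continuous E := by
    refine intervalIntegral.continuous_parametric_intervalIntegral_of_continuous' ?_ _ _
    simp only [Function.uncurry_def]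
    fun_prop
  have h0 : E Real.pi - E 0 = 0 := by
    rw [sub_eq_zero]
    refine intervalIntegral.integral_congr fun x _ => ?_
    obtain ⟨h1, h2⟩ := h.edge x
    simp only [Real.sin_pi, Real.sin_zero, mul_zero, add_zero]
    linear_combination (-(cutoff R x) * α) * h1 - cutoff R x * β * h2
  have hlim : Tendsto (fun ε => |E (Real.pi - ε) - E ε|) (𝓝[>] 0) (𝓝 0) := by
    have hcont : Continuous fun ε => |E (Real.pi - ε) - E ε| := by fun_prop
    have := hcont.tendsto 0
    simp only [sub_zero, h0, abs_zero] at this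
    exact this.mono_left nhdsWithin_le_nhds
  have h1 := hlim.eventually (eventually_le_nhds hδ)
  have h2 : ∀ᶠ ε : ℝ in 𝓝[>] 0, ε ≤ δ := nhdsWithin_le_nhds (eventually_le_nhds hδ)
  obtain ⟨ε, ⟨h3, h4⟩, h5⟩ := ((h1.and h2).and self_mem_nhdsWithin).exists
  exact ⟨ε, h5, h4, h3⟩

/-- Integrals over growing rectangles of the energy identity tested with cut-offs. -/
theorem Profile.exists_box_sequence (h : Profile q P f θ gx gy S) (hf : ContinuousOn f (Icc 0 1))
    (hθ : ExpFront θ) {α β : ℝ} (hα : 0 ≤ α) (hβ : 0 ≤ β) (hαβ : α + β ≤ 1) :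
    ∃ C : ℝ, ∃ ε : ℕ → ℝ, (∀ n, 0 < ε n) ∧ Tendsto ε atTop (𝓝 0) ∧ ∀ n : ℕ, 0 < n →
      |∫ p in box n (ε n), cutoff n p.1 * (β * (gx p ^ 2 + gy p ^ 2) +
      (α + β * θ p) * (S p - q * f (θ p)))| ≤ C / n := by
  have hδ : ∀ n : ℕ, (0 : ℝ) < 1 / ((n : ℝ) + 1) := fun n => by positivity
  choose ε h0 h1 h2 using fun n : ℕ => h.exists_edge_small α β (R := n) (hδ n)
  refine ⟨60 * Real.pi + 6 * |P| * (∫ p in strip, |θ p - if p.1 < 0 then 1 else 0|) + 1, ε, h0,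
    squeeze_zero (fun n => (h0 n).le) h1 tendsto_one_div_add_atTop_nhds_zero_nat, fun n hn => ?_⟩
  have hn' : (1 : ℝ) ≤ n := by exact_mod_cast hn
  have h3 : ε n ≤ Real.pi / 2 := by
    have : 1 / ((n : ℝ) + 1) ≤ 1 := by rw [div_le_one (by positivity)]; linarith
    have := h1 n
    linarith [Real.pi_gt_three]
  rw [h.cutoff_identity hf α β (by linarith) (h0 n) h3]
  refine (abs_add_le _ _).trans ?_
  rw [add_div]
  refine add_le_add (h.abs_cutoff_error_le hθ hα hβ hαβ (by linarith) (h0 n) h3)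
    ((h2 n).trans ?_)
  gcongr
  linarith

end Profile

theorem eventually_mem_box {ε : ℕ → ℝ} (hε : Tendsto ε atTop (𝓝 0)) {p : ℝ × ℝ} (hp : p ∈ strip) :
    ∀ᶠ n : ℕ in atTop, p ∈ box n (ε n) := by
  have h1 : ∀ᶠ n : ℕ in atTop, |p.1| ≤ n := tendsto_natCast_atTop_atTop.eventually_ge_atTop _
  have h2 := hε.eventually (eventually_lt_nhds hp.2.1)
  have h3 := hε.eventually (eventually_lt_nhds (sub_pos.2 hp.2.2))
  filter_upwards [h1, h2, h3] with n h1 h2 h3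
  rw [box_eq_prod]
  exact ⟨abs_le.1 h1, h2.le, by linarith⟩

/-- Fatou's lemma: the truncated integrands are nonnegative and converge pointwise to `h`, so a
bound on their integrals yields integrability and passes to the limit. -/
theorem integrableOn_of_cutoff {h : ℝ × ℝ → ℝ} (hc : ContinuousOn h strip)
    (h0 : ∀ p ∈ strip, 0 ≤ h p) {ε : ℕ → ℝ} (hε : ∀ n, 0 < ε n) (hε0 : Tendsto ε atTop (𝓝 0))
    {c : ℕ → ℝ} {c₀ : ℝ} (hint : ∀ n : ℕ, 0 < n → ∫ p in box n (ε n), cutoff n p.1 * h p ≤ c n)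
    (hlim : Tendsto c atTop (𝓝 c₀)) : IntegrableOn h strip ∧ ∫ p in strip, h p ≤ c₀ := by
  have hmeas : MeasurableSet strip := isOpen_strip.measurableSet
  have hbm : ∀ n : ℕ, MeasurableSet (box n (ε n)) := fun n => measurableSet_Icc
  have hm : AEStronglyMeasurable h (volume.restrict strip) := hc.aestronglyMeasurable hmeas
  have h0' : 0 ≤ᵐ[volume.restrict strip] h := by
    filter_upwards [ae_restrict_mem hmeas] with p hp using h0 p hp
  set w : ℕ → ℝ × ℝ → ℝ := fun n => (box n (ε n)).indicator fun p => cutoff n p.1 * h p with hw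
  have hwi : ∀ n : ℕ, Integrable (w n) (volume.restrict strip) := fun n => by
    rw [hw, integrable_indicator_iff (hbm n)]
    have h1 : IntegrableOn (fun p => cutoff n p.1 * h p) (box n (ε n)) :=
      ContinuousOn.integrableOn_compact isCompact_Icc
        ((Continuous.continuousOn (by fun_prop)).mul (hc.mono (box_subset_strip (hε n))))
    rw [IntegrableOn, Measure.restrict_restrict (hbm n)]
    exact h1.mono_set inter_subset_left
  have hw0 : ∀ n : ℕ, 0 ≤ᵐ[volume.restrict strip] w n := fun n => by
    filter_upwards [h0'] with p hp
    by_cases hb : p ∈ box n (ε n)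
    · simp only [hw, indicator_of_mem hb]; exact mul_nonneg (cutoff_nonneg _ _) hp
    · simp only [hw, indicator_of_notMem hb]; rfl
  have hwint : ∀ n : ℕ, ∫ p in strip, w n p = ∫ p in box n (ε n), cutoff n p.1 * h p := fun n => by
    rw [hw, setIntegral_indicator (hbm n), inter_eq_self_of_subset_right (box_subset_strip (hε n))]
  have hconv : ∀ p ∈ strip, Tendsto (fun n => ENNReal.ofReal (w n p)) atTop
      (𝓝 (ENNReal.ofReal (h p))) := fun p hp => by
    refine (ENNReal.continuous_ofReal.tendsto _).comp ?_
    have h1 : Tendsto (fun n : ℕ => cutoff n p.1 * h p) atTop (𝓝 (1 * h p)) :=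
      (tendsto_cutoff p.1).mul_const _
    rw [one_mul] at h1
    refine h1.congr' ?_
    filter_upwards [eventually_mem_box hε0 hp] with n hn
    simp only [hw, indicator_of_mem hn]
  have hbound : ∫⁻ p in strip, ENNReal.ofReal (h p) ≤ ENNReal.ofReal c₀ := by
    calc ∫⁻ p in strip, ENNReal.ofReal (h p)
        = ∫⁻ p in strip, liminf (fun n => ENNReal.ofReal (w n p)) atTop := by
          refine setLIntegral_congr_fun hmeas fun p hp => ?_
          exact ((hconv p hp).liminf_eq).symm
      _ ≤ liminf (fun n => ∫⁻ p in strip, ENNReal.ofReal (w n p)) atTop :=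
          lintegral_liminf_le' fun n => (hwi n).aestronglyMeasurable.aemeasurable.ennreal_ofReal
      _ ≤ liminf (fun n => ENNReal.ofReal (c n)) atTop := by
          refine liminf_le_liminf ?_
          filter_upwards [eventually_gt_atTop 0] with n hn
          rw [← ofReal_integral_eq_lintegral_ofReal (hwi n) (hw0 n), hwint n]
          exact ENNReal.ofReal_le_ofReal (hint n hn)
      _ = ENNReal.ofReal c₀ := ((ENNReal.continuous_ofReal.tendsto _).comp hlim).liminf_eq
  have hI : IntegrableOn h strip := by
    refine ⟨hm, ?_⟩
    rw [hasFiniteIntegral_iff_ofReal h0']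
    exact hbound.trans_lt ENNReal.ofReal_lt_top
  refine ⟨hI, ?_⟩
  have hc0 : 0 ≤ c₀ := by
    refine ge_of_tendsto hlim ?_
    filter_upwards [eventually_gt_atTop 0] with n hn
    exact (integral_nonneg_of_ae (hw0 n)).trans ((hwint n).le.trans (hint n hn))
  rw [← ENNReal.ofReal_le_ofReal_iff hc0, ofReal_integral_eq_lintegral_ofReal hI h0']
  exact hbound

section Profile

variable {q P : ℝ} {f : ℝ → ℝ} {θ gx gy S : ℝ × ℝ → ℝ}

theorem integral_box_cutoff_le {h : ℝ × ℝ → ℝ} (hI : IntegrableOn h strip)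
    (h0 : ∀ p ∈ strip, 0 ≤ h p) (n : ℕ) {ε : ℝ} (hε : 0 < ε) :
    IntegrableOn (fun p => cutoff n p.1 * h p) (box n ε) ∧
    ∫ p in box n ε, cutoff n p.1 * h p ≤ ∫ p in strip, h p := by
  have hsub := box_subset_strip (R := n) hε
  have hm : MeasurableSet (box n ε) := measurableSet_Icc
  have h1 : IntegrableOn (fun p => cutoff n p.1 * h p) (box n ε) := by
    refine Integrable.mono (hI.mono_set hsub) ?_ ?_
    · exact (Continuous.aestronglyMeasurable (by fun_prop)).mul
        (hI.mono_set hsub).aestronglyMeasurable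
    · refine ae_of_all _ fun p => ?_
      rw [norm_mul, Real.norm_eq_abs, abs_of_nonneg (cutoff_nonneg _ _)]
      exact mul_le_of_le_one_left (norm_nonneg _) (cutoff_le_one _ _)
  refine ⟨h1, ?_⟩
  calc _ ≤ ∫ p in box n ε, h p := by
        refine setIntegral_mono_on h1 (hI.mono_set hsub) hm fun p hp => ?_
        exact mul_le_of_le_one_left (h0 p (hsub hp)) (cutoff_le_one _ _)
    _ ≤ _ := by
        refine setIntegral_mono_set hI ?_ (ae_of_all _ hsub)
        filter_upwards [ae_restrict_mem isOpen_strip.measurableSet] with p hp using h0 p hp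

/-- As `f` is Lipschitz and vanishes at both `0` and `1`, `f(θ)` is dominated by a multiple of the
distance of `θ` to the step function. -/
theorem Profile.integrableOn_reaction (h : Profile q P f θ gx gy S) (hf : IsKPP f ∨ IsIgnition f)
    (hθ : ExpFront θ) : IntegrableOn (fun p => q * f (θ p)) strip := by
  obtain ⟨Λ, hΛ, hlip⟩ := exists_lipschitz_of_contDiffOn (reaction_contDiffOn hf)
  refine Integrable.const_mul ?_ q
  refine Integrable.mono' ((integrableOn_abs_sub_step h.cont hθ).const_mul Λ)
    (h.continuous_reaction (reaction_contDiffOn hf).continuousOn).aestronglyMeasurable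
    (ae_of_all _ fun p => ?_)
  rw [Real.norm_eq_abs]
  split_ifs
  · simpa [reaction_one hf] using hlip _ (h.mem_Icc p) 1 (by simp)
  · simpa [reaction_zero hf] using hlip _ (h.mem_Icc p) 0 (by simp)

/-- The total source equals the total reaction rate and dominates the Dirichlet integral. -/
theorem Profile.energy (h : Profile q P f θ gx gy S) (hq : 0 ≤ q) (hf : IsKPP f ∨ IsIgnition f)
    (hθ : ExpFront θ) : IntegrableOn S strip ∧ IntegrableOn (fun p => gx p ^ 2 + gy p ^ 2) strip ∧
      ∫ p in strip, q * f (θ p) = ∫ p in strip, S p ∧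
      ∫ p in strip, (gx p ^ 2 + gy p ^ 2) ≤ ∫ p in strip, S p := by
  have hfc := (reaction_contDiffOn hf).continuousOn
  have hF := h.integrableOn_reaction hf hθ
  have hF0 : ∀ p ∈ strip, 0 ≤ q * f (θ p) := fun p _ =>
    mul_nonneg hq (reaction_nonneg hf (h.mem_Icc p))
  have hFc : Continuous fun p => q * f (θ p) := continuous_const.mul (h.continuous_reaction hfc)
  have hSc := h.continuousOn_source hfc
  have hlim : ∀ c C : ℝ, Tendsto (fun n : ℕ => c + C / n) atTop (𝓝 c) := fun c C => by
    simpa using tendsto_const_nhds.add (tendsto_const_div_atTop_nhds_zero_nat C)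
  have hcI : ∀ {k : ℝ × ℝ → ℝ}, ContinuousOn k strip → ∀ (n : ℕ) {ε : ℝ}, 0 < ε →
      IntegrableOn (fun p => cutoff n p.1 * k p) (box n ε) := fun hk n ε hε =>
    ContinuousOn.integrableOn_compact isCompact_Icc
      ((Continuous.continuousOn (by fun_prop)).mul (hk.mono (box_subset_strip hε)))
  -- Tested with the constant `1`, source and reaction have equal truncated integrals up to `C / n`.
  -- Fatou's lemma, used once in each direction, turns this into integrability and equality.
  obtain ⟨C, ε, hε, hε0, hb⟩ := h.exists_box_sequence hfc hθ (α := 1) (β := 0) zero_le_one le_rfl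
    (by norm_num)
  have hb' : ∀ n : ℕ, 0 < n → |(∫ p in box n (ε n), cutoff n p.1 * S p) -
      ∫ p in box n (ε n), cutoff n p.1 * (q * f (θ p))| ≤ C / n := fun n hn => by
    rw [← integral_sub (hcI hSc n (hε n)) (hcI hFc.continuousOn n (hε n))]
    refine le_trans (le_of_eq ?_) (hb n hn)
    congr 2
    funext p; ring
  obtain ⟨hS, hS1⟩ := integrableOn_of_cutoff hSc h.nonneg hε hε0
    (c := fun n => (∫ p in strip, q * f (θ p)) + C / n) (fun n hn => by
      have h1 := (abs_le.1 (hb' n hn)).2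
      have h2 := (integral_box_cutoff_le hF hF0 n (hε n)).2
      linarith) (hlim _ _)
  obtain ⟨-, hS2⟩ := integrableOn_of_cutoff hFc.continuousOn hF0 hε hε0
    (c := fun n => (∫ p in strip, S p) + C / n) (fun n hn => by
      have h1 := (abs_le.1 (hb' n hn)).1
      have h2 := (integral_box_cutoff_le hS h.nonneg n (hε n)).2
      linarith) (hlim _ _)
  have hSF := le_antisymm hS2 hS1
  -- Tested with `θ`: the term `θ S ≥ 0` is dropped, and `θ ≤ 1` bounds the reaction term.
  obtain ⟨C', ε', hε', hε0', hb2⟩ := h.exists_box_sequence hfc hθ (α := 0) (β := 1) le_rfl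
    zero_le_one (by norm_num)
  have hgc : ContinuousOn (fun p => gx p ^ 2 + gy p ^ 2) strip := by
    have := h.cont_gx
    have := h.cont_gy
    exact Continuous.continuousOn (by fun_prop)
  have hθS : ContinuousOn (fun p => θ p * S p) strip := h.cont.continuousOn.mul hSc
  have hθF : ContinuousOn (fun p => θ p * (q * f (θ p))) strip := (h.cont.mul hFc).continuousOn
  obtain ⟨hG, hG1⟩ := integrableOn_of_cutoff hgc (fun p _ => by positivity) hε' hε0'
    (c := fun n => (∫ p in strip, q * f (θ p)) + C' / n) (fun n hn => by
      have h1 := (abs_le.1 (hb2 n hn)).2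
      have e : ∫ p in box n (ε' n), cutoff n p.1 * (1 * (gx p ^ 2 + gy p ^ 2) +
          (0 + 1 * θ p) * (S p - q * f (θ p))) =
          (∫ p in box n (ε' n), cutoff n p.1 * (gx p ^ 2 + gy p ^ 2)) +
          (∫ p in box n (ε' n), cutoff n p.1 * (θ p * S p)) -
          ∫ p in box n (ε' n), cutoff n p.1 * (θ p * (q * f (θ p))) := by
        have hadd : Integrable (fun p => cutoff n p.1 * (gx p ^ 2 + gy p ^ 2) +
            cutoff n p.1 * (θ p * S p)) (volume.restrict (box n (ε' n))) :=
          Integrable.add (hcI hgc n (hε' n)) (hcI hθS n (hε' n))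
        rw [← integral_add (hcI hgc n (hε' n)) (hcI hθS n (hε' n)),
          ← integral_sub hadd (hcI hθF n (hε' n))]
        congr 1
        funext p; ring
      rw [e] at h1
      have hm : MeasurableSet (box n (ε' n)) := measurableSet_Icc
      have h2 := (integral_box_cutoff_le hF hF0 n (hε' n)).2
      have h3 : ∫ p in box n (ε' n), cutoff n p.1 * (θ p * (q * f (θ p))) ≤
          ∫ p in box n (ε' n), cutoff n p.1 * (q * f (θ p)) := by
        refine setIntegral_mono_on (hcI hθF n (hε' n)) (hcI hFc.continuousOn n (hε' n)) hm
          fun p hp => ?_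
        exact mul_le_mul_of_nonneg_left (mul_le_of_le_one_left
          (hF0 p (box_subset_strip (hε' n) hp)) (h.mem_Icc p).2) (cutoff_nonneg _ _)
      have h4 : 0 ≤ ∫ p in box n (ε' n), cutoff n p.1 * (θ p * S p) :=
        setIntegral_nonneg hm fun p hp => mul_nonneg (cutoff_nonneg _ _)
          (mul_nonneg (h.mem_Icc p).1 (h.nonneg p (box_subset_strip (hε' n) hp)))
      linarith) (hlim _ _)
  exact ⟨hS, hG, hSF, hG1.trans_eq hSF⟩

end Profile

/-! ### The action of a one-dimensional profile. -/

/-- A continuous extension of a function on `[0, 1]` to the line. -/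
def unitExtend (f : ℝ → ℝ) (s : ℝ) : ℝ := f (max 0 (min s 1))

theorem continuous_unitExtend {f : ℝ → ℝ} (hf : ContinuousOn f (Icc 0 1)) :
    Continuous (unitExtend f) :=
  hf.comp_continuous (by fun_prop) fun s =>
    ⟨le_max_left _ _, max_le zero_le_one (min_le_right _ _)⟩

theorem unitExtend_eq {f : ℝ → ℝ} {s : ℝ} (hs : s ∈ Icc (0 : ℝ) 1) : unitExtend f s = f s := by
  rw [unitExtend, min_eq_left hs.2, max_eq_right hs.1]

/-- The primitive of the square root of the reaction term. -/
def sqrtPrimitive (f : ℝ → ℝ) (s : ℝ) : ℝ := ∫ r in (0 : ℝ)..s, Real.sqrt (unitExtend f r)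

theorem hasDerivAt_sqrtPrimitive {f : ℝ → ℝ} (hf : ContinuousOn f (Icc 0 1)) (s : ℝ) :
    HasDerivAt (sqrtPrimitive f) (Real.sqrt (unitExtend f s)) s :=
  ((continuous_unitExtend hf).sqrt.integral_hasStrictDerivAt 0 s).hasDerivAt

theorem sqrtPrimitive_mono {f : ℝ → ℝ} (hf : ContinuousOn f (Icc 0 1)) :
    Monotone (sqrtPrimitive f) :=
  monotone_of_hasDerivAt_nonneg (hasDerivAt_sqrtPrimitive hf) fun _ => Real.sqrt_nonneg _

theorem mul_sqrt_le_sqrtPrimitive_sub {f : ℝ → ℝ} (hf : ContinuousOn f (Icc 0 1)) {f₀ a b : ℝ}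
    (hab : a ≤ b) (ha : 0 ≤ a) (hb : b ≤ 1) (hl : ∀ s ∈ Ioo a b, f₀ ≤ f s) :
    (b - a) * Real.sqrt f₀ ≤ sqrtPrimitive f b - sqrtPrimitive f a := by
  rw [mul_comm]
  refine (convex_Icc a b).mul_sub_le_image_sub_of_le_deriv
    (fun s _ => (hasDerivAt_sqrtPrimitive hf s).continuousAt.continuousWithinAt)
    (fun s _ => (hasDerivAt_sqrtPrimitive hf s).differentiableAt.differentiableWithinAt)
    (fun s hs => ?_) a ⟨le_rfl, hab⟩ b ⟨hab, le_rfl⟩ hab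
  rw [interior_Icc] at hs
  rw [(hasDerivAt_sqrtPrimitive hf s).deriv, unitExtend_eq ⟨by linarith [hs.1], by linarith [hs.2]⟩]
  exact Real.sqrt_le_sqrt (hl s hs)

/-- The action of a profile along a segment. -/
theorem sqrtPrimitive_sub_le_action {q : ℝ} {f : ℝ → ℝ} (hq : 0 ≤ q)
    (hf : ContinuousOn f (Icc 0 1)) (hf0 : ∀ s ∈ Icc (0 : ℝ) 1, 0 ≤ f s) {h h' : ℝ → ℝ} {a b : ℝ}
    (hc : Continuous h) (hc' : Continuous h') (hd : ∀ x ∈ Ioo a b, HasDerivAt h (h' x) x)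
    (hI : ∀ x, h x ∈ Icc (0 : ℝ) 1) {x₀ x₁ : ℝ} (hx₀ : x₀ ∈ Icc a b) (hx₁ : x₁ ∈ Icc a b) :
    2 * Real.sqrt q * |sqrtPrimitive f (h x₁) - sqrtPrimitive f (h x₀)| ≤
      ∫ x in a..b, (h' x ^ 2 + q * f (h x)) := by
  wlog h01 : x₀ ≤ x₁ generalizing x₀ x₁
  · rw [abs_sub_comm]; exact this hx₁ hx₀ (by linarith)
  have hFc : Continuous fun x => f (h x) := hf.comp_continuous hc hI
  have hA : Continuous fun x => h' x ^ 2 + q * f (h x) := (hc'.pow 2).add (hFc.const_mul q)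
  have hE := continuous_unitExtend hf
  have key : ∫ x in x₀..x₁, Real.sqrt (unitExtend f (h x)) * h' x =
      sqrtPrimitive f (h x₁) - sqrtPrimitive f (h x₀) := by
    refine intervalIntegral.integral_eq_sub_of_hasDerivAt_of_le
      (f := fun x => sqrtPrimitive f (h x)) h01 ?_ (fun x hx => ?_)
      (Continuous.intervalIntegrable (by fun_prop) _ _)
    · exact Continuous.continuousOn (Continuous.comp (continuous_iff_continuousAt.2 fun s =>
        (hasDerivAt_sqrtPrimitive hf s).continuousAt) hc)
    · exact (hasDerivAt_sqrtPrimitive hf (h x)).comp x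
        (hd x ⟨lt_of_le_of_lt hx₀.1 hx.1, lt_of_lt_of_le hx.2 hx₁.2⟩)
  rw [← key, ← abs_of_nonneg (a := 2 * Real.sqrt q) (by positivity), ← abs_mul,
    ← intervalIntegral.integral_const_mul]
  calc _ ≤ ∫ x in x₀..x₁, |2 * Real.sqrt q * (Real.sqrt (unitExtend f (h x)) * h' x)| :=
        intervalIntegral.abs_integral_le_integral_abs h01
    _ ≤ ∫ x in x₀..x₁, (h' x ^ 2 + q * f (h x)) := by
        refine intervalIntegral.integral_mono_on h01
          (Continuous.intervalIntegrable (by fun_prop) _ _)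
          (hA.intervalIntegrable _ _) fun x _ => ?_
        -- The Modica–Mortola inequality `2 |h'| √(q f(h)) ≤ h'² + q f(h)`, whose left side is `2√q`
        -- times the absolute derivative of `sqrtPrimitive f ∘ h`.
        rw [unitExtend_eq (hI x)]
        have h1 := Real.sq_sqrt hq
        have h2 := Real.sq_sqrt (hf0 _ (hI x))
        have h3 : q * f (h x) = (Real.sqrt q * Real.sqrt (f (h x))) ^ 2 := by
          rw [mul_pow, h1, h2]
        rw [h3, abs_le]
        constructor <;>
        nlinarith [sq_nonneg (h' x - Real.sqrt q * Real.sqrt (f (h x))),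
          sq_nonneg (h' x + Real.sqrt q * Real.sqrt (f (h x)))]
    _ ≤ _ := by
        refine intervalIntegral.integral_mono_interval hx₀.1 h01 hx₁.2
          (ae_of_all _ fun x => ?_) (hA.intervalIntegrable _ _)
        have := hf0 _ (hI x)
        simp only [Pi.zero_apply]; positivity

/-- If `h` stays in the reactive window, the reaction alone costs `q f₀ (b - a) ≥ f₀ √q`. Otherwise
`h` both visits `[θ₁, θ₄]` and leaves the window, so it crosses a range of length `ζ` on which `f >
f₀`; by `sqrtPrimitive_sub_le_action` this costs `2√q ζ √f₀`. -/
theorem action_lower_bound {q : ℝ} {f : ℝ → ℝ} {f₀ ζ θ₁ θ₄ : ℝ} (hq : 1 ≤ q)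
    (hf₀ : 0 < f₀) (hζ : 0 < ζ)
    (hf : ContinuousOn f (Icc 0 1)) (hf0 : ∀ s ∈ Icc (0 : ℝ) 1, 0 ≤ f s)
    (hr : ReactionBound f f₀ ζ θ₁ θ₄) {h h' : ℝ → ℝ} {a b : ℝ}
    (hc : Continuous h) (hc' : Continuous h') (hd : ∀ x ∈ Ioo a b, HasDerivAt h (h' x) x)
    (hI : ∀ x, h x ∈ Icc (0 : ℝ) 1) (hab : 1 ≤ b - a) {x₀ : ℝ} (hx₀ : x₀ ∈ Icc a b)
    (hhit : h x₀ ∈ Icc θ₁ θ₄) :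
    min f₀ (2 * ζ * Real.sqrt f₀) * Real.sqrt q ≤ ∫ x in a..b, (h' x ^ 2 + q * f (h x)) := by
  have hs1 : 1 ≤ Real.sqrt q := by rwa [Real.one_le_sqrt]
  by_cases hall : ∀ x ∈ Icc a b, h x ∈ Ioo (θ₁ - ζ) (θ₄ + ζ)
  · have hFc : Continuous fun x => f (h x) := hf.comp_continuous hc hI
    have hA : Continuous fun x => h' x ^ 2 + q * f (h x) := (hc'.pow 2).add (hFc.const_mul q)
    calc min f₀ (2 * ζ * Real.sqrt f₀) * Real.sqrt q ≤ f₀ * q := by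
          have h1 : Real.sqrt q ≤ q := by
            have := Real.sq_sqrt (show 0 ≤ q by linarith)
            nlinarith
          exact mul_le_mul (min_le_left _ _) h1 (by positivity) hf₀.le
      _ ≤ (b - a) * (q * f₀) := by nlinarith [mul_pos hf₀ (show 0 < q by linarith)]
      _ = ∫ x in a..b, q * f₀ := by rw [intervalIntegral.integral_const, smul_eq_mul]
      _ ≤ _ := by
          refine intervalIntegral.integral_mono_on (by linarith)
            (Continuous.intervalIntegrable (by fun_prop) _ _)
            (hA.intervalIntegrable _ _) fun x hx => ?_
          have := hr.lower _ (hall x hx)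
          nlinarith [sq_nonneg (h' x)]
  · push Not at hall
    obtain ⟨x₁, hx₁, hout⟩ := hall
    have hG := sqrtPrimitive_mono hf
    have hact := sqrtPrimitive_sub_le_action (q := q) (by linarith) hf hf0 hc hc' hd hI hx₀ hx₁
    have hgap : ζ * Real.sqrt f₀ ≤ |sqrtPrimitive f (h x₁) - sqrtPrimitive f (h x₀)| := by
      have h3 := hr.left
      have h4 := hr.right
      have h14 : θ₁ ≤ θ₄ := hhit.1.trans hhit.2
      by_cases h1 : h x₁ ≤ θ₁ - ζ
      · have h2 := mul_sqrt_le_sqrtPrimitive_sub hf (a := θ₁ - ζ) (b := θ₁) (f₀ := f₀)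
          (by linarith) (by linarith) (by linarith)
          (fun s hs => (hr.lower s ⟨hs.1, by linarith [hs.2]⟩).le)
        have h5 := hG h1
        have h6 := hG hhit.1
        rw [abs_sub_comm]
        refine le_trans ?_ (le_abs_self _)
        rw [sub_sub_cancel] at h2
        linarith
      · have h1' : θ₄ + ζ ≤ h x₁ := by
          by_contra! h7
          exact hout ⟨not_le.1 h1, h7⟩
        have h2 := mul_sqrt_le_sqrtPrimitive_sub hf (a := θ₄) (b := θ₄ + ζ) (f₀ := f₀)
          (by linarith) (by linarith) (by linarith)
          (fun s hs => (hr.lower s ⟨by linarith [hs.1], hs.2⟩).le)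
        have h5 := hG h1'
        have h6 := hG hhit.2
        refine le_trans ?_ (le_abs_self _)
        rw [add_sub_cancel_left] at h2
        linarith
    calc min f₀ (2 * ζ * Real.sqrt f₀) * Real.sqrt q
        ≤ (2 * ζ * Real.sqrt f₀) * Real.sqrt q := by gcongr; exact min_le_right _ _
      _ = 2 * Real.sqrt q * (ζ * Real.sqrt f₀) := by ring
      _ ≤ _ := le_trans (by gcongr) hact

/-! ### Iterated integrals of continuous functions -/

theorem setIntegral_Icc_prod_Icc {F : ℝ × ℝ → ℝ} (hF : Continuous F) {a b c d : ℝ} (hab : a ≤ b)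
    (hcd : c ≤ d) :
    ∫ p in Icc a b ×ˢ Icc c d, F p = ∫ y in c..d, ∫ x in a..b, F (x, y) := by
  have hI : IntegrableOn F (Icc a b ×ˢ Icc c d) :=
    hF.continuousOn.integrableOn_compact (isCompact_Icc.prod isCompact_Icc)
  rw [Measure.volume_eq_prod] at hI ⊢
  rw [IntegrableOn, ← Measure.prod_restrict] at hI
  rw [← Measure.prod_restrict, integral_prod_symm _ hI, integral_Icc_eq_integral_Ioc,
    ← intervalIntegral.integral_of_le hcd]
  refine intervalIntegral.integral_congr fun y _ => ?_
  rw [integral_Icc_eq_integral_Ioc, ← intervalIntegral.integral_of_le hab]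

theorem intervalIntegral_swap {F : ℝ × ℝ → ℝ} (hF : Continuous F) {a b c d : ℝ} (hab : a ≤ b)
    (hcd : c ≤ d) :
    ∫ y in c..d, ∫ x in a..b, F (x, y) = ∫ x in a..b, ∫ y in c..d, F (x, y) := by
  rw [← setIntegral_Icc_prod_Icc hF hab hcd, ← setIntegral_Icc_prod_Icc
    (F := fun p => F (p.2, p.1)) (by fun_prop) hcd hab, Measure.volume_eq_prod]
  exact (setIntegral_prod_swap (Icc a b) (Icc c d) F).symm

theorem continuous_intervalIntegral_fst {F : ℝ × ℝ → ℝ} (hF : Continuous F) (a b : ℝ) :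
    Continuous fun y => ∫ x in a..b, F (x, y) :=
  intervalIntegral.continuous_parametric_intervalIntegral_of_continuous'
    (f := fun y x => F (x, y)) (by simp only [Function.uncurry_def]; fun_prop) a b

theorem continuous_intervalIntegral_snd {F : ℝ × ℝ → ℝ} (hF : Continuous F) (a b : ℝ) :
    Continuous fun x => ∫ y in a..b, F (x, y) :=
  intervalIntegral.continuous_parametric_intervalIntegral_of_continuous'
    (f := fun x y => F (x, y)) (by simp only [Function.uncurry_def]; fun_prop) a b

theorem iterated_mono {F G : ℝ × ℝ → ℝ} (hF : Continuous F) (hG : Continuous G) {a b c d : ℝ}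
    (hab : a ≤ b) (hcd : c ≤ d)
    (hle : ∀ x ∈ Icc a b, ∀ y ∈ Ioo c d, F (x, y) ≤ G (x, y)) :
    ∫ y in c..d, ∫ x in a..b, F (x, y) ≤ ∫ y in c..d, ∫ x in a..b, G (x, y) := by
  refine intervalIntegral.integral_mono_on_of_le_Ioo hcd
    ((continuous_intervalIntegral_fst hF a b).intervalIntegrable _ _)
    ((continuous_intervalIntegral_fst hG a b).intervalIntegrable _ _) fun y hy => ?_
  exact intervalIntegral.integral_mono_on hab (Continuous.intervalIntegrable (by fun_prop) _ _)
    (Continuous.intervalIntegrable (by fun_prop) _ _) fun x hx => hle x hx y hy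

/-! ### A fixed bump function and the weight of a cell -/

/-- A smooth bump supported in `[1/2, 1]`. -/
def bump : ContDiffBump (3 / 4 : ℝ) := ⟨1 / 8, 1 / 4, by norm_num, by norm_num⟩

theorem contDiff_bump : ContDiff ℝ 1 bump := bump.contDiff

@[fun_prop]
theorem continuous_bump : Continuous bump := bump.continuous

@[fun_prop]
theorem continuous_deriv_bump : Continuous (deriv bump) := contDiff_bump.continuous_deriv_one

theorem hasDerivAt_bump (s : ℝ) : HasDerivAt bump (deriv bump s) s :=
  (contDiff_bump.differentiable (by norm_num) s).hasDerivAt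

theorem bump_nonneg (s : ℝ) : 0 ≤ bump s := bump.nonneg

theorem bump_le_one (s : ℝ) : bump s ≤ 1 := bump.le_one

theorem bump_eq_zero_of_le {s : ℝ} (hs : s ≤ 1 / 2) : bump s = 0 := by
  refine bump.zero_of_le_dist ?_
  rw [Real.dist_eq, abs_sub_comm]
  refine le_trans ?_ (le_abs_self _)
  change (1 / 4 : ℝ) ≤ _
  linarith

theorem bump_eq_zero_of_ge {s : ℝ} (hs : 1 ≤ s) : bump s = 0 := by
  refine bump.zero_of_le_dist ?_
  rw [Real.dist_eq]
  refine le_trans ?_ (le_abs_self _)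
  change (1 / 4 : ℝ) ≤ _
  linarith

theorem bump_eq_one {s : ℝ} (hs : s ∈ Icc (5 / 8 : ℝ) (7 / 8)) : bump s = 1 := by
  refine bump.one_of_mem_closedBall ?_
  rw [Metric.mem_closedBall, Real.dist_eq, abs_le]
  change -(1 / 8 : ℝ) ≤ _ ∧ _ ≤ (1 / 8 : ℝ)
  constructor <;> linarith [hs.1, hs.2]

theorem deriv_bump_eq_zero_of_gt {s : ℝ} (hs : 1 < s) : deriv bump s = 0 := by
  have h : (bump : ℝ → ℝ) =ᶠ[𝓝 s] fun _ => 0 := by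
    filter_upwards [eventually_gt_nhds hs] with r hr using bump_eq_zero_of_ge hr.le
  rw [h.deriv_eq]; simp

theorem exists_deriv_bump_bound : ∃ K, 1 ≤ K ∧ ∀ s, 0 ≤ s → deriv bump s ^ 2 ≤ K := by
  obtain ⟨C, hC⟩ := isCompact_Icc.exists_bound_of_continuousOn
    (continuous_deriv_bump.continuousOn (s := Icc (0 : ℝ) 1))
  refine ⟨C ^ 2 + 1, by nlinarith [sq_nonneg C], fun s hs => ?_⟩
  by_cases h1 : s ≤ 1
  · have := hC s ⟨hs, h1⟩
    rw [Real.norm_eq_abs] at this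
    rw [← sq_abs]
    nlinarith [abs_nonneg (deriv bump s)]
  · rw [deriv_bump_eq_zero_of_gt (not_le.1 h1)]
    nlinarith [sq_nonneg C]

theorem integral_bump_div_le {b c : ℝ} (hb : 0 < b) (hc : 0 ≤ c) :
    ∫ s in (0 : ℝ)..c, bump (s / b) ≤ b := by
  have hint : ∀ u v : ℝ, IntervalIntegrable (fun s => bump (s / b)) volume u v := fun u v =>
    Continuous.intervalIntegrable (by fun_prop) _ _
  have h1 : ∫ s in (0 : ℝ)..c, bump (s / b) ≤ ∫ s in (0 : ℝ)..(max b c), bump (s / b) :=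
    intervalIntegral.integral_mono_interval le_rfl hc (le_max_right _ _)
      (ae_of_all _ fun s => bump_nonneg _) (hint _ _)
  have h2 : ∫ s in b..(max b c), bump (s / b) = 0 := by
    rw [intervalIntegral.integral_congr (g := fun _ => 0), intervalIntegral.integral_zero]
    intro s hs
    rw [uIcc_of_le (le_max_left _ _)] at hs
    exact bump_eq_zero_of_ge ((one_le_div hb).2 hs.1)
  have h3 : ∫ s in (0 : ℝ)..b, bump (s / b) ≤ ∫ _ in (0 : ℝ)..b, (1 : ℝ) :=
    intervalIntegral.integral_mono_on hb.le (hint _ _) intervalIntegrable_const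
      fun s _ => bump_le_one _
  have h4 := intervalIntegral.integral_add_adjacent_intervals (hint 0 b) (hint b (max b c))
  simp at h3
  linarith

theorem le_integral_bump_div {b c : ℝ} (hb : 0 < b) (hc : b ≤ c) :
    b / 4 ≤ ∫ s in (0 : ℝ)..c, bump (s / b) := by
  have hint : ∀ u v : ℝ, IntervalIntegrable (fun s => bump (s / b)) volume u v := fun u v =>
    Continuous.intervalIntegrable (by fun_prop) _ _
  calc b / 4 = ∫ _ in (5 / 8 * b)..(7 / 8 * b), (1 : ℝ) := by simp; ring
    _ ≤ ∫ s in (5 / 8 * b)..(7 / 8 * b), bump (s / b) := by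
        refine intervalIntegral.integral_mono_on (by linarith) intervalIntegrable_const (hint _ _)
          fun s hs => ?_
        rw [bump_eq_one ⟨by rw [le_div_iff₀ hb]; exact hs.1, by rw [div_le_iff₀ hb]; exact hs.2⟩]
    _ ≤ _ := intervalIntegral.integral_mono_interval (by positivity) (by linarith) (by linarith)
        (ae_of_all _ fun s => bump_nonneg _) (hint _ _)

/-- Along a horizontal line with `c = sin y`, the stream function `ψ = c sin x` serves as the
variable of integration on half a cell. The cosine in the cell weights is its Jacobian. -/
theorem integral_comp_sin {k : ℝ → ℝ} (hk : Continuous k) (c : ℝ) :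
    ∫ x in (0 : ℝ)..(Real.pi / 2), k (Real.sin x * c) * (Real.cos x * c) = ∫ s in (0 : ℝ)..c, k s := by
  have := intervalIntegral.integral_comp_mul_deriv (a := 0) (b := Real.pi / 2) (g := k)
    (f := fun x => Real.sin x * c) (f' := fun x => Real.cos x * c)
    (fun x _ => (Real.hasDerivAt_sin x).mul_const c) (Continuous.continuousOn (by fun_prop)) hk
  simpa using this

theorem integral_comp_sin_abs {k : ℝ → ℝ} (hk : Continuous k) {c : ℝ} :
    ∫ x in (0 : ℝ)..Real.pi, k (Real.sin x * c) * (|Real.cos x| * c) =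
      2 * ∫ s in (0 : ℝ)..c, k s := by
  have hint : ∀ u v : ℝ, IntervalIntegrable
      (fun x => k (Real.sin x * c) * (|Real.cos x| * c)) volume u v := fun u v =>
    Continuous.intervalIntegrable (by fun_prop) _ _
  have h1 : ∫ x in (0 : ℝ)..(Real.pi / 2), k (Real.sin x * c) * (|Real.cos x| * c) =
      ∫ s in (0 : ℝ)..c, k s := by
    rw [← integral_comp_sin hk]
    refine intervalIntegral.integral_congr fun x hx => ?_
    rw [uIcc_of_le (by positivity)] at hx
    rw [abs_of_nonneg (Real.cos_nonneg_of_mem_Icc ⟨by linarith [hx.1, Real.pi_pos], hx.2⟩)]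
  have h2 : ∫ x in (Real.pi / 2)..Real.pi, k (Real.sin x * c) * (|Real.cos x| * c) =
      ∫ x in (0 : ℝ)..(Real.pi / 2), k (Real.sin x * c) * (|Real.cos x| * c) := by
    have := intervalIntegral.integral_comp_sub_left (a := Real.pi / 2) (b := Real.pi)
      (fun x => k (Real.sin x * c) * (|Real.cos x| * c)) Real.pi
    simp only [Real.sin_pi_sub, Real.cos_pi_sub, abs_neg, sub_self] at this
    rw [this]
    congr 1; ring
  rw [← intervalIntegral.integral_add_adjacent_intervals (hint 0 (Real.pi / 2)) (hint _ _), h2, h1]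
  ring

/-- The weight `η(ψ / b) cos x sin² y`, with `ψ = sin x sin y`. -/
def cellWeight (b : ℝ) (p : ℝ × ℝ) : ℝ :=
  bump (Real.sin p.1 * Real.sin p.2 / b) * (Real.cos p.1 * Real.sin p.2 ^ 2)

@[fun_prop]
theorem continuous_cellWeight (b : ℝ) : Continuous (cellWeight b) := by
  unfold cellWeight; fun_prop

theorem cellWeight_nonneg (b : ℝ) {x : ℝ} (hx : x ∈ Icc 0 (Real.pi / 2)) (y : ℝ) :
    0 ≤ cellWeight b (x, y) :=
  mul_nonneg (bump_nonneg _) (mul_nonneg (Real.cos_nonneg_of_mem_Icc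
    ⟨by linarith [hx.1, Real.pi_pos], hx.2⟩) (sq_nonneg _))

theorem integral_cellWeight_fst (b y : ℝ) :
    ∫ x in (0 : ℝ)..(Real.pi / 2), cellWeight b (x, y) =
      Real.sin y * ∫ s in (0 : ℝ)..(Real.sin y), bump (s / b) := by
  rw [← integral_comp_sin (k := fun s => bump (s / b)) (by fun_prop),
    ← intervalIntegral.integral_const_mul]
  refine intervalIntegral.integral_congr fun x _ => ?_
  simp only [cellWeight]; ring

/-- The average over the left half of a cell, not normalized. -/
def leftMean (b : ℝ) (θ : ℝ × ℝ → ℝ) : ℝ :=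
  ∫ y in (0 : ℝ)..Real.pi, ∫ x in (0 : ℝ)..(Real.pi / 2), θ (x, y) * cellWeight b (x, y)

/-- The average over the right half of a cell, not normalized. -/
def rightMean (b : ℝ) (θ : ℝ × ℝ → ℝ) : ℝ :=
  ∫ y in (0 : ℝ)..Real.pi, ∫ x in (0 : ℝ)..(Real.pi / 2),
    θ (Real.pi - x, y) * cellWeight b (x, y)

/-- The normalization of `leftMean` and `rightMean`. -/
def cellMass (b : ℝ) : ℝ :=
  ∫ y in (0 : ℝ)..Real.pi, ∫ x in (0 : ℝ)..(Real.pi / 2), cellWeight b (x, y)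

theorem le_cellMass {b : ℝ} (hb : 0 < b) (hb' : b ≤ 1 / 2) : b / 4 ≤ cellMass b := by
  have hπ := Real.pi_gt_three
  have hc := continuous_intervalIntegral_fst (continuous_cellWeight b) 0 (Real.pi / 2)
  have hnn : ∀ y ∈ Icc 0 Real.pi, 0 ≤ ∫ x in (0 : ℝ)..(Real.pi / 2), cellWeight b (x, y) :=
    fun y _ => intervalIntegral.integral_nonneg (by positivity) fun x hx => cellWeight_nonneg b hx y
  -- On `[π/6, 5π/6]`, of length `2π/3 ≥ 2`, one has `sin y ≥ 1/2 ≥ b`. So the range of `ψ` contains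
  -- the whole support of the bump, and each line contributes at least `(1/2)(b/4)`.
  calc b / 4 ≤ (5 * Real.pi / 6 - Real.pi / 6) * (1 / 2 * (b / 4)) := by nlinarith
    _ = ∫ _ in (Real.pi / 6)..(5 * Real.pi / 6), 1 / 2 * (b / 4) := by
        rw [intervalIntegral.integral_const, smul_eq_mul]
    _ ≤ ∫ y in (Real.pi / 6)..(5 * Real.pi / 6), ∫ x in (0 : ℝ)..(Real.pi / 2),
          cellWeight b (x, y) := by
        refine intervalIntegral.integral_mono_on (by linarith) intervalIntegrable_const
          (hc.intervalIntegrable _ _) fun y hy => ?_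
        have hsin : 1 / 2 ≤ Real.sin y := by
          rw [← Real.sin_pi_div_six]
          by_cases h : y ≤ Real.pi / 2
          · exact Real.sin_le_sin_of_le_of_le_pi_div_two (by linarith) h hy.1
          · rw [← Real.sin_pi_sub y]
            exact Real.sin_le_sin_of_le_of_le_pi_div_two (by linarith) (by linarith)
              (by linarith [hy.2])
        rw [integral_cellWeight_fst]
        exact mul_le_mul hsin (le_integral_bump_div hb (hb'.trans hsin)) (by positivity)
          (by linarith)
    _ ≤ _ := by
        refine intervalIntegral.integral_mono_interval (by positivity) (by linarith) (by linarith)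
          ?_ (hc.intervalIntegrable _ _)
        filter_upwards [ae_restrict_mem measurableSet_Ioc] with y hy
        exact hnn y ⟨hy.1.le, hy.2⟩

theorem integral_cellWeight_fst_le {b : ℝ} (hb : 0 < b) {y : ℝ} (hy : y ∈ Icc 0 Real.pi) :
    ∫ x in (0 : ℝ)..(Real.pi / 2), cellWeight b (x, y) ≤ b := by
  rw [integral_cellWeight_fst]
  have h0 := Real.sin_nonneg_of_mem_Icc hy
  have h1 := integral_bump_div_le hb h0
  have h2 : 0 ≤ ∫ s in (0 : ℝ)..(Real.sin y), bump (s / b) :=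
    intervalIntegral.integral_nonneg h0 fun s _ => bump_nonneg _
  nlinarith [Real.sin_le_one y]

theorem hit_or_above_or_below {h : ℝ → ℝ} (hc : Continuous h) {a b θ₁ θ₄ : ℝ}
    (hθ : θ₁ ≤ θ₄) :
    (∃ x ∈ Icc a b, h x ∈ Icc θ₁ θ₄) ∨ (∀ x ∈ Icc a b, θ₄ < h x) ∨ ∀ x ∈ Icc a b, h x < θ₁ := by
  by_contra! hcon
  obtain ⟨h1, ⟨x, hx, hx4⟩, ⟨y, hy, hy1⟩⟩ := hcon
  have hx1 : h x < θ₁ := by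
    by_contra! h'
    exact h1 x hx ⟨h', hx4⟩
  obtain ⟨z, hz, hz'⟩ := intermediate_value_uIcc (hc.continuousOn (s := uIcc x y))
    (show θ₁ ∈ uIcc (h x) (h y) by rw [uIcc_of_le (by linarith)]; exact ⟨hx1.le, hy1⟩)
  exact h1 z (uIcc_subset_Icc hx hy hz) ⟨hz'.ge, hz'.trans_le hθ⟩

/-! ### Energy cost of a cell with intermediate mean temperature. -/

section Profile

variable {q P : ℝ} {f : ℝ → ℝ} {θ gx gy S : ℝ × ℝ → ℝ}

/-- The energy density `|∇θ|² + q f(θ)`. -/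
def energyDensity (q : ℝ) (f : ℝ → ℝ) (θ gx gy : ℝ × ℝ → ℝ) (p : ℝ × ℝ) : ℝ :=
  gx p ^ 2 + gy p ^ 2 + q * f (θ p)

theorem Profile.continuous_energyDensity (h : Profile q P f θ gx gy S)
    (hf : ContinuousOn f (Icc 0 1)) : Continuous (energyDensity q f θ gx gy) :=
  ((h.cont_gx.pow 2).add (h.cont_gy.pow 2)).add (continuous_const.mul (h.continuous_reaction hf))

theorem Profile.energyDensity_nonneg (h : Profile q P f θ gx gy S) (hq : 0 ≤ q)
    (hf0 : ∀ s ∈ Icc (0 : ℝ) 1, 0 ≤ f s) (p : ℝ × ℝ) : 0 ≤ energyDensity q f θ gx gy p := by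
  have := hf0 _ (h.mem_Icc p)
  unfold energyDensity; positivity

theorem Profile.hasDerivAt_fst (h : Profile q P f θ gx gy S) (x : ℝ) {y : ℝ}
    (hy : y ∈ Ioo 0 Real.pi) : HasDerivAt (fun x => θ (x, y)) (gx (x, y)) x := by
  have h1 : HasDerivAt (fun x => ((x, y) : ℝ × ℝ)) (1, 0) x :=
    (hasDerivAt_id x).prodMk (hasDerivAt_const x y)
  have := (h.hasFDerivAt (x, y) ⟨mem_univ _, hy⟩).comp_hasDerivAt
    (f := fun x => ((x, y) : ℝ × ℝ)) x h1
  exact this.congr_deriv (by simp)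

theorem Profile.hasDerivAt_snd (h : Profile q P f θ gx gy S) (x : ℝ) {y : ℝ}
    (hy : y ∈ Ioo 0 Real.pi) : HasDerivAt (fun y => θ (x, y)) (gy (x, y)) y := by
  have h1 : HasDerivAt (fun y => ((x, y) : ℝ × ℝ)) (0, 1) y :=
    (hasDerivAt_const y x).prodMk (hasDerivAt_id y)
  have := (h.hasFDerivAt (x, y) ⟨mem_univ _, hy⟩).comp_hasDerivAt
    (f := fun y => ((x, y) : ℝ × ℝ)) y h1
  exact this.congr_deriv (by simp)

variable {f₀ ζ θ₁ θ₄ : ℝ}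

theorem Profile.horizontal_action (h : Profile q P f θ gx gy S) (hq : 1 ≤ q) (hf₀ : 0 < f₀)
    (hζ : 0 < ζ) (hf : ContinuousOn f (Icc 0 1)) (hf0 : ∀ s ∈ Icc (0 : ℝ) 1, 0 ≤ f s)
    (hr : ReactionBound f f₀ ζ θ₁ θ₄) {a b x y : ℝ} (hab : 1 ≤ b - a) (hx : x ∈ Icc a b)
    (hy : y ∈ Ioo 0 Real.pi) (hhit : θ (x, y) ∈ Icc θ₁ θ₄) :
    min f₀ (2 * ζ * Real.sqrt f₀) * Real.sqrt q ≤
      ∫ x in a..b, energyDensity q f θ gx gy (x, y) := by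
  have hc := h.cont
  have hcx := h.cont_gx
  have hcy := h.cont_gy
  have hE := h.continuous_energyDensity hf
  have hF := h.continuous_reaction hf
  have h1 : Continuous fun x => gx (x, y) ^ 2 + q * f (θ (x, y)) :=
    Continuous.add (by fun_prop) (continuous_const.mul (hF.comp (by fun_prop : Continuous
      fun x : ℝ => ((x, y) : ℝ × ℝ))))
  refine (action_lower_bound hq hf₀ hζ hf hf0 hr (h := fun x => θ (x, y))
    (h' := fun x => gx (x, y)) (by fun_prop) (by fun_prop) (fun x _ => h.hasDerivAt_fst x hy)
    (fun x => h.mem_Icc _) hab hx hhit).trans ?_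
  refine intervalIntegral.integral_mono_on (by linarith) (h1.intervalIntegrable _ _)
    (Continuous.intervalIntegrable (by fun_prop) _ _) fun x _ => ?_
  unfold energyDensity
  nlinarith [sq_nonneg (gy (x, y))]

theorem Profile.vertical_action (h : Profile q P f θ gx gy S) (hq : 1 ≤ q) (hf₀ : 0 < f₀)
    (hζ : 0 < ζ) (hf : ContinuousOn f (Icc 0 1)) (hf0 : ∀ s ∈ Icc (0 : ℝ) 1, 0 ≤ f s)
    (hr : ReactionBound f f₀ ζ θ₁ θ₄) {x y : ℝ}
    (hy : y ∈ Icc 0 Real.pi) (hhit : θ (x, y) ∈ Icc θ₁ θ₄) :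
    min f₀ (2 * ζ * Real.sqrt f₀) * Real.sqrt q ≤
      ∫ y in (0 : ℝ)..Real.pi, energyDensity q f θ gx gy (x, y) := by
  have hc := h.cont
  have hcx := h.cont_gx
  have hcy := h.cont_gy
  have hE := h.continuous_energyDensity hf
  have hF := h.continuous_reaction hf
  have h1 : Continuous fun y => gy (x, y) ^ 2 + q * f (θ (x, y)) :=
    Continuous.add (by fun_prop) (continuous_const.mul (hF.comp (by fun_prop : Continuous
      fun y : ℝ => ((x, y) : ℝ × ℝ))))
  refine (action_lower_bound hq hf₀ hζ hf hf0 hr (h := fun y => θ (x, y))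
    (h' := fun y => gy (x, y)) (by fun_prop) (by fun_prop) (fun y hy => h.hasDerivAt_snd x hy)
    (fun y => h.mem_Icc _) (by linarith [Real.pi_gt_three]) hy hhit).trans ?_
  refine intervalIntegral.integral_mono_on Real.pi_pos.le (h1.intervalIntegrable _ _)
    (Continuous.intervalIntegrable (by fun_prop) _ _) fun x _ => ?_
  unfold energyDensity
  nlinarith [sq_nonneg (gx (x, y))]

theorem leftMean_mono {b : ℝ} {F G : ℝ × ℝ → ℝ} (hF : Continuous F) (hG : Continuous G)
    (hle : ∀ x ∈ Icc 0 (Real.pi / 2), ∀ y ∈ Ioo 0 Real.pi, F (x, y) ≤ G (x, y)) :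
    leftMean b F ≤ leftMean b G :=
  iterated_mono (F := fun p => F p * cellWeight b p) (G := fun p => G p * cellWeight b p)
    (by fun_prop) (by fun_prop) (by positivity) Real.pi_pos.le fun x hx y hy =>
    mul_le_mul_of_nonneg_right (hle x hx y hy) (cellWeight_nonneg b hx y)

theorem leftMean_const_add_snd {b : ℝ} {k : ℝ → ℝ} (hk : Continuous k) (c : ℝ) :
    leftMean b (fun p => c + k p.2) = c * cellMass b +
      ∫ y in (0 : ℝ)..Real.pi, k y * ∫ x in (0 : ℝ)..(Real.pi / 2), cellWeight b (x, y) := by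
  have hw := continuous_intervalIntegral_fst (continuous_cellWeight b) 0 (Real.pi / 2)
  rw [leftMean, cellMass, ← intervalIntegral.integral_const_mul, ← intervalIntegral.integral_add
    (Continuous.intervalIntegrable (by fun_prop) _ _)
    (Continuous.intervalIntegrable (by fun_prop) _ _)]
  refine intervalIntegral.integral_congr fun y _ => ?_
  simp only
  rw [intervalIntegral.integral_const_mul, add_mul]

/-- A cell with little energy has its mean temperature outside of the middle of `[θ₁, θ₄]`. -/
theorem Profile.mean_dichotomy (h : Profile q P f θ gx gy S) (hq : 1 ≤ q) (hf₀ : 0 < f₀)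
    (hζ : 0 < ζ) (hf : ContinuousOn f (Icc 0 1)) (hf0 : ∀ s ∈ Icc (0 : ℝ) 1, 0 ≤ f s)
    (hr : ReactionBound f f₀ ζ θ₁ θ₄) {d : ℝ} (hd : 0 < d) (hdθ : θ₄ - θ₁ = d) {b : ℝ}
    (hb : 0 < b) (hb' : b ≤ 1 / 2)
    (hE : ∫ y in (0 : ℝ)..Real.pi, ∫ x in (0 : ℝ)..Real.pi, energyDensity q f θ gx gy (x, y) <
      d / 16 * (min f₀ (2 * ζ * Real.sqrt f₀) * Real.sqrt q)) :
    (θ₄ - d / 4) * cellMass b < leftMean b θ ∨ leftMean b θ < (θ₁ + d / 4) * cellMass b := by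
  set c := min f₀ (2 * ζ * Real.sqrt f₀) * Real.sqrt q with hc
  have hq0 : 0 < q := by linarith
  have hc0 : 0 < c := mul_pos (lt_min hf₀ (by positivity)) (Real.sqrt_pos.2 hq0)
  have hπ := Real.pi_gt_three
  have hec := h.continuous_energyDensity hf
  have henn := h.energyDensity_nonneg hq0.le hf0
  have hθc := h.cont
  set E : ℝ → ℝ := fun y => ∫ x in (0 : ℝ)..Real.pi, energyDensity q f θ gx gy (x, y) with hEdef
  have hEc : Continuous E := continuous_intervalIntegral_fst hec 0 Real.pi
  have hE0 : ∀ y, 0 ≤ E y := fun y =>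
    intervalIntegral.integral_nonneg Real.pi_pos.le fun x _ => henn _
  have hd1 : d ≤ 1 := by have := hr.left; have := hr.right; linarith
  have hW := le_cellMass hb hb'
  have hwc := continuous_intervalIntegral_fst (continuous_cellWeight b) 0 (Real.pi / 2)
  have htri : ∀ y ∈ Ioo 0 Real.pi, c ≤ E y ∨ (∀ x ∈ Icc 0 Real.pi, θ₄ < θ (x, y)) ∨
      ∀ x ∈ Icc 0 Real.pi, θ (x, y) < θ₁ := fun y hy => by
    rcases hit_or_above_or_below (a := 0) (b := Real.pi) (h := fun x => θ (x, y)) (by fun_prop)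
      (show θ₁ ≤ θ₄ by linarith) with ⟨x, hx, hx'⟩ | h' | h'
    · exact Or.inl (h.horizontal_action hq hf₀ hζ hf hf0 hr (by linarith) hx hy hx')
    · exact Or.inr (Or.inl h')
    · exact Or.inr (Or.inr h')
  -- Chebyshev's inequality: `E y / c` is at least `1` on the lines that meet `[θ₁, θ₄]`, so their
  -- weight is small. The bounds `b` per line from above and `b / 4` on the mass from below turn `d
  -- / 16` into `d / 4`.
  have herr : ∫ y in (0 : ℝ)..Real.pi, (E y / c) *
      ∫ x in (0 : ℝ)..(Real.pi / 2), cellWeight b (x, y) < d / 4 * cellMass b := by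
    calc _ ≤ ∫ y in (0 : ℝ)..Real.pi, (E y / c) * b := by
          refine intervalIntegral.integral_mono_on Real.pi_pos.le
            (Continuous.intervalIntegrable (by fun_prop) _ _)
            (Continuous.intervalIntegrable (by fun_prop) _ _) fun y hy => ?_
          exact mul_le_mul_of_nonneg_left (integral_cellWeight_fst_le hb hy)
            (div_nonneg (hE0 y) hc0.le)
      _ = (∫ y in (0 : ℝ)..Real.pi, E y) / c * b := by
          rw [intervalIntegral.integral_mul_const, intervalIntegral.integral_div]
      _ < d / 16 * b := by
          refine mul_lt_mul_of_pos_right ?_ hb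
          rwa [div_lt_iff₀ hc0]
      _ ≤ d / 4 * cellMass b := by nlinarith
  by_cases hcold : ∃ y ∈ Ioo 0 Real.pi, ∀ x ∈ Icc 0 Real.pi, θ (x, y) < θ₁
  · right
    -- A cold line and a hot line in the same cell would force every vertical line through `θ₁`, at
    -- a total cost of at least `π c`, far more than the cell contains.
    have hnohot : ∀ y ∈ Ioo 0 Real.pi, ¬ ∀ x ∈ Icc 0 Real.pi, θ₄ < θ (x, y) := by
      intro y₄ hy₄ hhot
      obtain ⟨y₁, hy₁, hcold⟩ := hcold
      have hline : ∀ x ∈ Icc 0 Real.pi, c ≤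
          ∫ y in (0 : ℝ)..Real.pi, energyDensity q f θ gx gy (x, y) := fun x hx => by
        obtain ⟨z, hz, hz'⟩ := intermediate_value_uIcc
          (Continuous.continuousOn (by fun_prop) (s := uIcc y₁ y₄) (f := fun y => θ (x, y)))
          (show θ₁ ∈ uIcc (θ (x, y₁)) (θ (x, y₄)) by
            have h1 := hcold x hx
            have h2 := hhot x hx
            rw [uIcc_of_le (by linarith)]; exact ⟨h1.le, by linarith⟩)
        exact h.vertical_action hq hf₀ hζ hf hf0 hr
          (uIcc_subset_Icc (Ioo_subset_Icc_self hy₁) (Ioo_subset_Icc_self hy₄) hz)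
          ⟨hz'.ge, by simp only at hz'; linarith⟩
      have h1 : ∫ _ in (0 : ℝ)..Real.pi, c ≤ ∫ x in (0 : ℝ)..Real.pi,
          ∫ y in (0 : ℝ)..Real.pi, energyDensity q f θ gx gy (x, y) :=
        intervalIntegral.integral_mono_on Real.pi_pos.le intervalIntegrable_const
          ((continuous_intervalIntegral_snd hec 0 Real.pi).intervalIntegrable _ _) hline
      rw [← intervalIntegral_swap hec Real.pi_pos.le Real.pi_pos.le,
        intervalIntegral.integral_const, smul_eq_mul] at h1
      nlinarith
    have h1 : leftMean b θ ≤ leftMean b (fun p => θ₁ + E p.2 / c) := by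
      refine leftMean_mono hθc (by fun_prop) fun x hx y hy => ?_
      have hx' : x ∈ Icc 0 Real.pi := ⟨hx.1, by linarith [hx.2]⟩
      have h2 := div_nonneg (hE0 y) hc0.le
      rcases htri y hy with h3 | h3 | h3
      · have := (one_le_div hc0).2 h3
        have := (h.mem_Icc (x, y)).2
        have := hr.left
        simp only; linarith
      · exact absurd h3 (hnohot y hy)
      · have := h3 x hx'
        simp only; linarith
    rw [leftMean_const_add_snd (k := fun y => E y / c) (by fun_prop)] at h1
    linarith
  · left
    have h1 : leftMean b (fun p => θ₄ + -(E p.2 / c)) ≤ leftMean b θ := by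
      refine leftMean_mono (by fun_prop) hθc fun x hx y hy => ?_
      have hx' : x ∈ Icc 0 Real.pi := ⟨hx.1, by linarith [hx.2]⟩
      have h2 := div_nonneg (hE0 y) hc0.le
      rcases htri y hy with h3 | h3 | h3
      · have := (one_le_div hc0).2 h3
        have := (h.mem_Icc (x, y)).1
        have := hr.right
        simp only; linarith
      · have := h3 x hx'
        simp only; linarith
      · exact absurd ⟨y, hy, h3⟩ hcold
    rw [leftMean_const_add_snd (k := fun y => -(E y / c)) (by fun_prop)] at h1
    simp only [neg_mul, intervalIntegral.integral_neg] at h1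
    linarith

end Profile

/-! ### Transport by the flow inside a cell. -/

theorem integral_le_of_support {k : ℝ → ℝ} (hk : Continuous k) {b c M : ℝ} (hb : 0 ≤ b)
    (hc : 0 ≤ c) (h0 : ∀ s, 0 ≤ k s) (hM : ∀ s, 0 ≤ s → k s ≤ M) (hz : ∀ s, b < s → k s = 0) :
    ∫ s in (0 : ℝ)..c, k s ≤ M * b := by
  have hint : ∀ u v : ℝ, IntervalIntegrable k volume u v := fun u v => hk.intervalIntegrable u v
  have h1 : ∫ s in (0 : ℝ)..c, k s ≤ ∫ s in (0 : ℝ)..(max b c), k s :=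
    intervalIntegral.integral_mono_interval le_rfl hc (le_max_right _ _)
      (ae_of_all _ fun s => h0 _) (hint _ _)
  have h2 : ∫ s in b..(max b c), k s = 0 := by
    rw [intervalIntegral.integral_of_le (le_max_left _ _)]
    exact setIntegral_eq_zero_of_forall_eq_zero fun s hs => hz s hs.1
  have h3 : ∫ s in (0 : ℝ)..b, k s ≤ ∫ _ in (0 : ℝ)..b, M :=
    intervalIntegral.integral_mono_on hb (hint _ _) intervalIntegrable_const fun s hs => hM s hs.1
  have h4 := intervalIntegral.integral_add_adjacent_intervals (hint 0 b) (hint b (max b c))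
  rw [intervalIntegral.integral_const, sub_zero, smul_eq_mul] at h3
  linarith

/-- The stream function is at most the distance to each side of the cell, and the bump vanishes
below `1 / 2`. -/
theorem bump_stream_eq_zero {b x y : ℝ} (hb : 0 < b) (hx : x ∈ Icc 0 Real.pi)
    (hy : y ∈ Icc 0 Real.pi)
    (h : x ≤ b / 2 ∨ Real.pi - x ≤ b / 2 ∨ y ≤ b / 2 ∨ Real.pi - y ≤ b / 2) :
    bump (Real.sin x * Real.sin y / b) = 0 := by
  apply bump_eq_zero_of_le
  rw [div_le_iff₀ hb]
  have h1 := Real.sin_nonneg_of_mem_Icc hx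
  have h2 := Real.sin_nonneg_of_mem_Icc hy
  have h3 := Real.sin_le_one x
  have h4 := Real.sin_le_one y
  have key : ∀ z, 0 ≤ z → z ≤ b / 2 → Real.sin z ≤ b / 2 := fun z hz hz' =>
    (Real.sin_le hz).trans hz'
  rcases h with h | h | h | h
  · have := key x hx.1 h; nlinarith
  · have := key _ (sub_nonneg.2 hx.2) h
    rw [Real.sin_pi_sub] at this; nlinarith
  · have := key y hy.1 h; nlinarith
  · have := key _ (sub_nonneg.2 hy.2) h
    rw [Real.sin_pi_sub] at this; nlinarith

/-- The test function `η(ψ / b) cos y`, which transports heat between two sides of a cell. -/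
def transportTest (b : ℝ) (p : ℝ × ℝ) : ℝ :=
  bump (Real.sin p.1 * Real.sin p.2 / b) * Real.cos p.2

/-- The `x`-derivative of `transportTest`. -/
def transportTestX (b : ℝ) (p : ℝ × ℝ) : ℝ :=
  deriv bump (Real.sin p.1 * Real.sin p.2 / b) * (Real.cos p.1 * Real.sin p.2 / b) * Real.cos p.2

/-- The `y`-derivative of `transportTest`. -/
def transportTestY (b : ℝ) (p : ℝ × ℝ) : ℝ :=
  deriv bump (Real.sin p.1 * Real.sin p.2 / b) * (Real.sin p.1 * Real.cos p.2 / b) * Real.cos p.2 -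
    bump (Real.sin p.1 * Real.sin p.2 / b) * Real.sin p.2

@[fun_prop]
theorem continuous_transportTestX (b : ℝ) : Continuous (transportTestX b) := by
  unfold transportTestX; fun_prop

@[fun_prop]
theorem continuous_transportTestY (b : ℝ) : Continuous (transportTestY b) := by
  unfold transportTestY; fun_prop

@[fun_prop]
theorem continuous_transportTest (b : ℝ) : Continuous (transportTest b) := by
  unfold transportTest; fun_prop

theorem hasGrad_transportTest (b : ℝ) (p : ℝ × ℝ) :
    HasGrad (transportTest b) (transportTestX b p) (transportTestY b p) p := by
  have h1 : HasGrad (fun r : ℝ × ℝ => Real.sin r.1 * Real.sin r.2 / b)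
      (Real.cos p.1 * Real.sin p.2 / b) (Real.sin p.1 * Real.cos p.2 / b) p := by
    have := ((hasGrad_of_fst (Real.hasDerivAt_sin p.1)).mul
      (hasGrad_of_snd (Real.hasDerivAt_sin p.2))).const_mul b⁻¹
    simp only [← div_eq_inv_mul] at this
    exact this.congr (by ring) (by ring)
  have h2 := (HasGrad.comp (k := bump) (hasDerivAt_bump _) h1).mul
    (hasGrad_of_snd (Real.hasDerivAt_cos p.2))
  refine h2.congr ?_ ?_
  · simp only [transportTestX]; ring
  · simp only [transportTestY]; ring

theorem abs_transportTest_le_one (b : ℝ) (p : ℝ × ℝ) : |transportTest b p| ≤ 1 := by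
  rw [transportTest, abs_mul, abs_of_nonneg (bump_nonneg _)]
  exact mul_le_one₀ (bump_le_one _) (abs_nonneg _) (Real.abs_cos_le_one _)

/-- The gradient has size `1 / b` on the layer `ψ ~ b`, whose area is of order `b log(1/b)` because
of the corners. The logarithm is avoided: the squared gradient contains the factor `|cos x| sin y`
(or its mirror image), which is the Jacobian of `ψ` along a line, so each line contributes only
order `1 / b`. -/
theorem exists_transportTest_bound : ∃ K, 0 < K ∧ ∀ b : ℝ, 0 < b → b ≤ 1 / 2 →
    ∫ p in Icc 0 Real.pi ×ˢ Icc 0 Real.pi, (transportTestX b p ^ 2 + transportTestY b p ^ 2) ≤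
      K / b := by
  obtain ⟨K₀, hK₀, hK⟩ := exists_deriv_bump_bound
  -- Three copies of `2π K₀ / b`, one from the `x`-derivative and two from the squared sum in the
  -- `y`-derivative, and a remainder `2π² ≤ π² / b`.
  refine ⟨6 * Real.pi * K₀ + Real.pi ^ 2, by positivity, fun b hb hb' => ?_⟩
  have hπ := Real.pi_pos
  set k : ℝ → ℝ := fun s => deriv bump (s / b) ^ 2 / b ^ 2 with hk
  have hkc : Continuous k := by simp only [hk]; fun_prop
  have hk0 : ∀ s, 0 ≤ k s := fun s => by simp only [hk]; positivity
  have hkint : ∀ c, 0 ≤ c → ∫ s in (0 : ℝ)..c, k s ≤ K₀ / b := fun c hc => by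
    have := integral_le_of_support hkc (b := b) (c := c) (M := K₀ / b ^ 2) hb.le hc hk0
      (fun s hs => by
        simp only [hk]
        gcongr
        exact hK _ (by positivity))
      (fun s hs => by
        simp only [hk]
        rw [deriv_bump_eq_zero_of_gt ((one_lt_div hb).2 hs)]; simp)
    refine this.trans (le_of_eq ?_)
    field_simp
  have hA : ∫ y in (0 : ℝ)..Real.pi, ∫ x in (0 : ℝ)..Real.pi,
      k (Real.sin x * Real.sin y) * (|Real.cos x| * Real.sin y) ≤ 2 * Real.pi * (K₀ / b) := by
    have hc := continuous_intervalIntegral_fst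
      (F := fun p => k (Real.sin p.1 * Real.sin p.2) * (|Real.cos p.1| * Real.sin p.2))
      (by fun_prop) 0 Real.pi
    calc _ ≤ ∫ y in (0 : ℝ)..Real.pi, 2 * (K₀ / b) := by
          refine intervalIntegral.integral_mono_on hπ.le (hc.intervalIntegrable _ _)
            intervalIntegrable_const fun y hy => ?_
          rw [integral_comp_sin_abs hkc]
          linarith [hkint _ (Real.sin_nonneg_of_mem_Icc hy)]
      _ = _ := by rw [intervalIntegral.integral_const, smul_eq_mul]; ring
  have hB : ∫ y in (0 : ℝ)..Real.pi, ∫ x in (0 : ℝ)..Real.pi,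
      k (Real.sin x * Real.sin y) * (|Real.cos y| * Real.sin x) ≤ 2 * Real.pi * (K₀ / b) := by
    rw [intervalIntegral_swap (F := fun p => k (Real.sin p.1 * Real.sin p.2) *
      (|Real.cos p.2| * Real.sin p.1)) (by fun_prop) hπ.le hπ.le]
    refine le_trans (le_of_eq ?_) hA
    simp only [mul_comm (Real.sin _) (Real.sin _)]
  rw [setIntegral_Icc_prod_Icc (by fun_prop) hπ.le hπ.le]
  calc _ ≤ ∫ y in (0 : ℝ)..Real.pi, ∫ x in (0 : ℝ)..Real.pi,
        ((k (Real.sin x * Real.sin y) * (|Real.cos x| * Real.sin y) +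
          2 * (k (Real.sin x * Real.sin y) * (|Real.cos y| * Real.sin x))) + 2) := by
        refine iterated_mono (F := fun p => transportTestX b p ^ 2 + transportTestY b p ^ 2)
          (G := fun p => (k (Real.sin p.1 * Real.sin p.2) * (|Real.cos p.1| * Real.sin p.2) +
          2 * (k (Real.sin p.1 * Real.sin p.2) * (|Real.cos p.2| * Real.sin p.1))) + 2)
          (by fun_prop) (by fun_prop) hπ.le hπ.le fun x hx y hy => ?_
        have hsx := Real.sin_nonneg_of_mem_Icc hx
        have hsy := Real.sin_nonneg_of_mem_Icc (Ioo_subset_Icc_self hy)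
        have hsx1 := Real.sin_le_one x
        have hsy1 := Real.sin_le_one y
        have hcx := Real.abs_cos_le_one x
        have hcy := Real.abs_cos_le_one y
        have hkk := hk0 (Real.sin x * Real.sin y)
        have e1 : transportTestX b (x, y) ^ 2 = k (Real.sin x * Real.sin y) *
            ((|Real.cos x| * Real.sin y) * (|Real.cos x| * Real.sin y * |Real.cos y| ^ 2)) := by
          simp only [transportTestX, hk, sq_abs]
          rw [show |Real.cos x| * Real.sin y * (|Real.cos x| * Real.sin y * Real.cos y ^ 2) =
            |Real.cos x| ^ 2 * Real.sin y ^ 2 * Real.cos y ^ 2 by ring, sq_abs]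
          field_simp
        have e2 : (deriv bump (Real.sin x * Real.sin y / b) * (Real.sin x * Real.cos y / b) *
            Real.cos y) ^ 2 = k (Real.sin x * Real.sin y) *
            ((|Real.cos y| * Real.sin x) * (|Real.cos y| * Real.sin x * |Real.cos y| ^ 2)) := by
          simp only [hk]
          rw [show |Real.cos y| * Real.sin x * (|Real.cos y| * Real.sin x * |Real.cos y| ^ 2) =
            (|Real.cos y| ^ 2) ^ 2 * Real.sin x ^ 2 by ring, sq_abs]
          field_simp
        have hX : transportTestX b (x, y) ^ 2 ≤
            k (Real.sin x * Real.sin y) * (|Real.cos x| * Real.sin y) := by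
          rw [e1]
          refine mul_le_mul_of_nonneg_left (mul_le_of_le_one_right (by positivity) ?_) hkk
          exact mul_le_one₀ (mul_le_one₀ hcx hsy hsy1) (by positivity)
            (pow_le_one₀ (abs_nonneg _) hcy)
        have hY : (deriv bump (Real.sin x * Real.sin y / b) * (Real.sin x * Real.cos y / b) *
            Real.cos y) ^ 2 ≤ k (Real.sin x * Real.sin y) * (|Real.cos y| * Real.sin x) := by
          rw [e2]
          refine mul_le_mul_of_nonneg_left (mul_le_of_le_one_right (by positivity) ?_) hkk
          exact mul_le_one₀ (mul_le_one₀ hcy hsx hsx1) (by positivity)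
            (pow_le_one₀ (abs_nonneg _) hcy)
        have hZ : (bump (Real.sin x * Real.sin y / b) * Real.sin y) ^ 2 ≤ 1 :=
          pow_le_one₀ (mul_nonneg (bump_nonneg _) hsy) (mul_le_one₀ (bump_le_one _) hsy hsy1)
        have hY2 : transportTestY b (x, y) ^ 2 ≤
            2 * (k (Real.sin x * Real.sin y) * (|Real.cos y| * Real.sin x)) + 2 := by
          simp only [transportTestY]
          nlinarith [sq_nonneg (deriv bump (Real.sin x * Real.sin y / b) *
            (Real.sin x * Real.cos y / b) * Real.cos y +
            bump (Real.sin x * Real.sin y / b) * Real.sin y)]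
        simp only
        linarith
    _ = (∫ y in (0 : ℝ)..Real.pi, ∫ x in (0 : ℝ)..Real.pi,
          k (Real.sin x * Real.sin y) * (|Real.cos x| * Real.sin y)) +
        2 * (∫ y in (0 : ℝ)..Real.pi, ∫ x in (0 : ℝ)..Real.pi,
          k (Real.sin x * Real.sin y) * (|Real.cos y| * Real.sin x)) + 2 * Real.pi ^ 2 := by
        simp only [← setIntegral_Icc_prod_Icc (F := fun p => (k (Real.sin p.1 * Real.sin p.2) *
            (|Real.cos p.1| * Real.sin p.2) + 2 * (k (Real.sin p.1 * Real.sin p.2) *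
            (|Real.cos p.2| * Real.sin p.1))) + 2) (by fun_prop) hπ.le hπ.le,
          ← setIntegral_Icc_prod_Icc (F := fun p => k (Real.sin p.1 * Real.sin p.2) *
            (|Real.cos p.1| * Real.sin p.2)) (by fun_prop) hπ.le hπ.le,
          ← setIntegral_Icc_prod_Icc (F := fun p => k (Real.sin p.1 * Real.sin p.2) *
            (|Real.cos p.2| * Real.sin p.1)) (by fun_prop) hπ.le hπ.le]
        have hcomp : IsCompact (Icc (0 : ℝ) Real.pi ×ˢ Icc (0 : ℝ) Real.pi) :=
          isCompact_Icc.prod isCompact_Icc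
        have hi : ∀ F : ℝ × ℝ → ℝ, Continuous F →
            Integrable F (volume.restrict (Icc 0 Real.pi ×ˢ Icc 0 Real.pi)) := fun F hF =>
          hF.continuousOn.integrableOn_compact hcomp
        rw [integral_add (hi _ (by fun_prop)) (hi _ (by fun_prop)),
          integral_add (hi _ (by fun_prop)) (hi _ (by fun_prop)), integral_const_mul,
          setIntegral_const, smul_eq_mul, Measure.volume_eq_prod, measureReal_prod_prod,
          Real.volume_real_Icc_of_le hπ.le, sub_zero]
        ring
    _ ≤ 2 * Real.pi * (K₀ / b) + 2 * (2 * Real.pi * (K₀ / b)) + 2 * Real.pi ^ 2 := by gcongr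
    _ ≤ _ := by
        rw [add_div]
        have : 2 * Real.pi ^ 2 ≤ Real.pi ^ 2 / b := by
          rw [le_div_iff₀ hb]; nlinarith [sq_nonneg Real.pi]
        have e : 6 * Real.pi * K₀ / b = 2 * Real.pi * (K₀ / b) + 2 * (2 * Real.pi * (K₀ / b)) := by
          ring
        linarith

/-- A square compactly contained in a cell, outside of which the transport test vanishes. -/
def innerSquare (b : ℝ) : Set (ℝ × ℝ) :=
  Icc (b / 2, b / 2) (Real.pi - b / 2, Real.pi - b / 2)

/-- The interior of a cell. -/
def cell : Set (ℝ × ℝ) := Ioo 0 Real.pi ×ˢ Ioo 0 Real.pi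

theorem cell_subset_strip : cell ⊆ strip := prod_mono (subset_univ _) subset_rfl

theorem innerSquare_subset_cell {b : ℝ} (hb : 0 < b) : innerSquare b ⊆ cell := fun p hp => by
  simp only [innerSquare, mem_Icc, Prod.le_def] at hp
  exact ⟨⟨by linarith [hp.1.1], by linarith [hp.2.1]⟩, ⟨by linarith [hp.1.2], by linarith [hp.2.2]⟩⟩

theorem cell_subset_Icc : cell ⊆ Icc 0 Real.pi ×ˢ Icc 0 Real.pi :=
  prod_mono Ioo_subset_Icc_self Ioo_subset_Icc_self

theorem cellWeight_eq_zero {b : ℝ} (hb : 0 < b) {p : ℝ × ℝ}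
    (hp : p ∈ Icc 0 Real.pi ×ˢ Icc 0 Real.pi) (hp' : p ∉ innerSquare b) : cellWeight b p = 0 := by
  have : p.1 ≤ b / 2 ∨ Real.pi - p.1 ≤ b / 2 ∨ p.2 ≤ b / 2 ∨ Real.pi - p.2 ≤ b / 2 := by
    by_contra! hcon
    refine hp' ?_
    simp only [innerSquare, mem_Icc, Prod.le_def]
    exact ⟨⟨hcon.1.le, hcon.2.2.1.le⟩, ⟨by linarith [hcon.2.1], by linarith [hcon.2.2.2]⟩⟩
  rw [cellWeight, bump_stream_eq_zero hb hp.1 hp.2 this, zero_mul]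

/-- The factor `cos x` is odd under the reflection `x ↦ π - x`, so the right half enters with a
minus sign. -/
theorem integral_innerSquare_mul_cellWeight {θ : ℝ × ℝ → ℝ} (hθ : Continuous θ) {b : ℝ}
    (hb : 0 < b) :
    ∫ p in innerSquare b, θ p * cellWeight b p = leftMean b θ - rightMean b θ := by
  have hπ := Real.pi_pos
  rw [← setIntegral_eq_of_subset_of_forall_sdiff_eq_zero (measurableSet_Icc.prod measurableSet_Icc)
    ((innerSquare_subset_cell hb).trans cell_subset_Icc) (fun p hp => by
      rw [cellWeight_eq_zero hb hp.1 hp.2, mul_zero]),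
    setIntegral_Icc_prod_Icc (by fun_prop) hπ.le hπ.le, leftMean, rightMean]
  have h1 := continuous_intervalIntegral_fst (F := fun p => θ p * cellWeight b p) (by fun_prop)
    0 (Real.pi / 2)
  have h2 := continuous_intervalIntegral_fst
    (F := fun p => θ (Real.pi - p.1, p.2) * cellWeight b p) (by fun_prop) 0 (Real.pi / 2)
  rw [← intervalIntegral.integral_sub (h1.intervalIntegrable _ _) (h2.intervalIntegrable _ _)]
  refine intervalIntegral.integral_congr fun y _ => ?_
  simp only
  have hint : ∀ u v : ℝ, IntervalIntegrable (fun x => θ (x, y) * cellWeight b (x, y)) volume u v :=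
    fun u v => Continuous.intervalIntegrable (by fun_prop) _ _
  rw [← intervalIntegral.integral_add_adjacent_intervals (hint 0 (Real.pi / 2)) (hint _ _),
    sub_eq_add_neg]
  congr 1
  have h3 := intervalIntegral.integral_comp_sub_left (a := 0) (b := Real.pi / 2)
      (fun x => θ (x, y) * cellWeight b (x, y)) Real.pi
  rw [sub_zero, show Real.pi - Real.pi / 2 = Real.pi / 2 by ring] at h3
  rw [← h3, ← intervalIntegral.integral_neg]
  refine intervalIntegral.integral_congr fun x _ => ?_
  simp only [cellWeight, Real.sin_pi_sub, Real.cos_pi_sub]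
  ring

section Profile

variable {q P : ℝ} {f : ℝ → ℝ} {θ gx gy S : ℝ × ℝ → ℝ}

/-- The equation is tested with `transportTest`. The flow annihilates functions of its stream
function, so it acts only on `cos y`, and `u · ∇ transportTest` is `cellWeight`. There are no
boundary terms since the test function vanishes near the sides of the cell. -/
theorem Profile.transport_identity (h : Profile q P f θ gx gy S) {b : ℝ} (hb : 0 < b)
    (hb' : b ≤ 1 / 2) (hf : ContinuousOn f (Icc 0 1)) :
    P * (leftMean b θ - rightMean b θ) =
      ∫ p in innerSquare b, (transportTestX b p * gx p + transportTestY b p * gy p +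
        transportTest b p * (S p - q * f (θ p))) := by
  have hπ := Real.pi_gt_three
  have hcx := h.cont_gx
  have hcy := h.cont_gy
  have hc := h.cont
  have hFc := h.continuous_reaction hf
  have hsub : innerSquare b ⊆ strip := (innerSquare_subset_cell hb).trans cell_subset_strip
  have hu : ∀ p : ℝ × ℝ, HasGrad (fun r : ℝ × ℝ => -P * (Real.sin r.1 * Real.cos r.2))
      (-P * (Real.cos p.1 * Real.cos p.2)) (P * (Real.sin p.1 * Real.sin p.2)) p := fun p =>
    (((hasGrad_of_fst (Real.hasDerivAt_sin p.1)).mul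
      (hasGrad_of_snd (Real.hasDerivAt_cos p.2))).const_mul (-P)).congr (by ring) (by ring)
  have hv : ∀ p : ℝ × ℝ, HasGrad (fun r : ℝ × ℝ => P * (Real.cos r.1 * Real.sin r.2))
      (-P * (Real.sin p.1 * Real.sin p.2)) (P * (Real.cos p.1 * Real.cos p.2)) p := fun p =>
    (((hasGrad_of_fst (Real.hasDerivAt_cos p.1)).mul
      (hasGrad_of_snd (Real.hasDerivAt_sin p.2))).const_mul P).congr (by ring) (by ring)
  have hT : ∀ p ∈ strip, HasGrad (fun r => transportTest b r * θ r)
      (transportTestX b p * θ p + transportTest b p * gx p)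
      (transportTestY b p * θ p + transportTest b p * gy p) p := fun p hp =>
    (hasGrad_transportTest b p).mul (h.hasGrad hp)
  have key := h.integral_divergence (φ := transportTest b) (a := (b / 2, b / 2))
    (b := (Real.pi - b / 2, Real.pi - b / 2))
    (A := fun r => transportTest b r * θ r * (-P * (Real.sin r.1 * Real.cos r.2)))
    (B := fun r => transportTest b r * θ r * (P * (Real.cos r.1 * Real.sin r.2)))
    ⟨by simp only; linarith, by simp only; linarith⟩ hsub (fun p _ => hasGrad_transportTest b p)
    (fun p hp => (hT p hp).mul (hu p)) (fun p hp => (hT p hp).mul (hv p)) (by fun_prop)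
    (by fun_prop) (by fun_prop) (by fun_prop)
  have hz : ∀ x ∈ Icc 0 Real.pi, ∀ y ∈ Icc 0 Real.pi,
      x ≤ b / 2 ∨ Real.pi - x ≤ b / 2 ∨ y ≤ b / 2 ∨ Real.pi - y ≤ b / 2 →
      transportTest b (x, y) = 0 := fun x hx y hy hxy => by
    rw [transportTest, bump_stream_eq_zero hb hx hy hxy, zero_mul]
  have hmem : ∀ x ∈ uIcc (b / 2) (Real.pi - b / 2), x ∈ Icc 0 Real.pi := fun x hx => by
    rw [uIcc_of_le (by linarith)] at hx
    exact ⟨by linarith [hx.1], by linarith [hx.2]⟩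
  have h0 : b / 2 ∈ Icc 0 Real.pi := ⟨by linarith, by linarith⟩
  have h1 : Real.pi - b / 2 ∈ Icc 0 Real.pi := ⟨by linarith, by linarith⟩
  have hzi : ∀ G : ℝ → ℝ, (∀ x ∈ uIcc (b / 2) (Real.pi - b / 2), G x = 0) →
      ∫ x in (b / 2)..(Real.pi - b / 2), G x = 0 := fun G hG => by
    rw [intervalIntegral.integral_congr (g := fun _ => (0 : ℝ)) hG, intervalIntegral.integral_zero]
  rw [hzi _ (fun x hx => by simp [hz x (hmem x hx) _ h1 (by simp)]),
    hzi _ (fun x hx => by simp [hz x (hmem x hx) _ h0 (by simp)]),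
    hzi _ (fun y hy => by simp [hz _ h1 y (hmem y hy) (by simp)]),
    hzi _ (fun y hy => by simp [hz _ h0 y (hmem y hy) (by simp)])] at key
  simp only [sub_zero, add_zero] at key
  have hI : ∀ F : ℝ × ℝ → ℝ, ContinuousOn F strip → IntegrableOn F (innerSquare b) := fun F hF =>
    (hF.mono hsub).integrableOn_compact isCompact_Icc
  have hSc := h.continuousOn_source hf
  have hRc : Continuous fun p => q * f (θ p) := continuous_const.mul hFc
  have hR : ContinuousOn (fun p => transportTestX b p * gx p + transportTestY b p * gy p +
      transportTest b p * (S p - q * f (θ p))) strip :=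
    ContinuousOn.add (by fun_prop) (ContinuousOn.mul (by fun_prop) (hSc.sub hRc.continuousOn))
  rw [← integral_innerSquare_mul_cellWeight hc hb, ← integral_const_mul, eq_comm, ← sub_eq_zero,
    ← integral_sub (hI _ hR) (hI _ (by fun_prop))]
  refine Eq.trans (setIntegral_congr_fun measurableSet_Icc fun p _ => ?_) key
  simp only [cellWeight, transportTest, transportTestX, transportTestY]
  ring

/-- Strong advection equilibrates the temperature between the two sides of a cell. -/
theorem Profile.transport_bound (h : Profile q P f θ gx gy S) (hq : 0 ≤ q)
    (hf : ContinuousOn f (Icc 0 1)) (hf0 : ∀ s ∈ Icc (0 : ℝ) 1, 0 ≤ f s)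
    (hS : IntegrableOn S strip) {K : ℝ} {b s : ℝ} (hb : 0 < b) (hb' : b ≤ 1 / 2) (hs : 0 < s)
    (hK : ∫ p in Icc 0 Real.pi ×ˢ Icc 0 Real.pi,
      (transportTestX b p ^ 2 + transportTestY b p ^ 2) ≤ K / b) :
    |P| * |leftMean b θ - rightMean b θ| ≤
      (s / 2 + 1) * (∫ p in cell, (S p + energyDensity q f θ gx gy p)) + K / (2 * s * b) := by
  have hsub := innerSquare_subset_cell hb
  have hsub' := hsub.trans cell_subset_strip
  have hEc := h.continuous_energyDensity hf
  have hcomp : IsCompact (Icc (0 : ℝ) Real.pi ×ˢ Icc (0 : ℝ) Real.pi) :=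
    isCompact_Icc.prod isCompact_Icc
  have hEI : IntegrableOn (fun p => S p + energyDensity q f θ gx gy p) cell :=
    (hS.mono_set cell_subset_strip).add
      ((hEc.continuousOn.integrableOn_compact hcomp).mono_set cell_subset_Icc)
  have hNI : IntegrableOn (fun p => transportTestX b p ^ 2 + transportTestY b p ^ 2)
      (Icc 0 Real.pi ×ˢ Icc 0 Real.pi) :=
    Continuous.continuousOn (by fun_prop) |>.integrableOn_compact hcomp
  rw [← abs_mul, h.transport_identity hb hb' hf]
  have hmeas : MeasurableSet (innerSquare b) := measurableSet_Icc
  have h1 : IntegrableOn (fun p => (s / 2 + 1) * (S p + energyDensity q f θ gx gy p))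
    (innerSquare b) := (hEI.mono_set hsub).const_mul _
  have h2 : IntegrableOn (fun p => 1 / (2 * s) * (transportTestX b p ^ 2 + transportTestY b p ^ 2))
    (innerSquare b) := (hNI.mono_set (hsub.trans cell_subset_Icc)).const_mul _
  have hbound : ‖∫ p in innerSquare b, (transportTestX b p * gx p + transportTestY b p * gy p +
      transportTest b p * (S p - q * f (θ p)))‖ ≤ ∫ p in innerSquare b,
      ((s / 2 + 1) * (S p + energyDensity q f θ gx gy p) +
        1 / (2 * s) * (transportTestX b p ^ 2 + transportTestY b p ^ 2)) := by
    refine norm_integral_le_of_norm_le (h1.add h2) ?_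
    filter_upwards [ae_restrict_mem hmeas] with p hp
    have hSp := h.nonneg p (hsub' hp)
    have hfp := mul_nonneg hq (hf0 _ (h.mem_Icc p))
    have hφ := abs_transportTest_le_one b p
    -- The free weight `s` balances the Dirichlet energy against the norm of the test function, of
    -- order `1 / b`; it is fixed in `exists_quartic_bound`.
    have young : ∀ u v : ℝ, |u * v| ≤ s / 2 * v ^ 2 + 1 / (2 * s) * u ^ 2 := fun u v => by
      have e : s / 2 * v ^ 2 + 1 / (2 * s) * u ^ 2 - |u| * |v| = (s * |v| - |u|) ^ 2 / (2 * s) := by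
        rw [← sq_abs u, ← sq_abs v]; field_simp; ring
      rw [abs_mul]
      have := div_nonneg (sq_nonneg (s * |v| - |u|)) (by positivity : 0 ≤ 2 * s)
      linarith
    have e3 : |transportTest b p * (S p - q * f (θ p))| ≤ S p + q * f (θ p) := by
      rw [abs_mul]
      refine (mul_le_of_le_one_left (abs_nonneg _) hφ).trans ?_
      rw [abs_le]; constructor <;> linarith
    rw [Real.norm_eq_abs]
    refine (abs_add_three _ _ _).trans ?_
    have := young (transportTestX b p) (gx p)
    have := young (transportTestY b p) (gy p)
    unfold energyDensity
    nlinarith [mul_nonneg hs.le hSp, mul_nonneg hs.le hfp, sq_nonneg (gx p), sq_nonneg (gy p)]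
  refine hbound.trans ?_
  rw [integral_add h1 h2, integral_const_mul, integral_const_mul]
  refine add_le_add (mul_le_mul_of_nonneg_left ?_ (by positivity)) ?_
  · refine setIntegral_mono_set hEI ?_ (ae_of_all _ hsub)
    filter_upwards [ae_restrict_mem (isOpen_Ioo.prod isOpen_Ioo).measurableSet] with p hp
    exact add_nonneg (h.nonneg p (cell_subset_strip hp)) (h.energyDensity_nonneg hq hf0 p)
  · calc _ ≤ 1 / (2 * s) * (K / b) := by
          refine mul_le_mul_of_nonneg_left (le_trans ?_ hK) (by positivity)
          exact setIntegral_mono_set hNI (ae_of_all _ fun p => by positivity)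
            (ae_of_all _ (hsub.trans cell_subset_Icc))
      _ = _ := by field_simp

end Profile

/-! ### Diffusion across the line between two cells. -/

section Profile

variable {q P : ℝ} {f : ℝ → ℝ} {θ gx gy S : ℝ × ℝ → ℝ}

/-- The two points are mirror images in the line `x = π` that separates two cells. -/
theorem Profile.sin_mul_abs_sub_le (h : Profile q P f θ gx gy S) (hq : 0 ≤ q)
    (hf : ContinuousOn f (Icc 0 1)) (hf0 : ∀ s ∈ Icc (0 : ℝ) 1, 0 ≤ f s) {r : ℝ} (hr : 0 < r)
    {x y : ℝ} (hx : x ∈ Icc 0 (Real.pi / 2)) (hy : y ∈ Ioo 0 Real.pi) :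
    Real.sin y * |θ (x + Real.pi, y) - θ (Real.pi - x, y)| ≤
      r * (∫ x in (0 : ℝ)..(2 * Real.pi), energyDensity q f θ gx gy (x, y)) +
        x * Real.sin y ^ 2 / (2 * r) := by
  have hπ := Real.pi_pos
  have hcx := h.cont_gx
  have hEc := h.continuous_energyDensity hf
  have hsy := Real.sin_pos_of_mem_Ioo hy
  have hle : Real.pi - x ≤ x + Real.pi := by linarith [hx.1]
  have hint : ∀ u v : ℝ, IntervalIntegrable (fun x => energyDensity q f θ gx gy (x, y)) volume u v :=
    fun u v => Continuous.intervalIntegrable (by fun_prop) _ _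
  have hftc : ∫ z in (Real.pi - x)..(x + Real.pi), gx (z, y) =
      θ (x + Real.pi, y) - θ (Real.pi - x, y) :=
    intervalIntegral.integral_eq_sub_of_hasDerivAt (fun z _ => h.hasDerivAt_fst z hy)
      (Continuous.intervalIntegrable (by fun_prop) _ _)
  have h1 : ∫ z in (Real.pi - x)..(x + Real.pi), energyDensity q f θ gx gy (z, y) ≤
      ∫ z in (0 : ℝ)..(2 * Real.pi), energyDensity q f θ gx gy (z, y) :=
    intervalIntegral.integral_mono_interval (by linarith [hx.2]) hle (by linarith [hx.2])
      (ae_of_all _ fun z => h.energyDensity_nonneg hq hf0 _) (hint _ _)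
  calc Real.sin y * |θ (x + Real.pi, y) - θ (Real.pi - x, y)|
      ≤ Real.sin y * ∫ z in (Real.pi - x)..(x + Real.pi), |gx (z, y)| := by
        rw [← hftc]
        exact mul_le_mul_of_nonneg_left (intervalIntegral.abs_integral_le_integral_abs hle) hsy.le
    _ = ∫ z in (Real.pi - x)..(x + Real.pi), Real.sin y * |gx (z, y)| :=
        (intervalIntegral.integral_const_mul _ _).symm
    _ ≤ ∫ z in (Real.pi - x)..(x + Real.pi), (r * energyDensity q f θ gx gy (z, y) +
          Real.sin y ^ 2 / (4 * r)) := by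
        refine intervalIntegral.integral_mono_on hle
          (Continuous.intervalIntegrable (by fun_prop) _ _)
          (Continuous.intervalIntegrable (by fun_prop) _ _) fun z _ => ?_
        have e : r * |gx (z, y)| ^ 2 + Real.sin y ^ 2 / (4 * r) - Real.sin y * |gx (z, y)| =
            (2 * r * |gx (z, y)| - Real.sin y) ^ 2 / (4 * r) := by field_simp; ring
        have e1 := div_nonneg (sq_nonneg (2 * r * |gx (z, y)| - Real.sin y))
          (by positivity : 0 ≤ 4 * r)
        have e2 := mul_nonneg hq (hf0 _ (h.mem_Icc (z, y)))
        rw [sq_abs] at e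
        unfold energyDensity
        nlinarith [sq_nonneg (gy (z, y))]
    _ = r * (∫ z in (Real.pi - x)..(x + Real.pi), energyDensity q f θ gx gy (z, y)) +
          x * Real.sin y ^ 2 / (2 * r) := by
        rw [intervalIntegral.integral_add ((hint _ _).const_mul r) intervalIntegrable_const,
          intervalIntegral.integral_const_mul, intervalIntegral.integral_const, smul_eq_mul]
        field_simp; ring
    _ ≤ _ := by gcongr

/-- Diffusion bounds the jump of the temperature across the line between two cells. -/
theorem Profile.jump_bound (h : Profile q P f θ gx gy S) (hq : 0 ≤ q)
    (hf : ContinuousOn f (Icc 0 1)) (hf0 : ∀ s ∈ Icc (0 : ℝ) 1, 0 ≤ f s) {r b : ℝ} (hr : 0 < r)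
    (hb : 0 < b) :
    |leftMean b (fun p => θ (p.1 + Real.pi, p.2)) - rightMean b θ| ≤
      b * (r * (∫ y in (0 : ℝ)..Real.pi, ∫ x in (0 : ℝ)..(2 * Real.pi),
        energyDensity q f θ gx gy (x, y)) + Real.pi * b / r) := by
  have hπ := Real.pi_pos
  have hc := h.cont
  have hEc := h.continuous_energyDensity hf
  set G : ℝ → ℝ := fun y => ∫ x in (0 : ℝ)..(2 * Real.pi), energyDensity q f θ gx gy (x, y) with hG
  have hGc : Continuous G := continuous_intervalIntegral_fst hEc 0 (2 * Real.pi)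
  have hG0 : ∀ y, 0 ≤ G y := fun y =>
    intervalIntegral.integral_nonneg (by positivity) fun x _ => h.energyDensity_nonneg hq hf0 _
  set D : ℝ × ℝ → ℝ := fun p =>
    (θ (p.1 + Real.pi, p.2) - θ (Real.pi - p.1, p.2)) * cellWeight b p with hD
  have hDc : Continuous D := by simp only [hD]; fun_prop
  have hdiff : leftMean b (fun p => θ (p.1 + Real.pi, p.2)) - rightMean b θ =
      ∫ y in (0 : ℝ)..Real.pi, ∫ x in (0 : ℝ)..(Real.pi / 2), D (x, y) := by
    have h1 := continuous_intervalIntegral_fst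
      (F := fun p => θ (p.1 + Real.pi, p.2) * cellWeight b p) (by fun_prop) 0 (Real.pi / 2)
    have h2 := continuous_intervalIntegral_fst
      (F := fun p => θ (Real.pi - p.1, p.2) * cellWeight b p) (by fun_prop) 0 (Real.pi / 2)
    rw [leftMean, rightMean, ← intervalIntegral.integral_sub (h1.intervalIntegrable _ _)
      (h2.intervalIntegrable _ _)]
    refine intervalIntegral.integral_congr fun y _ => ?_
    simp only
    rw [← intervalIntegral.integral_sub (Continuous.intervalIntegrable (by fun_prop) _ _)
      (Continuous.intervalIntegrable (by fun_prop) _ _)]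
    simp only [hD, sub_mul]
  have hpt : ∀ y ∈ Ioo 0 Real.pi, |∫ x in (0 : ℝ)..(Real.pi / 2), D (x, y)| ≤
      (r * G y + b / r) * b := fun y hy => by
    have hsy := Real.sin_pos_of_mem_Ioo hy
    have hM : 0 ≤ r * G y + b / r := add_nonneg (mul_nonneg hr.le (hG0 y)) (by positivity)
    calc |∫ x in (0 : ℝ)..(Real.pi / 2), D (x, y)|
        ≤ ∫ x in (0 : ℝ)..(Real.pi / 2), |D (x, y)| :=
          intervalIntegral.abs_integral_le_integral_abs (by positivity)
      _ ≤ ∫ x in (0 : ℝ)..(Real.pi / 2), (r * G y + b / r) *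
            (bump (Real.sin x * Real.sin y / b) * (Real.cos x * Real.sin y)) := by
          refine intervalIntegral.integral_mono_on (by positivity)
            (Continuous.intervalIntegrable (by fun_prop) _ _)
            (Continuous.intervalIntegrable (by fun_prop) _ _) fun x hx => ?_
          have hcx : 0 ≤ Real.cos x := Real.cos_nonneg_of_mem_Icc ⟨by linarith [hx.1], hx.2⟩
          have hkey := h.sin_mul_abs_sub_le hq hf hf0 hr hx hy
          by_cases hbump : 1 ≤ Real.sin x * Real.sin y / b
          · simp [hD, cellWeight, bump_eq_zero_of_ge hbump]
          rw [not_le, div_lt_one hb] at hbump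
          -- On the support of the bump `ψ < b`, so Jordan's inequality `sin x ≥ 2x/π` gives `x sin
          -- y ≤ πb/2 ≤ 2b`.
          have hxs : x * Real.sin y ≤ 2 * b := by
            have h1 := Real.mul_le_sin hx.1 hx.2
            have h2 : 2 / Real.pi * x * Real.sin y ≤ b :=
              (mul_le_mul_of_nonneg_right h1 hsy.le).trans hbump.le
            rw [div_mul_eq_mul_div, div_mul_eq_mul_div, div_le_iff₀ hπ] at h2
            nlinarith [Real.pi_lt_four]
          have h3 : x * Real.sin y ^ 2 / (2 * r) ≤ b / r := by
            rw [div_le_div_iff₀ (by positivity) hr]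
            nlinarith [Real.sin_le_one y, mul_nonneg hx.1 hsy.le,
              mul_nonneg (mul_nonneg hx.1 hsy.le) (sub_nonneg.2 (Real.sin_le_one y)), mul_nonneg hr.le
              (mul_nonneg (mul_nonneg hx.1 hsy.le) (sub_nonneg.2 (Real.sin_le_one y))),
              mul_nonneg hr.le (sub_nonneg.2 hxs)]
          -- Of the factor `sin² y` in `cellWeight`, one `sin y` compensates the length `2x` of the
          -- segment between the mirror points, which is controlled only by `b / sin y`; the other
          -- belongs to the Jacobian of `ψ`.
          calc |D (x, y)| = (Real.sin y * |θ (x + Real.pi, y) - θ (Real.pi - x, y)|) *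
                (bump (Real.sin x * Real.sin y / b) * (Real.cos x * Real.sin y)) := by
                simp only [hD]
                rw [abs_mul, abs_of_nonneg (cellWeight_nonneg b hx y), cellWeight]
                ring
            _ ≤ _ := mul_le_mul_of_nonneg_right (by simp only [hG]; linarith)
                (mul_nonneg (bump_nonneg _) (by positivity))
      _ = (r * G y + b / r) * ∫ s in (0 : ℝ)..(Real.sin y), bump (s / b) := by
          rw [intervalIntegral.integral_const_mul,
            ← integral_comp_sin (k := fun s => bump (s / b)) (by fun_prop)]
      _ ≤ _ := mul_le_mul_of_nonneg_left (integral_bump_div_le hb hsy.le) hM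
  rw [hdiff]
  calc _ ≤ ∫ y in (0 : ℝ)..Real.pi, |∫ x in (0 : ℝ)..(Real.pi / 2), D (x, y)| :=
        intervalIntegral.abs_integral_le_integral_abs hπ.le
    _ ≤ ∫ y in (0 : ℝ)..Real.pi, (r * G y + b / r) * b :=
        intervalIntegral.integral_mono_on_of_le_Ioo hπ.le
          ((continuous_intervalIntegral_fst hDc 0 (Real.pi / 2)).abs.intervalIntegrable _ _)
          (Continuous.intervalIntegrable (by fun_prop) _ _) hpt
    _ = _ := by
        rw [intervalIntegral.integral_mul_const, intervalIntegral.integral_add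
          (Continuous.intervalIntegrable (by fun_prop) _ _) intervalIntegrable_const,
          intervalIntegral.integral_const_mul, intervalIntegral.integral_const, smul_eq_mul]
        ring

end Profile

/-! ### Translation to an arbitrary cell. -/

/-- Translation by `k` cells. -/
def cellShift (k : ℤ) (g : ℝ × ℝ → ℝ) (p : ℝ × ℝ) : ℝ := g (p.1 + k * Real.pi, p.2)

theorem cellShift_point (k : ℤ) (p : ℝ × ℝ) :
    (p.1 + k * Real.pi, p.2) = p + ((k : ℝ) * Real.pi, (0 : ℝ)) := by ext <;> simp

theorem cellShift_eq (k : ℤ) (g : ℝ × ℝ → ℝ) :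
    cellShift k g = fun p => g (p + ((k : ℝ) * Real.pi, (0 : ℝ))) := by
  funext p; rw [cellShift, cellShift_point]

theorem cellShift_mem_strip (k : ℤ) {p : ℝ × ℝ} (hp : p ∈ strip) :
    p + ((k : ℝ) * Real.pi, (0 : ℝ)) ∈ strip := by
  simpa [strip] using hp

theorem cellShift_add_one (k : ℤ) (g : ℝ × ℝ → ℝ) :
    cellShift (k + 1) g = fun p => cellShift k g (p.1 + Real.pi, p.2) := by
  funext p
  simp only [cellShift]
  congr 2
  push_cast; ring

theorem continuous_cellShift {g : ℝ × ℝ → ℝ} (hg : Continuous g) (k : ℤ) : Continuous (cellShift k g) := by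
  unfold cellShift; fun_prop

theorem contDiffOn_cellShift {g : ℝ × ℝ → ℝ} (hg : ContDiffOn ℝ 1 g strip) (k : ℤ) :
    ContDiffOn ℝ 1 (cellShift k g) strip := by
  rw [cellShift_eq]
  exact hg.comp (ContDiff.contDiffOn (by fun_prop)) fun p hp => cellShift_mem_strip k hp

theorem fderiv_cellShift (k : ℤ) (g : ℝ × ℝ → ℝ) (p : ℝ × ℝ) :
    fderiv ℝ (cellShift k g) p = fderiv ℝ g (p + ((k : ℝ) * Real.pi, (0 : ℝ))) := by
  rw [cellShift_eq, fderiv_comp_add_right]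

/-- The square occupied by the `k`-th cell. -/
def cellAt (k : ℤ) : Set (ℝ × ℝ) :=
  Ioo (k * Real.pi) ((k + 1) * Real.pi) ×ˢ Ioo 0 Real.pi

theorem measurableSet_cellAt (k : ℤ) : MeasurableSet (cellAt k) :=
  measurableSet_Ioo.prod measurableSet_Ioo

theorem cellAt_subset_strip (k : ℤ) : cellAt k ⊆ strip := prod_mono (subset_univ _) subset_rfl

theorem integral_cell_cellShift (k : ℤ) (g : ℝ × ℝ → ℝ) :
    ∫ p in cell, cellShift k g p = ∫ p in cellAt k, g p := by
  have hpre : (fun p : ℝ × ℝ => p + ((k : ℝ) * Real.pi, (0 : ℝ))) ⁻¹' cellAt k = cell := by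
    ext p
    simp only [cellAt, cell, mem_preimage, mem_prod, mem_Ioo, Prod.fst_add, Prod.snd_add, add_zero,
      add_mul, one_mul]
    constructor <;> rintro ⟨⟨h1, h2⟩, h3⟩ <;> exact ⟨⟨by linarith, by linarith⟩, h3⟩
  rw [cellShift_eq, ← hpre]
  exact (measurePreserving_add_right volume ((k : ℝ) * Real.pi, (0 : ℝ))).setIntegral_preimage_emb
    (measurableEmbedding_addRight _) g _

theorem pairwise_disjoint_cellAt : Pairwise (Function.onFun Disjoint cellAt) := by
  have key : ∀ i j : ℤ, i < j → Disjoint (cellAt i) (cellAt j) := fun i j hij => by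
    rw [Set.disjoint_left]
    intro p hi hj
    have h1 : (i : ℝ) + 1 ≤ j := by exact_mod_cast hij
    have h2 := mul_le_mul_of_nonneg_right h1 Real.pi_pos.le
    linarith [hi.1.2, hj.1.1]
  intro i j hij
  rcases lt_or_gt_of_ne hij with h | h
  · exact key i j h
  · exact (key j i h).symm

theorem sum_integral_cell_cellShift_le {g : ℝ × ℝ → ℝ} (hg : IntegrableOn g strip)
    (h0 : ∀ p ∈ strip, 0 ≤ g p) (s : Finset ℤ) :
    ∑ k ∈ s, ∫ p in cell, cellShift k g p ≤ ∫ p in strip, g p := by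
  simp only [integral_cell_cellShift]
  rw [← integral_biUnion_finset s (fun k _ => measurableSet_cellAt k)
    (pairwise_disjoint_cellAt.set_pairwise _) fun k _ => hg.mono_set (cellAt_subset_strip k)]
  refine setIntegral_mono_set hg ?_ (ae_of_all _ (iUnion₂_subset fun k _ => cellAt_subset_strip k))
  filter_upwards [ae_restrict_mem isOpen_strip.measurableSet] with p hp using h0 p hp

theorem integral_cell_eq {F : ℝ × ℝ → ℝ} (hF : Continuous F) :
    ∫ p in cell, F p = ∫ y in (0 : ℝ)..Real.pi, ∫ x in (0 : ℝ)..Real.pi, F (x, y) := by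
  rw [← setIntegral_Icc_prod_Icc hF Real.pi_pos.le Real.pi_pos.le]
  exact setIntegral_congr_set (Measure.set_prod_ae_eq Ioo_ae_eq_Icc Ioo_ae_eq_Icc)

theorem integral_two_cells {F : ℝ × ℝ → ℝ} (hF : Continuous F) :
    ∫ y in (0 : ℝ)..Real.pi, ∫ x in (0 : ℝ)..(2 * Real.pi), F (x, y) =
      (∫ p in cell, F p) + ∫ p in cell, F (p.1 + Real.pi, p.2) := by
  have hF' : Continuous fun p : ℝ × ℝ => F (p.1 + Real.pi, p.2) := by fun_prop
  rw [integral_cell_eq hF, integral_cell_eq hF', ← intervalIntegral.integral_add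
    ((continuous_intervalIntegral_fst hF 0 Real.pi).intervalIntegrable _ _)
    ((continuous_intervalIntegral_fst hF' 0 Real.pi).intervalIntegrable _ _)]
  refine intervalIntegral.integral_congr fun y _ => ?_
  have hint : ∀ u v : ℝ, IntervalIntegrable (fun x => F (x, y)) volume u v :=
    fun u v => Continuous.intervalIntegrable (by fun_prop) _ _
  simp only
  rw [← intervalIntegral.integral_add_adjacent_intervals (hint 0 Real.pi) (hint _ _),
    intervalIntegral.integral_comp_add_right (fun x => F (x, y)), zero_add, two_mul]

section Profile

variable {q P : ℝ} {f : ℝ → ℝ} {θ gx gy S : ℝ × ℝ → ℝ}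

/-- A translation by `π` reverses the flow. Hence the sign of `P` alternates, and the estimates of a
single cell must not depend on it. -/
theorem Profile.shift (h : Profile q P f θ gx gy S) (k : ℤ) :
    Profile q ((-1) ^ k * P) f (cellShift k θ) (cellShift k gx) (cellShift k gy) (cellShift k S) where
  cont := continuous_cellShift h.cont k
  cont_gx := continuous_cellShift h.cont_gx k
  cont_gy := continuous_cellShift h.cont_gy k
  mem_Icc p := h.mem_Icc _
  hasFDerivAt p hp := by
    have := h.hasFDerivAt _ (cellShift_mem_strip k hp)
    rw [← hasFDerivAt_comp_add_right] at this
    simpa only [cellShift_eq] using this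
  c1_gx := contDiffOn_cellShift h.c1_gx k
  c1_gy := contDiffOn_cellShift h.c1_gy k
  edge x := h.edge _
  equation p hp := by
    have := h.equation _ (cellShift_mem_strip k hp)
    rw [fderiv_cellShift, fderiv_cellShift]
    simp only [cellShift, cellShift_point]
    rw [this]
    simp only [Prod.fst_add, Prod.snd_add, add_zero, Real.sin_add_int_mul_pi,
      Real.cos_add_int_mul_pi]
    ring
  nonneg p hp := by
    have := h.nonneg _ (cellShift_mem_strip k hp)
    rwa [← cellShift_point] at this

end Profile

/-! ### The discrete descent and the optimization of parameters. -/

/-- A sequence that descends from `hi` to `lo` costs energy at each intermediate value and at each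
step. -/
theorem descent_le {a μ : ℤ → ℝ} {lo hi e E α α' β : ℝ} (hlh : lo < hi) (he : 0 < e)
    (hα : 0 ≤ α) (hα' : 0 ≤ α') (hβ : 0 ≤ β) (hE : ∀ s : Finset ℤ, ∑ k ∈ s, μ k ≤ E)
    (hmid : ∀ k, lo ≤ a k → a k ≤ hi → e ≤ μ k)
    (hstep : ∀ k, |a k - a (k + 1)| ≤ α * μ k + α' * μ (k + 1) + β)
    (hstart : ∃ i j, i ≤ j ∧ hi ≤ a i ∧ a j ≤ lo) :
    hi - lo ≤ (α + α') * E + (1 + E / e) * β := by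
  classical
  -- A shortest descent is chosen. By minimality all its `m - 1` interior values lie strictly
  -- between `lo` and `hi`, so each costs `e`, and `m ≤ 1 + E / e`.
  have hex : ∃ m : ℕ, ∃ i : ℤ, hi ≤ a i ∧ a (i + m) ≤ lo := by
    obtain ⟨i, j, hij, h1, h2⟩ := hstart
    exact ⟨(j - i).toNat, i, h1, by rwa [Int.toNat_of_nonneg (by omega), add_sub_cancel]⟩
  set m := Nat.find hex with hm
  obtain ⟨i, h1, h2⟩ := Nat.find_spec hex
  rw [← hm] at h2
  have hmin : ∀ n < m, ∀ i : ℤ, hi ≤ a i → lo < a (i + n) := fun n hn i hi' => by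
    by_contra! hcon
    exact Nat.find_min hex hn ⟨i, hi', hcon⟩
  have hsum : ∀ (c : ℤ) (n : ℕ), ∑ j ∈ Finset.range n, μ (c + j) ≤ E := fun c n => by
    refine le_trans (le_of_eq ?_) (hE ((Finset.range n).map
      ⟨fun j : ℕ => c + (j : ℤ), fun j₁ j₂ h => by simpa using h⟩))
    rw [Finset.sum_map]; rfl
  have hm1 : 1 ≤ m := by
    by_contra! h0
    have : m = 0 := by omega
    rw [this] at h2
    simp only [Nat.cast_zero, add_zero] at h2
    linarith
  have hE0 : 0 ≤ E := by simpa using hE ∅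
  have hcount : ((m - 1 : ℕ) : ℝ) * e ≤ E := by
    have : ∑ j ∈ Finset.range (m - 1), e ≤ ∑ j ∈ Finset.range (m - 1), μ (i + 1 + j) := by
      refine Finset.sum_le_sum fun j hj => ?_
      have hj := Finset.mem_range.1 hj
      have hlo := hmin (j + 1) (by omega) i h1
      have e1 : i + ((j + 1 : ℕ) : ℤ) = i + 1 + j := by push_cast; ring
      rw [e1] at hlo
      refine hmid _ hlo.le (le_of_not_ge fun hcon => ?_)
      have := hmin (m - (j + 1)) (by omega) _ hcon
      rw [show i + 1 + (j : ℤ) + ((m - (j + 1) : ℕ) : ℤ) = i + m by omega] at this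
      linarith
    rw [Finset.sum_const, Finset.card_range, nsmul_eq_mul] at this
    exact this.trans (hsum _ _)
  have hmle : (m : ℝ) ≤ 1 + E / e := by
    rw [Nat.cast_sub hm1, Nat.cast_one] at hcount
    have := (le_div_iff₀ he).2 hcount
    linarith
  have htel : a i - a (i + m) = ∑ j ∈ Finset.range m, (a (i + j) - a (i + j + 1)) := by
    have := Finset.sum_range_sub' (fun j : ℕ => a (i + j)) m
    simp only [Nat.cast_zero, add_zero, Nat.cast_add, Nat.cast_one, ← add_assoc] at this
    exact this.symm
  calc hi - lo ≤ a i - a (i + m) := by linarith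
    _ = ∑ j ∈ Finset.range m, (a (i + j) - a (i + j + 1)) := htel
    _ ≤ ∑ j ∈ Finset.range m, (α * μ (i + j) + α' * μ (i + 1 + j) + β) :=
        Finset.sum_le_sum fun j _ => by
          have := (le_abs_self _).trans (hstep (i + j))
          rwa [show i + (j : ℤ) + 1 = i + 1 + j by ring] at this ⊢
    _ = α * ∑ j ∈ Finset.range m, μ (i + j) + α' * ∑ j ∈ Finset.range m, μ (i + 1 + j) +
          m * β := by
        rw [Finset.sum_add_distrib, Finset.sum_add_distrib, Finset.mul_sum, Finset.mul_sum]
        simp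
    _ ≤ α * E + α' * E + (1 + E / e) * β := by
        gcongr
        · exact hsum _ _
        · exact hsum _ _
    _ = _ := by ring

/-- Optimization over the width `b` of the boundary layer and the weights `s`, `r`. -/
theorem exists_quartic_bound {d c c₂ K : ℝ} (hd : 0 < d) (hc : 0 < c) (hc₂ : 0 < c₂) (hK : 0 < K) :
    ∃ c' > 0, ∀ X Q P : ℝ, 1 ≤ Q → 0 < P → c ≤ X →
      (∀ s r b : ℝ, 0 < s → 0 < r → 0 < b → b ≤ 1 / 2 →
        d / 2 ≤ (4 / b * ((s / 2 + 1) / P) + 4 * r + 4 * r) * (3 * (X * Q)) +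
          (1 + 3 * (X * Q) / (c₂ * Q)) *
            (4 / b * (K / (2 * s * b) / P) + 4 * (Real.pi * b / r))) →
      c' * (P / Q ^ 2) ≤ X ^ 4 := by
  have hπ := Real.pi_pos
  set c₃ := 1 / c + 3 / c₂ with hc₃
  have hc₃0 : 0 < c₃ := by positivity
  set M := 24 + 4 * Real.pi * c₃ with hM
  have hM0 : 0 < M := by positivity
  -- The first bound lets `M γ ≤ d / 4` be absorbed into the left side `d / 2`; the second gives `γ
  -- ≤ X / 2`, hence `b ≤ 1 / 2`.
  set γ := min (d / (4 * M)) (c / 2) with hγ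
  have hγ0 : 0 < γ := lt_min (by positivity) (by positivity)
  have hγM : M * γ ≤ d / 4 := by
    have := (le_div_iff₀ (by positivity)).1 (min_le_left (d / (4 * M)) (c / 2))
    rw [← hγ] at this
    linarith
  have hγc : γ ≤ c / 2 := min_le_right _ _
  set N := 6 / γ ^ 3 + 12 / (c * γ ^ 2) + 2 * K * c₃ / γ ^ 3 with hN
  have hN0 : 0 < N := by positivity
  refine ⟨d / (4 * N), by positivity, fun X Q P hQ hP hX hmain => ?_⟩
  have hX0 : 0 < X := hc.trans_le hX
  have hQ0 : 0 < Q := by linarith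
  have hb : γ ^ 2 / (X ^ 2 * Q) ≤ 1 / 2 := by
    rw [div_le_iff₀ (by positivity)]
    have h1 : γ ^ 2 ≤ (X / 2) ^ 2 := pow_le_pow_left₀ hγ0.le (by linarith) 2
    nlinarith [mul_le_mul_of_nonneg_left hQ (sq_nonneg X)]
  -- The scaling makes both diffusive terms, of order `r X Q` and `X b / r`, equal to constants
  -- times `γ`. The two advective terms that depend on `s` then balance at order `X⁴ Q² / P`, and
  -- the remaining one is of order `X³ Q² / P`, smaller up to a factor `1 / c`.
  have h := hmain (X / γ) (γ / (X * Q)) (γ ^ 2 / (X ^ 2 * Q)) (by positivity) (by positivity)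
    (by positivity) hb
  have hlast : 1 + 3 * (X * Q) / (c₂ * Q) ≤ c₃ * X := by
    have e : 3 * (X * Q) / (c₂ * Q) = 3 / c₂ * X := by field_simp
    rw [e, hc₃, add_mul]
    have : 1 ≤ 1 / c * X := by rw [one_div_mul_eq_div, one_le_div hc]; exact hX
    linarith
  have hβ0 : 0 ≤ 4 / (γ ^ 2 / (X ^ 2 * Q)) * (K / (2 * (X / γ) * (γ ^ 2 / (X ^ 2 * Q))) / P) +
      4 * (Real.pi * (γ ^ 2 / (X ^ 2 * Q)) / (γ / (X * Q))) := by positivity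
  have h' := h.trans (add_le_add_right (mul_le_mul_of_nonneg_right hlast hβ0) _)
  have e1 : (4 / (γ ^ 2 / (X ^ 2 * Q)) * ((X / γ / 2 + 1) / P) + 4 * (γ / (X * Q)) +
      4 * (γ / (X * Q))) * (3 * (X * Q)) + c₃ * X *
      (4 / (γ ^ 2 / (X ^ 2 * Q)) * (K / (2 * (X / γ) * (γ ^ 2 / (X ^ 2 * Q))) / P) +
        4 * (Real.pi * (γ ^ 2 / (X ^ 2 * Q)) / (γ / (X * Q)))) =
      M * γ + Q ^ 2 / P * ((6 / γ ^ 3 + 2 * K * c₃ / γ ^ 3) * X ^ 4 + 12 / γ ^ 2 * X ^ 3) := by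
    rw [hM]; field_simp; ring
  rw [e1] at h'
  have h3 : 12 / γ ^ 2 * X ^ 3 ≤ 12 / (c * γ ^ 2) * X ^ 4 := by
    have : 12 / (c * γ ^ 2) * X ^ 4 - 12 / γ ^ 2 * X ^ 3 =
        12 / (c * γ ^ 2) * X ^ 3 * (X - c) := by field_simp
    have h4 : 0 ≤ 12 / (c * γ ^ 2) * X ^ 3 * (X - c) :=
      mul_nonneg (by positivity) (sub_nonneg.2 hX)
    linarith
  have h5 : d / 4 ≤ Q ^ 2 / P * (N * X ^ 4) := by
    have : Q ^ 2 / P * ((6 / γ ^ 3 + 2 * K * c₃ / γ ^ 3) * X ^ 4 + 12 / γ ^ 2 * X ^ 3) ≤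
        Q ^ 2 / P * (N * X ^ 4) := by
      refine mul_le_mul_of_nonneg_left ?_ (by positivity)
      rw [hN]; linarith
    linarith
  rw [div_mul_div_comm, div_le_iff₀ (by positivity)]
  rw [div_mul_eq_mul_div, div_le_div_iff₀ (by norm_num) hP] at h5
  linarith

/-! ### The laminar bound. -/

theorem ExpFront.exists_radius {θ : ℝ × ℝ → ℝ} (hθ : ExpFront θ) {ζ : ℝ} (hζ : 0 < ζ) :
    ∃ R : ℝ, 1 ≤ R ∧ ∀ x y, (R ≤ x → θ (x, y) < ζ) ∧ (x ≤ -R → 1 - ζ < θ (x, y)) := by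
  obtain ⟨lam, hlam, K, hK⟩ := hθ
  have h1 : Tendsto (fun R : ℝ => K * Real.exp (-lam * R)) atTop (𝓝 (K * 0)) := by
    refine Tendsto.const_mul K (Real.tendsto_exp_atBot.comp ?_)
    exact tendsto_id.const_mul_atTop_of_neg (by linarith)
  rw [mul_zero] at h1
  obtain ⟨R₀, hR₀⟩ := eventually_atTop.1 (h1.eventually_lt_const hζ)
  refine ⟨max R₀ 1, le_max_right _ _, fun x y => ⟨fun hx => ?_, fun hx => ?_⟩⟩
  · have h2 : R₀ ≤ x := (le_max_left _ _).trans hx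
    have h3 : (1 : ℝ) ≤ x := (le_max_right _ _).trans hx
    have h4 := hK (x, y)
    simp only [not_lt.2 (by linarith : (0 : ℝ) ≤ x), if_false, sub_zero,
      abs_of_nonneg (by linarith : (0 : ℝ) ≤ x)] at h4
    exact (le_abs_self _).trans_lt (h4.trans_lt (hR₀ x h2))
  · have h2 : R₀ ≤ -x := by linarith [le_max_left R₀ 1]
    have h3 : (1 : ℝ) ≤ -x := by linarith [le_max_right R₀ 1]
    have h4 := hK (x, y)
    simp only [(by linarith : x < 0), if_true, abs_of_neg (by linarith : x < 0)] at h4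
    have := neg_abs_le (θ (x, y) - 1)
    linarith [hR₀ (-x) h2]

theorem leftMean_const (b c : ℝ) : leftMean b (fun _ => c) = c * cellMass b := by
  simp only [leftMean, cellMass, intervalIntegral.integral_const_mul]

section Profile

variable {q P : ℝ} {f : ℝ → ℝ} {θ gx gy S : ℝ × ℝ → ℝ} {f₀ ζ θ₁ θ₄ : ℝ}

theorem Profile.integrableOn_energyDensity (h : Profile q P f θ gx gy S) (hq : 0 ≤ q)
    (hf : IsKPP f ∨ IsIgnition f) (hθ : ExpFront θ) :
    IntegrableOn (energyDensity q f θ gx gy) strip :=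
  Integrable.add (h.energy hq hf hθ).2.1 (h.integrableOn_reaction hf hθ)

theorem Profile.integral_energyDensity_le (h : Profile q P f θ gx gy S) (hq : 0 ≤ q)
    (hf : IsKPP f ∨ IsIgnition f) (hθ : ExpFront θ) :
    ∫ p in strip, energyDensity q f θ gx gy p ≤ 2 * ∫ p in strip, S p := by
  obtain ⟨-, h1, h2, h3⟩ := h.energy hq hf hθ
  have := integral_add h1 (h.integrableOn_reaction hf hθ)
  simp only [energyDensity]
  rw [this]
  linarith

/-- Every horizontal line crosses the reaction zone, so that the total source is at least of order
`√q`. -/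
theorem Profile.laminar_bound (h : Profile q P f θ gx gy S) (hq : 1 ≤ q) (hf₀ : 0 < f₀)
    (hζ : 0 < ζ) (hf : IsKPP f ∨ IsIgnition f) (hθ : ExpFront θ) (hlt : θ₁ < θ₄)
    (hr : ReactionBound f f₀ ζ θ₁ θ₄) :
    min f₀ (2 * ζ * Real.sqrt f₀) * Real.sqrt q ≤ ∫ p in strip, S p := by
  have hπ := Real.pi_gt_three
  have hq0 : 0 ≤ q := by linarith
  have hfc := (reaction_contDiffOn hf).continuousOn
  have hf0 : ∀ s ∈ Icc (0 : ℝ) 1, 0 ≤ f s := fun s hs => reaction_nonneg hf hs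
  have hc0 : 0 ≤ min f₀ (2 * ζ * Real.sqrt f₀) * Real.sqrt q :=
    mul_nonneg (le_min hf₀.le (by positivity)) (Real.sqrt_nonneg _)
  obtain ⟨R, hR1, hR⟩ := hθ.exists_radius hζ
  have hcont := h.cont
  have hEc := h.continuous_energyDensity hfc
  have hline : ∀ y ∈ Ioo 0 Real.pi, min f₀ (2 * ζ * Real.sqrt f₀) * Real.sqrt q ≤
      ∫ x in (-R)..R, energyDensity q f θ gx gy (x, y) := fun y hy => by
    have h1 := (hR R y).1 le_rfl
    have h2 := (hR (-R) y).2 le_rfl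
    have hl := hr.left
    have hu := hr.right
    obtain ⟨x, hx, hx'⟩ := intermediate_value_uIcc
      (Continuous.continuousOn (by fun_prop) (s := uIcc R (-R)) (f := fun x => θ (x, y)))
      (show θ₁ ∈ uIcc (θ (R, y)) (θ (-R, y)) by
        rw [uIcc_of_le (by linarith)]; exact ⟨by linarith, by linarith⟩)
    rw [uIcc_of_ge (by linarith)] at hx
    exact h.horizontal_action hq hf₀ hζ hfc hf0 hr (by linarith) hx hy
      ⟨hx'.ge, hx'.trans_le hlt.le⟩
  have hset : (Icc (-R) R ×ˢ Ioo 0 Real.pi : Set (ℝ × ℝ)) =ᵐ[volume]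
      (Icc (-R) R ×ˢ Icc 0 Real.pi : Set (ℝ × ℝ)) :=
    Measure.set_prod_ae_eq (Filter.EventuallyEq.refl _ _) Ioo_ae_eq_Icc
  have h1 : ∫ _ in (0 : ℝ)..Real.pi, min f₀ (2 * ζ * Real.sqrt f₀) * Real.sqrt q ≤
      ∫ y in (0 : ℝ)..Real.pi, ∫ x in (-R)..R, energyDensity q f θ gx gy (x, y) :=
    intervalIntegral.integral_mono_on_of_le_Ioo (by linarith) intervalIntegrable_const
      ((continuous_intervalIntegral_fst hEc (-R) R).intervalIntegrable _ _) hline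
  rw [intervalIntegral.integral_const, smul_eq_mul, sub_zero,
    ← setIntegral_Icc_prod_Icc hEc (by linarith) (by linarith),
    ← setIntegral_congr_set hset] at h1
  have h2 : ∫ p in Icc (-R) R ×ˢ Ioo 0 Real.pi, energyDensity q f θ gx gy p ≤
      ∫ p in strip, energyDensity q f θ gx gy p :=
    setIntegral_mono_set (h.integrableOn_energyDensity hq0 hf hθ)
      (ae_of_all _ fun p => h.energyDensity_nonneg hq0 hf0 p)
      (ae_of_all _ (prod_mono (subset_univ _) subset_rfl))
  -- The width `π` of the strip exceeds the factor `2` between energy and source.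
  have h3 := h.integral_energyDensity_le hq0 hf hθ
  nlinarith

end Profile

/-! ### Assembly of the cell estimates. -/

section Profile

variable {q P : ℝ} {f : ℝ → ℝ} {θ gx gy S : ℝ × ℝ → ℝ} {f₀ ζ θ₁ θ₄ : ℝ}

theorem integrableOn_cellShift {g : ℝ × ℝ → ℝ} (hg : IntegrableOn g strip) (k : ℤ) :
    IntegrableOn (cellShift k g) strip := by
  have hpre : (fun p : ℝ × ℝ => p + ((k : ℝ) * Real.pi, (0 : ℝ))) ⁻¹' strip = strip := by
    ext p; simp [strip]
  rw [cellShift_eq]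
  have := ((measurePreserving_add_right volume
    ((k : ℝ) * Real.pi, (0 : ℝ))).integrableOn_comp_preimage
    (measurableEmbedding_addRight _) (f := g) (s := strip)).2 hg
  rwa [hpre] at this

/-- Source and energy density. -/
def totalDensity (q : ℝ) (f : ℝ → ℝ) (θ gx gy S : ℝ × ℝ → ℝ) (p : ℝ × ℝ) : ℝ :=
  S p + energyDensity q f θ gx gy p

theorem Profile.integral_energyDensity_cell_le (h : Profile q P f θ gx gy S)
    (hf : ContinuousOn f (Icc 0 1)) (hS : IntegrableOn S strip) (k : ℤ) :
    ∫ p in cell, cellShift k (energyDensity q f θ gx gy) p ≤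
      ∫ p in cell, cellShift k (totalDensity q f θ gx gy S) p := by
  have h1 : IntegrableOn (cellShift k (energyDensity q f θ gx gy)) cell :=
    ((continuous_cellShift (h.continuous_energyDensity hf) k).continuousOn.integrableOn_compact
      (isCompact_Icc.prod isCompact_Icc)).mono_set cell_subset_Icc
  refine setIntegral_mono_on h1 (((integrableOn_cellShift hS k).mono_set cell_subset_strip).add h1)
    (isOpen_Ioo.prod isOpen_Ioo).measurableSet fun p hp => ?_
  have := (h.shift k).nonneg p (cell_subset_strip hp)
  simp only [cellShift, totalDensity] at this ⊢
  linarith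

/-- The mean temperatures of successive cells differ by little if the burning is weak. -/
theorem Profile.leftMean_step (h : Profile q P f θ gx gy S) (hq : 0 ≤ q) (hP : 0 < P)
    (hf : ContinuousOn f (Icc 0 1)) (hf0 : ∀ s ∈ Icc (0 : ℝ) 1, 0 ≤ f s)
    (hS : IntegrableOn S strip) {K : ℝ} {b s r : ℝ} (hb : 0 < b) (hb' : b ≤ 1 / 2) (hs : 0 < s)
    (hr : 0 < r)
    (hK : ∫ p in Icc 0 Real.pi ×ˢ Icc 0 Real.pi,
      (transportTestX b p ^ 2 + transportTestY b p ^ 2) ≤ K / b) (k : ℤ) :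
    |leftMean b (cellShift k θ) - leftMean b (cellShift (k + 1) θ)| ≤
      ((s / 2 + 1) * (∫ p in cell, cellShift k (totalDensity q f θ gx gy S) p) +
        K / (2 * s * b)) / P +
      b * (r * ((∫ p in cell, cellShift k (totalDensity q f θ gx gy S) p) +
        ∫ p in cell, cellShift (k + 1) (totalDensity q f θ gx gy S) p) + Real.pi * b / r) := by
  have hEc := h.continuous_energyDensity hf
  have h1 := (h.shift k).transport_bound hq hf hf0 (integrableOn_cellShift hS k) hb hb' hs hK
  have h2 := (h.shift k).jump_bound hq hf hf0 hr hb
  rw [← cellShift_add_one] at h2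
  have h3 : ∫ y in (0 : ℝ)..Real.pi, ∫ x in (0 : ℝ)..(2 * Real.pi),
      energyDensity q f (cellShift k θ) (cellShift k gx) (cellShift k gy) (x, y) ≤
      (∫ p in cell, cellShift k (totalDensity q f θ gx gy S) p) +
        ∫ p in cell, cellShift (k + 1) (totalDensity q f θ gx gy S) p := by
    have h4 := integral_two_cells (continuous_cellShift hEc k)
    have h5 := h.integral_energyDensity_cell_le hf hS k
    have h6 := h.integral_energyDensity_cell_le hf hS (k + 1)
    rw [cellShift_add_one k (energyDensity q f θ gx gy)] at h6
    exact h4.le.trans (add_le_add h5 h6)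
  rw [abs_mul, abs_zpow, abs_neg, abs_one, one_zpow, one_mul, abs_of_pos hP, mul_comm,
    ← le_div_iff₀ hP] at h1
  rw [abs_sub_comm] at h2
  -- The right half of cell `k` is the intermediate stop: transport links it to the left half of the
  -- same cell, and diffusion to the left half of cell `k + 1`.
  refine (abs_sub_le _ (rightMean b (cellShift k θ)) _).trans (add_le_add h1 (h2.trans ?_))
  gcongr

/-- A cell whose mean temperature is in the middle of `[θ₁, θ₄]` contains some energy. -/
theorem Profile.energy_of_middle (h : Profile q P f θ gx gy S) (hq : 1 ≤ q) (hf₀ : 0 < f₀)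
    (hζ : 0 < ζ) (hf : ContinuousOn f (Icc 0 1)) (hf0 : ∀ s ∈ Icc (0 : ℝ) 1, 0 ≤ f s)
    (hS : IntegrableOn S strip)
    (hr : ReactionBound f f₀ ζ θ₁ θ₄) {d : ℝ} (hd : 0 < d) (hdθ : θ₄ - θ₁ = d) {b : ℝ}
    (hb : 0 < b) (hb' : b ≤ 1 / 2) (k : ℤ)
    (h1 : θ₁ + d / 4 ≤ leftMean b (cellShift k θ) / cellMass b)
    (h4 : leftMean b (cellShift k θ) / cellMass b ≤ θ₄ - d / 4) :
    d / 16 * (min f₀ (2 * ζ * Real.sqrt f₀) * Real.sqrt q) ≤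
      ∫ p in cell, cellShift k (totalDensity q f θ gx gy S) p := by
  have hW : 0 < cellMass b := by linarith [le_cellMass hb hb']
  rw [le_div_iff₀ hW] at h1
  rw [div_le_iff₀ hW] at h4
  refine le_trans ?_ (h.integral_energyDensity_cell_le hf hS k)
  rw [integral_cell_eq (continuous_cellShift (h.continuous_energyDensity hf) k)]
  by_contra! hcon
  rcases (h.shift k).mean_dichotomy hq hf₀ hζ hf hf0 hr hd hdθ hb hb' hcon with h' | h' <;> linarith

theorem Profile.exists_leftMean_descent (h : Profile q P f θ gx gy S) (hζ : 0 < ζ)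
    (hθ : ExpFront θ) (hr : ReactionBound f f₀ ζ θ₁ θ₄) {b : ℝ} (hb : 0 < b) (hb' : b ≤ 1 / 2) :
    ∃ i j : ℤ, i ≤ j ∧ θ₄ ≤ leftMean b (cellShift i θ) / cellMass b ∧
      leftMean b (cellShift j θ) / cellMass b ≤ θ₁ := by
  have hπ := Real.pi_gt_three
  have hW : 0 < cellMass b := by linarith [le_cellMass hb hb']
  obtain ⟨R, hR1, hR⟩ := hθ.exists_radius hζ
  obtain ⟨n, hn⟩ := exists_nat_ge R
  -- The left half of cell `-(n + 1)` reaches up to `x = -(n + 1/2)π`, which with `n ≥ R ≥ 1` is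
  -- still at most `-R`.
  refine ⟨-(n + 1), n, by omega, ?_, ?_⟩
  · rw [le_div_iff₀ hW, ← leftMean_const]
    refine leftMean_mono (by fun_prop) (continuous_cellShift h.cont _) fun x hx y _ => ?_
    refine (le_trans ?_ ((hR (x + (-(n + 1) : ℤ) * Real.pi) y).2 ?_).le)
    · linarith [hr.right]
    · push_cast
      nlinarith [hx.2, (n.cast_nonneg : (0 : ℝ) ≤ n)]
  · rw [div_le_iff₀ hW, ← leftMean_const]
    refine leftMean_mono (continuous_cellShift h.cont _) (by fun_prop) fun x hx y _ => ?_
    refine (((hR (x + (n : ℤ) * Real.pi) y).1 ?_).le.trans ?_)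
    · push_cast
      nlinarith [hx.1, (n.cast_nonneg : (0 : ℝ) ≤ n)]
    · linarith [hr.left]

end Profile

/-- Lower bounds on the total source of a front, in units of the laminar one `√q`. -/
theorem exists_source_bound {f₀ ζ d : ℝ} (hf₀ : 0 < f₀) (hζ : 0 < ζ) (hd : 0 < d) :
    ∃ c > 0, ∃ c' > 0, ∀ (f : ℝ → ℝ) (θ₁ θ₄ q P : ℝ) (θ gx gy S : ℝ × ℝ → ℝ),
      IsKPP f ∨ IsIgnition f → θ₄ - θ₁ = d → ReactionBound f f₀ ζ θ₁ θ₄ → 1 ≤ q → 0 < P →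
      Profile q P f θ gx gy S → ExpFront θ →
      c ≤ (∫ p in strip, S p) / Real.sqrt q ∧
        c' * (P / q) ≤ ((∫ p in strip, S p) / Real.sqrt q) ^ 4 := by
  have hc0 : 0 < min f₀ (2 * ζ * Real.sqrt f₀) := lt_min hf₀ (by positivity)
  set c := min f₀ (2 * ζ * Real.sqrt f₀) with hc
  obtain ⟨K, hK, hKb⟩ := exists_transportTest_bound
  obtain ⟨c', hc', hopt⟩ := exists_quartic_bound hd hc0 (by positivity : 0 < d / 16 * c) hK
  refine ⟨c, hc0, c', hc', fun f θ₁ θ₄ q P θ gx gy S hf hdθ hr hq hP h hθ => ?_⟩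
  have hq0 : 0 < q := by linarith
  have hQ : 0 < Real.sqrt q := Real.sqrt_pos.2 hq0
  have hQ1 : 1 ≤ Real.sqrt q := Real.one_le_sqrt.2 hq
  have hfc := (reaction_contDiffOn hf).continuousOn
  have hf0 : ∀ s ∈ Icc (0 : ℝ) 1, 0 ≤ f s := fun s hs => reaction_nonneg hf hs
  have hS := (h.energy hq0.le hf hθ).1
  have hEI := h.integrableOn_energyDensity hq0.le hf hθ
  have hlam : c ≤ (∫ p in strip, S p) / Real.sqrt q :=
    (le_div_iff₀ hQ).2 (h.laminar_bound hq hf₀ hζ hf hθ (by linarith) hr)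
  refine ⟨hlam, ?_⟩
  set X := (∫ p in strip, S p) / Real.sqrt q with hX
  have hXQ : ∫ p in strip, S p = X * Real.sqrt q := by rw [hX]; field_simp
  have hX0 : 0 < X := hc0.trans_le hlam
  have key := hopt X (Real.sqrt q) P hQ1 hP hlam fun s r b hs hr' hb hb' => ?_
  · rwa [Real.sq_sqrt hq0.le] at key
  have hW := le_cellMass hb hb'
  have hW0 : 0 < cellMass b := by linarith
  have hMI : IntegrableOn (totalDensity q f θ gx gy S) strip := hS.add hEI
  have hM0 : ∀ p ∈ strip, 0 ≤ totalDensity q f θ gx gy S p := fun p hp =>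
    add_nonneg (h.nonneg p hp) (h.energyDensity_nonneg hq0.le hf0 p)
  -- One part from the source and two from the energy.
  have hMle : ∫ p in strip, totalDensity q f θ gx gy S p ≤ 3 * (X * Real.sqrt q) := by
    have h1 := integral_add hS hEI
    have h2 := h.integral_energyDensity_le hq0.le hf hθ
    simp only [totalDensity]
    linarith
  set μ : ℤ → ℝ := fun k => ∫ p in cell, cellShift k (totalDensity q f θ gx gy S) p with hμ
  have hμ0 : ∀ k, 0 ≤ μ k := fun k => by
    refine setIntegral_nonneg (isOpen_Ioo.prod isOpen_Ioo).measurableSet fun p hp => ?_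
    rw [cellShift, cellShift_point]
    exact hM0 _ (cellShift_mem_strip k (cell_subset_strip hp))
  obtain ⟨i, j, hij, hi, hj⟩ := h.exists_leftMean_descent hζ hθ hr hb hb'
  have hstep : ∀ k, |leftMean b (cellShift k θ) / cellMass b -
      leftMean b (cellShift (k + 1) θ) / cellMass b| ≤
      (4 / b * ((s / 2 + 1) / P) + 4 * r) * μ k + (4 * r) * μ (k + 1) +
        (4 / b * (K / (2 * s * b) / P) + 4 * (Real.pi * b / r)) := fun k => by
    have h1 := h.leftMean_step hq0.le hP hfc hf0 hS hb hb' hs hr' (hKb b hb hb') k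
    have h2 := hμ0 k
    have h3 := hμ0 (k + 1)
    rw [← sub_div, abs_div, abs_of_pos hW0, div_le_iff₀ hW0]
    refine h1.trans ?_
    have hπ := Real.pi_pos
    -- The factors `4 / b` come from the lower bound `b / 4` on the mass of a cell. In the jump term
    -- they cancel the factor `b` of `Profile.jump_bound`.
    calc _ = ((4 / b * ((s / 2 + 1) / P) + 4 * r) * μ k + (4 * r) * μ (k + 1) +
        (4 / b * (K / (2 * s * b) / P) + 4 * (Real.pi * b / r))) * (b / 4) := by
          simp only [hμ]; field_simp; ring
      _ ≤ _ := mul_le_mul_of_nonneg_left hW (by positivity)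
  have hπ := Real.pi_pos
  -- The thresholds are those of `Profile.energy_of_middle`; their distance is `d / 2`.
  have hdes := descent_le (a := fun k => leftMean b (cellShift k θ) / cellMass b) (μ := μ)
    (lo := θ₁ + d / 4) (hi := θ₄ - d / 4) (e := d / 16 * c * Real.sqrt q)
    (E := 3 * (X * Real.sqrt q)) (by linarith) (by positivity) (by positivity) (by positivity)
    (by positivity) (fun t => (sum_integral_cell_cellShift_le hMI hM0 t).trans hMle)
    (fun k h1 h4 => by
      rw [mul_assoc]
      exact h.energy_of_middle hq hf₀ hζ hfc hf0 hS hr hd hdθ hb hb' k h1 h4)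
    hstep ⟨i, j, hij, by linarith, by linarith⟩
  refine le_trans (by linarith) hdes

/-! ### Return to the original variables. -/

open scoped Pointwise in
theorem smul_strip {H : ℝ} (hH : 0 < H) : H • strip = openStrip H := by
  ext p
  rw [mem_smul_set_iff_inv_smul_mem₀ hH.ne', ← smul_mem_openStrip_iff hH, smul_inv_smul₀ hH.ne']

theorem integrableOn_comp_smul_strip {H : ℝ} (hH : 0 < H) {g : ℝ × ℝ → ℝ} :
    IntegrableOn (fun p => g (H • p)) strip ↔ IntegrableOn g (openStrip H) := by
  rw [← integrable_indicator_iff isOpen_strip.measurableSet,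
    ← integrable_indicator_iff (isOpen_openStrip H).measurableSet,
    ← integrable_comp_smul_iff volume ((openStrip H).indicator g) hH.ne']
  refine iff_of_eq (congrArg (fun k => Integrable k volume) (funext fun p => ?_))
  by_cases hp : p ∈ strip
  · rw [indicator_of_mem hp, indicator_of_mem ((smul_mem_openStrip_iff hH).2 hp)]
  · rw [indicator_of_notMem hp, indicator_of_notMem (mt (smul_mem_openStrip_iff hH).1 hp)]

theorem integral_comp_smul_strip {H : ℝ} (hH : 0 < H) (g : ℝ × ℝ → ℝ) :
    H ^ 2 * ∫ p in strip, g (H • p) = ∫ p in openStrip H, g p := by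
  rw [Measure.setIntegral_comp_smul_of_pos volume g strip hH, smul_strip hH,
    Module.finrank_prod, Module.finrank_self, smul_eq_mul, ← mul_assoc,
    mul_inv_cancel₀ (by positivity), one_mul]

/-- Lower bounds on the burning rate, in units of the laminar flame speed. -/
theorem exists_burningRate_bound {f₀ ζ d : ℝ} (hf₀ : 0 < f₀) (hζ : 0 < ζ) (hd : 0 < d) :
    ∃ c > 0, ∃ c' > 0, ∀ (f : ℝ → ℝ) (θ₁ θ₄ κ v₀ U H : ℝ) (T : ℝ → ℝ × ℝ → ℝ),
      IsKPP f ∨ IsIgnition f → θ₄ - θ₁ = d → ReactionBound f f₀ ζ θ₁ θ₄ →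
      0 < κ → 0 < v₀ → 0 < U → 0 < H → κ / v₀ / H ≤ 1 → IsSolution κ v₀ U H f T →
      NeumannCondition H T ∨ PeriodicCondition H T → InitiallyIncreasing κ v₀ U H f (T 0) →
      ExponentialDecay H (T 0) → ∀ t, 0 < t →
      IntegrableOn (timeDeriv T t) (openStrip H) ∧ c ≤ burningRate H T t / v₀ ∧
        c' * (reactionTime κ v₀ / turnoverTime U H) ≤ (burningRate H T t / v₀) ^ 4 := by
  obtain ⟨c, hc, c', hc', hmain⟩ := exists_source_bound hf₀ hζ hd
  refine ⟨c, hc, c', hc', fun f θ₁ θ₄ κ v₀ U H T hf hdθ hr hκ hv₀ hU hH hl hT hb hi hdec t ht => ?_⟩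
  obtain ⟨gx, gy, h⟩ := hT.profile hκ hU.le hH hf hb hi ht
  have hθ := hT.expFront hκ hU.le hH hf hb hi hdec ht.le
  -- The condition `l / H ≤ 1` says that `√q = H / l` is at least `1`.
  have hQ : 1 ≤ v₀ * H / κ := by
    rw [div_div, div_le_one (by positivity)] at hl
    rwa [one_le_div hκ]
  have hQ0 : 0 < v₀ * H / κ := by positivity
  have hI := (h.energy (sq_nonneg _) hf hθ).1
  have hI' : IntegrableOn (fun p => timeDeriv T t (H • p)) strip :=
    (integrable_const_mul_iff (Ne.isUnit (by positivity)) _).1 hI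
  obtain ⟨h1, h2⟩ := hmain f θ₁ θ₄ ((v₀ * H / κ) ^ 2) (U * H / κ) _ gx gy _ hf hdθ hr
    (one_le_pow₀ hQ) (by positivity) h hθ
  -- The dilation turns the total source into `(H / κ) V`, and division by `√q = v₀ H / κ` leaves `V
  -- / v₀`.
  have e1 : (∫ p in strip, H ^ 2 / κ * timeDeriv T t (H • p)) / Real.sqrt ((v₀ * H / κ) ^ 2) =
      burningRate H T t / v₀ := by
    rw [Real.sqrt_sq hQ0.le, integral_const_mul, burningRate, ← integral_comp_smul_strip hH]
    field_simp
  have e2 : U * H / κ / (v₀ * H / κ) ^ 2 = reactionTime κ v₀ / turnoverTime U H := by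
    rw [reactionTime, turnoverTime]; field_simp
  rw [e1] at h1 h2
  rw [e2] at h2
  exact ⟨(integrableOn_comp_smul_strip hH).1 hI', h1, h2⟩

end CellularFlow

end

theorem theorem6 (f₀ ζ d : ℝ) (hf₀ : 0 < f₀) (hζ : 0 < ζ) (hd : 0 < d) :
    ∃ C₁ > 0, ∃ C₂ > 0,
      ∀ (f : ℝ → ℝ), CellularFlow.IsKPP f ∨ CellularFlow.IsIgnition f →
      ∀ (θ₁ θ₄ : ℝ), θ₄ - θ₁ = d → CellularFlow.ReactionBound f f₀ ζ θ₁ θ₄ →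
      ∀ (κ v₀ U H : ℝ), 0 < κ → 0 < v₀ → 0 < U → 0 < H →
        1 ≤ U * H / κ → κ / v₀ / H ≤ 1 →
      ∀ (T : ℝ → ℝ × ℝ → ℝ),
        CellularFlow.IsSolution κ v₀ U H f T →
        CellularFlow.FrontCondition H T →
        CellularFlow.NeumannCondition H T ∨ CellularFlow.PeriodicCondition H T →
        CellularFlow.InitiallyIncreasing κ v₀ U H f (T 0) →
        CellularFlow.ExponentialDecay H (T 0) →
      ∀ t : ℝ, 0 < t →
        IntegrableOn (CellularFlow.timeDeriv T t) (CellularFlow.openStrip H) ∧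
        (CellularFlow.reactionTime κ v₀ ≤ CellularFlow.turnoverTime U H →
          (C₁ * Real.sqrt (CellularFlow.reactionTime κ v₀ / CellularFlow.turnoverTime U H) + C₂)
              * v₀
            ≤ CellularFlow.burningRate H T t) ∧
        (CellularFlow.turnoverTime U H ≤ CellularFlow.reactionTime κ v₀ →
          (C₁ * (CellularFlow.reactionTime κ v₀ / CellularFlow.turnoverTime U H) ^ (1 / 5 : ℝ)
              + C₂) * v₀
            ≤ CellularFlow.burningRate H T t) := by
  obtain ⟨c, hc, c', hc', hmain⟩ := CellularFlow.exists_burningRate_bound hf₀ hζ hd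
  -- With `k ≤ 1` one has `k⁴ ≤ k ≤ c'`, which avoids a fourth root of `c'`.
  set k := min c' 1 with hk
  have hk0 : 0 < k := lt_min hc' one_pos
  -- One half of `X ≥ c` supplies `C₂`. The first term is paid by the other half when `√ρ ≤ 1`, and
  -- by half of `X ≥ k ρ^{1/5}` when `ρ ≥ 1`.
  refine ⟨min (c / 2) (k / 2), by positivity, c / 2, by positivity,
    fun f hf θ₁ θ₄ hdθ hr κ v₀ U H hκ hv₀ hU hH _ hl T hT _ hb hi hdec t ht => ?_⟩
  obtain ⟨hI, h1, h2⟩ := hmain f θ₁ θ₄ κ v₀ U H T hf hdθ hr hκ hv₀ hU hH hl hT hb hi hdec t ht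
  have hτc : 0 < CellularFlow.reactionTime κ v₀ := by unfold CellularFlow.reactionTime; positivity
  have hτu : 0 < CellularFlow.turnoverTime U H := by unfold CellularFlow.turnoverTime; positivity
  set X := CellularFlow.burningRate H T t / v₀ with hX
  set ρ := CellularFlow.reactionTime κ v₀ / CellularFlow.turnoverTime U H with hρ
  have hρ0 : 0 < ρ := div_pos hτc hτu
  have hX0 : 0 < X := hc.trans_le h1
  have hconv : ∀ z, z ≤ X → z * v₀ ≤ CellularFlow.burningRate H T t := fun z hz =>
    (le_div_iff₀ hv₀).1 hz
  refine ⟨hI, fun hle => hconv _ ?_, fun hle => hconv _ ?_⟩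
  · have h3 : Real.sqrt ρ ≤ 1 := Real.sqrt_le_one.2 ((div_le_one hτu).2 hle)
    have h4 : min (c / 2) (k / 2) * Real.sqrt ρ ≤ c / 2 * 1 :=
      mul_le_mul (min_le_left _ _) h3 (Real.sqrt_nonneg _) (by positivity)
    linarith
  · have h3 : 1 ≤ ρ := (one_le_div hτu).2 hle
    -- The bound `X⁴ ≥ c' ρ` is stronger than needed: for `ρ ≥ 1` the fourth power `ρ^{4/5}` is at
    -- most `ρ`.
    have h4 : k * ρ ^ (1 / 5 : ℝ) ≤ X := by
      refine le_of_pow_le_pow_left₀ (n := 4) (by norm_num) hX0.le (le_trans ?_ h2)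
      rw [mul_pow, ← Real.rpow_mul_natCast hρ0.le]
      refine mul_le_mul ?_ ?_ (by positivity) hc'.le
      · exact (pow_le_of_le_one hk0.le (min_le_right _ _) (by norm_num)).trans (min_le_left _ _)
      · exact (Real.rpow_le_rpow_of_exponent_le h3 (by norm_num)).trans_eq (Real.rpow_one ρ)
    have h5 : min (c / 2) (k / 2) * ρ ^ (1 / 5 : ℝ) ≤ k / 2 * ρ ^ (1 / 5 : ℝ) :=
      mul_le_mul_of_nonneg_right (min_le_right _ _) (by positivity)
    linarith
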